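/- Let $\Omega$ be a measure space, $Z$ an index set, $2\le p<\infty$ and $q=(p/2)^*=\frac{p}{p-2}$ (so $q=\infty$ if $p=2$). Write $S^p$ for the Schatten class of operators on $\ell^2$, with $\|T\|_{S^p}=(\operatorname{Tr}|T|^p)^{1/p}$ for $p<\infty$, and $S^\infty=B(\ell^2)$. For a measurable kernel $k:\Omega\times\Omega\to\mathbb C$ let $(\mathcal C_kf)(x)=\int_\Omega k(x,y)f(y)\,dy$, the integral being required to converge absolutely for almost every $x$, for every scalar $f$ in the $L^r$-space considered. For each $z\in Z$ let $\mathcal C_{k_z}$ be a bounded integral operator on $L^p(\Omega)$. For a family $(x_z)_{z\in Z}$ in $L^q(\Omega,S^q)$ put $\|\sup^+_{z}x_z\|_{L^q(\Omega,S^q)}=\inf\|a\|_{L^{2q}(\Omega,S^{2q})}\,\sup_z\|y_z\|_\infty\,\|b\|_{L^{2q}(\Omega,S^{2q})}$, the infimum being over all factorizations $x_z=a\,y_z\,b$ ($z\in Z$) with $a,b\in L^{2q}(\Omega,S^{2q})$ and $(y_z)$ a bounded family in $L^\infty(\Omega)\overline\otimes B(\ell^2)$; define $\|\sup_z^+x_z\|_{L^q(\Omega)}$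 in the same way with scalar-valued $a,b\in L^{2q}(\Omega)$ and $y_z\in L^\infty(\Omega)$. The family $(k_z)_{z\in Z}$ admits an $L^q(S^q)$-square-max decomposition if $k_z=s_zm_z$ pointwise with measurable $s_z,m_z:\Omega\times\Omega\to\mathbb C$ such that $\sup_{z}\sup_{x\in\Omega}\|s_z(x,\cdot)\|_{L^2(\Omega)}<\infty$ and such that the integral operators $(\mathcal C_{|m_z|^2})^*$ with kernels $(x,y)\mapsto|m_z(y,x)|^2$ are defined on $L^q(\Omega)$ and satisfy, for some constant $C$, $$\Big\|\sup_{z\in Z}{}^{+}\big((\mathcal C_{|m_z|^2})^*\otimes \mathrm{Id}\big)(u)\Big\|_{L^q(\Omega,S^q)}\le C\|u\|_{L^q(\Omega,S^q)},\qquad u\in L^q(\Omega,S^q).$$ It admits an $L^q$-square-max decomposition if the same holds with $L^q(\Omega)$ in place of $L^q(\Omega,S^q)$ in the last estimate. A family $(T_z)_{z\in Z}$ of operators on a Banach space $X$ is R-bounded if there is a constant $C$ such that $\big(\mathbb E\|\sum_{j=1}^N\varepsilon_jT_{z_j}f_j\|_X^2\big)^{1/2}\le C\big(\mathbb E\|\sum_{j=1}^N\varepsilon_jf_j\|_X^2\big)^{1/2}$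 for all $N$, all $z_1,\dots,z_N\in Z$ and all $f_1,\dots,f_N\in X$, where the $\varepsilon_j$ are independent random signs. If $X=L^p(\Omega,S^p)$, the family is column-bounded if there is a constant $C$ such that $\big\|(\sum_j|T_{z_j}f_j|^2)^{1/2}\big\|_{L^p(\Omega,S^p)}\le C\big\|(\sum_j|f_j|^2)^{1/2}\big\|_{L^p(\Omega,S^p)}$ for all such choices, where $|f|^2=f^*f$, and row-bounded if the same holds with $|(T_{z_j}f_j)^*|^2$ and $|f_j^*|^2$ in place of $|T_{z_j}f_j|^2$ and $|f_j|^2$. **Theorem 9.4.** If $(k_z)_{z\in Z}$ admits an $L^{q}(S^{q})$-square-max decomposition, then each $\mathcal C_{k_z}\otimes\mathrm{Id}_{S^p}$ is a bounded operator on $L^p(\Omega,S^p)$ and the family $(\mathcal C_{k_z}\otimes\mathrm{Id}_{S^p})_{z\in Z}$ is column-bounded, row-bounded and R-bounded on $L^p(\Omega,S^p)$. **Scalar version (Proposition 9.2).** If $(k_z)_{z\in Z}$ admits an $L^{q}$-square-max decomposition, then the family $(\mathcal C_{k_z})_{z\in Z}$ is R-bounded on $L^p(\Omega)$. -/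

import Mathlib

open MeasureTheory
open scoped ENNReal NNReal InnerProductSpace

noncomputable section

namespace SquareMax

/-! ### Schatten norms of operators on `ℓ²` -/

/-- The Hilbert space `ℓ²(ℕ)`. -/
def L2 : Type := lp (fun _ : ℕ => ℂ) 2

instance : NormedAddCommGroup L2 :=
  inferInstanceAs (NormedAddCommGroup (lp (fun _ : ℕ => ℂ) 2))

instance : InnerProductSpace ℂ L2 :=
  inferInstanceAs (InnerProductSpace ℂ (lp (fun _ : ℕ => ℂ) 2))

instance : CompleteSpace L2 :=
  inferInstanceAs (CompleteSpace (lp (fun _ : ℕ => ℂ) 2))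

/-- The algebra `B(ℓ²)` of bounded operators. -/
abbrev Op : Type := L2 →L[ℂ] L2

/-- The canonical basis of `ℓ²`. -/
def stdBasis : HilbertBasis ℕ ℂ L2 :=
  HilbertBasis.ofRepr (LinearIsometryEquiv.refl ℂ (lp (fun _ : ℕ => ℂ) 2))

/-- The trace `∑ ⟨e_n, T e_n⟩` of a positive operator, with values in `[0, ∞]`. -/
def opTrace (T : Op) : ℝ≥0∞ :=
  ∑' n, ENNReal.ofReal (⟪stdBasis n, T (stdBasis n)⟫_ℂ).re

/-- The Schatten norm: `(Tr |T|^p)^(1/p)` for `0 < p < ∞`, and the operator norm for `p = ∞`.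
The Schatten space `S^p` consists of the `T` with `schattenNorm p T < ∞`
(so `S^∞` is `B(ℓ²)`). -/
def schattenNorm (p : ℝ≥0∞) (T : Op) : ℝ≥0∞ :=
  if p = ∞ then ‖T‖ₑ else opTrace (CFC.abs T ^ p.toReal) ^ (1 / p.toReal)

/-! ### Families of operators: R-boundedness -/

/-- The average `(𝔼 ‖∑ ε_j v_j‖²)^(1/2)` over independent Rademacher signs `ε_j`, for a
`[0, ∞]`-valued norm `nrm`. -/
def rademacherNorm {V : Type*} [AddCommGroup V] (nrm : V → ℝ≥0∞) {N : ℕ} (v : Fin N → V) :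
    ℝ≥0∞ :=
  ((∑ ε : Fin N → ℤˣ, nrm (∑ j, ((ε j : ℤˣ) : ℤ) • v j) ^ 2) / 2 ^ N) ^ (1 / 2 : ℝ)

/-- R-boundedness of a family of operators on the space `{v | mem v}` with norm `nrm`
(functions are not identified here when they agree almost everywhere). -/
def IsRBounded {V Z : Type*} [AddCommGroup V] (mem : V → Prop) (nrm : V → ℝ≥0∞)
    (T : Z → V → V) : Prop :=
  ∃ C : ℝ≥0, ∀ (N : ℕ) (z : Fin N → Z) (v : Fin N → V), (∀ j, mem (v j)) →
    rademacherNorm nrm (fun j => T (z j) (v j)) ≤ C * rademacherNorm nrm v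

section Space

variable {Ω : Type*} [MeasurableSpace Ω]

/-! ### The spaces `L^p(Ω, S^p)` and `L^∞(Ω) ⊗ B(ℓ²)` -/

/-- The norm of `L^p(Ω, S^p)`. -/
def schattenLpNorm (p : ℝ≥0∞) (μ : Measure Ω) (f : Ω → Op) : ℝ≥0∞ :=
  eLpNorm (fun x => schattenNorm p (f x)) p μ

/-- `f` represents an element of the Bochner space `L^p(Ω, S^p)`. For `p < ∞` the space `S^p` is
separable and embeds continuously into `B(ℓ²)`, so that for functions which take their values
in `S^p` almost everywhere, strong measurability in `S^p` and in `B(ℓ²)` are the same. -/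
structure MemSchattenLp (p : ℝ≥0∞) (μ : Measure Ω) (f : Ω → Op) : Prop where
  aestronglyMeasurable : AEStronglyMeasurable f μ
  norm_lt_top : schattenLpNorm p μ f < ∞

/-- `y` represents an element of the von Neumann algebra `L^∞(Ω) ⊗ B(ℓ²)`: it is measurable for
the weak operator topology and essentially bounded. -/
structure MemVN (μ : Measure Ω) (y : Ω → Op) : Prop where
  weaklyMeasurable : ∀ ξ η : L2, AEStronglyMeasurable (fun x => ⟪ξ, y x η⟫_ℂ) μ
  norm_lt_top : eLpNorm (fun x => ‖y x‖ₑ) ∞ μ < ∞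

/-- The norm of the column `(f_j)`: `‖(∑ |f_j|²)^(1/2)‖` in `L^p(Ω, S^p)`, `|f|² = f* f`. -/
def columnNorm (p : ℝ≥0∞) (μ : Measure Ω) {N : ℕ} (f : Fin N → Ω → Op) : ℝ≥0∞ :=
  schattenLpNorm p μ fun x => CFC.sqrt (∑ j, star (f j x) * f j x)

/-- The norm of the row `(f_j)`: `‖(∑ |f_j*|²)^(1/2)‖` in `L^p(Ω, S^p)`, `|f*|² = f f*`. -/
def rowNorm (p : ℝ≥0∞) (μ : Measure Ω) {N : ℕ} (f : Fin N → Ω → Op) : ℝ≥0∞ :=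
  schattenLpNorm p μ fun x => CFC.sqrt (∑ j, f j x * star (f j x))

/-- Column-boundedness on `L^p(Ω, S^p)`. -/
def IsColBounded {Z : Type*} (p : ℝ≥0∞) (μ : Measure Ω) (T : Z → (Ω → Op) → (Ω → Op)) : Prop :=
  ∃ C : ℝ≥0, ∀ (N : ℕ) (z : Fin N → Z) (f : Fin N → Ω → Op), (∀ j, MemSchattenLp p μ (f j)) →
    columnNorm p μ (fun j => T (z j) (f j)) ≤ C * columnNorm p μ f

/-- Row-boundedness on `L^p(Ω, S^p)`. -/
def IsRowBounded {Z : Type*} (p : ℝ≥0∞) (μ : Measure Ω) (T : Z → (Ω → Op) → (Ω → Op)) : Prop :=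
  ∃ C : ℝ≥0, ∀ (N : ℕ) (z : Fin N → Z) (f : Fin N → Ω → Op), (∀ j, MemSchattenLp p μ (f j)) →
    rowNorm p μ (fun j => T (z j) (f j)) ≤ C * rowNorm p μ f

/-! ### Integral operators -/

/-- The integral operator `(C_k f)(x) = ∫ k(x, y) f(y) dy` on functions with values in `E`.
For `E = ℂ` it is `C_k`, for `E = B(ℓ²)` it is `C_k ⊗ Id`. -/
def intOp {E : Type*} [NormedAddCommGroup E] [NormedSpace ℂ E] (μ : Measure Ω)
    (k : Ω → Ω → ℂ) (f : Ω → E) (x : Ω) : E :=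
  ∫ y, k x y • f y ∂μ

/-- On elementary tensors, `intOp` with values in `B(ℓ²)` is `C_k ⊗ Id`. -/
theorem intOp_smul_const (μ : Measure Ω) (k : Ω → Ω → ℂ) (φ : Ω → ℂ) (v : Op) (x : Ω) :
    intOp μ k (fun y => φ y • v) x = intOp μ k φ x • v := by
  simp only [intOp, smul_eq_mul, smul_smul]
  exact integral_smul_const _ _

/-- `C_k f` is given by an absolutely convergent integral, for all `f` in `L^p(Ω)`. -/
def IsDefinedOn (p : ℝ≥0∞) (μ : Measure Ω) (k : Ω → Ω → ℂ) : Prop :=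
  ∀ f : Ω → ℂ, MemLp f p μ → ∀ᵐ x ∂μ, Integrable (fun y => k x y * f y) μ

/-- `k` is the kernel of a bounded integral operator `C_k` on `L^p(Ω)`. -/
structure IsBoundedKernel (p : ℝ≥0∞) (μ : Measure Ω) (k : Ω → Ω → ℂ) : Prop where
  measurable : Measurable (Function.uncurry k)
  isDefinedOn : IsDefinedOn p μ k
  bounded : ∃ C : ℝ≥0, ∀ f : Ω → ℂ, MemLp f p μ →
    MemLp (intOp μ k f) p μ ∧ eLpNorm (intOp μ k f) p μ ≤ C * eLpNorm f p μ

/-- `C_k ⊗ Id` is a bounded operator on `L^p(Ω, S^p)`, given by absolutely convergent integrals. -/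
def TensorBounded (p : ℝ≥0∞) (μ : Measure Ω) (k : Ω → Ω → ℂ) : Prop :=
  ∃ C : ℝ≥0, ∀ f : Ω → Op, MemSchattenLp p μ f →
    (∀ᵐ x ∂μ, Integrable (fun y => k x y • f y) μ) ∧ MemSchattenLp p μ (intOp μ k f) ∧
      schattenLpNorm p μ (intOp μ k f) ≤ C * schattenLpNorm p μ f

/-- The kernel `(x, y) ↦ |m(y, x)|²` of the adjoint of the operator with kernel `|m|²`. -/
def adjSqKernel (m : Ω → Ω → ℂ) (x y : Ω) : ℂ := ((‖m y x‖ ^ 2 : ℝ) : ℂ)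

/-! ### Noncommutative maximal norms -/

/-- A factorization `X_z = a y_z b` with `a, b ∈ L^{2q}(Ω)` and `(y_z)` bounded in `L^∞(Ω)`. -/
structure ScalarFactorization {Z : Type*} (q : ℝ≥0∞) (μ : Measure Ω) (X : Z → Ω → ℂ)
    (a b : Ω → ℂ) (y : Z → Ω → ℂ) : Prop where
  left_mem : MemLp a (2 * q) μ
  right_mem : MemLp b (2 * q) μ
  mid_mem : ∀ z, MemLp (y z) ∞ μ
  mid_bounded : ⨆ z, eLpNorm (y z) ∞ μ < ∞
  eq_mul : ∀ z, X z =ᵐ[μ] fun x => a x * y z x * b x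

/-- The norm `‖sup⁺ X_z‖` on `L^q(Ω)`. -/
def scalarSupNorm {Z : Type*} (q : ℝ≥0∞) (μ : Measure Ω) (X : Z → Ω → ℂ) : ℝ≥0∞ :=
  ⨅ (a : Ω → ℂ) (b : Ω → ℂ) (y : Z → Ω → ℂ) (_ : ScalarFactorization q μ X a b y),
    eLpNorm a (2 * q) μ * (⨆ z, eLpNorm (y z) ∞ μ) * eLpNorm b (2 * q) μ

/-- A factorization `X_z = a y_z b` with `a, b ∈ L^{2q}(Ω, S^{2q})` and `(y_z)` bounded in
`L^∞(Ω) ⊗ B(ℓ²)`. -/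
structure OpFactorization {Z : Type*} (q : ℝ≥0∞) (μ : Measure Ω) (X : Z → Ω → Op)
    (a b : Ω → Op) (y : Z → Ω → Op) : Prop where
  left_mem : MemSchattenLp (2 * q) μ a
  right_mem : MemSchattenLp (2 * q) μ b
  mid_mem : ∀ z, MemVN μ (y z)
  mid_bounded : ⨆ z, eLpNorm (fun x => ‖y z x‖ₑ) ∞ μ < ∞
  eq_mul : ∀ z, X z =ᵐ[μ] fun x => a x * y z x * b x

/-- The norm `‖sup⁺ X_z‖` on `L^q(Ω, S^q)`. -/
def opSupNorm {Z : Type*} (q : ℝ≥0∞) (μ : Measure Ω) (X : Z → Ω → Op) : ℝ≥0∞ :=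
  ⨅ (a : Ω → Op) (b : Ω → Op) (y : Z → Ω → Op) (_ : OpFactorization q μ X a b y),
    schattenLpNorm (2 * q) μ a * (⨆ z, eLpNorm (fun x => ‖y z x‖ₑ) ∞ μ) *
      schattenLpNorm (2 * q) μ b

/-! ### Square-max decompositions -/

/-- A decomposition `k_z = s_z m_z` into measurable functions with
`sup_z sup_x ‖s_z(x, ·)‖_{L²} < ∞`, such that the adjoint of each `C_{|m_z|²}` is a well-defined
integral operator on `L^q(Ω)`. -/
structure SquareDecomposition {Z : Type*} (q : ℝ≥0∞) (μ : Measure Ω) (k s m : Z → Ω → Ω → ℂ) :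
    Prop where
  measurable_s : ∀ z, Measurable (Function.uncurry (s z))
  measurable_m : ∀ z, Measurable (Function.uncurry (m z))
  eq_mul : ∀ z x y, k z x y = s z x y * m z x y
  square : ⨆ z, ⨆ x, eLpNorm (s z x) 2 μ < ∞
  isDefinedOn : ∀ z, IsDefinedOn q μ (adjSqKernel (m z))

/-- The family `(k_z)` admits an `L^q`-square-max decomposition. -/
def HasSquareMax {Z : Type*} (q : ℝ≥0∞) (μ : Measure Ω) (k : Z → Ω → Ω → ℂ) : Prop :=
  ∃ s m : Z → Ω → Ω → ℂ, SquareDecomposition q μ k s m ∧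
    ∃ C : ℝ≥0, ∀ f : Ω → ℂ, MemLp f q μ →
      scalarSupNorm q μ (fun z => intOp μ (adjSqKernel (m z)) f) ≤ C * eLpNorm f q μ

/-- The family `(k_z)` admits an `L^q(S^q)`-square-max decomposition. -/
def HasSchattenSquareMax {Z : Type*} (q : ℝ≥0∞) (μ : Measure Ω) (k : Z → Ω → Ω → ℂ) : Prop :=
  ∃ s m : Z → Ω → Ω → ℂ, SquareDecomposition q μ k s m ∧
    ∃ C : ℝ≥0, ∀ u : Ω → Op, MemSchattenLp q μ u →
      opSupNorm q μ (fun z => intOp μ (adjSqKernel (m z)) u) ≤ C * schattenLpNorm q μ u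

end Space

end SquareMax

end

/-!
Column, row and R-boundedness of tensorized integral operators, from a square-max decomposition
of their kernels.

Write `T_z = C_{k_z}`, `k_z = s_z m_z`, `r = p / 2` and let `q` be the exponent conjugate to `r`.
By the Cauchy–Schwarz inequality and the bound on `s_z` in `L²`,
`|T_z f(x) ξ|² ≤ M² ∫ |m_z(x, y)|² |f(y) ξ|² dy` (`enorm_intOp_apply_sq_le`). Testing this against a
positive function `u = v* v` and exchanging the integrals gives
`∑ ∫ Tr(|T_j f_j|² u) ≤ M² ∑ ∫ Tr(f_j (C_{|m_j|²})*(u) f_j*)`. If `(C_{|m_j|²})*(u) = a y_j b`, then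
by Cauchy–Schwarz and Hölder the right-hand side is at most
`‖a‖ sup ‖y_j‖ ‖b‖ ‖∑ |f_j|²‖`, with norms in `L^{2q}(S^{2q})` for `a`, `b` and in `L^r(S^r)` for
the last factor, so that the maximal inequality bounds it by `C ‖u‖ ‖∑ |f_j|²‖`
(`sum_lintegral_hsSq_le`). This is the dual form of the column estimate.

It is not known beforehand that `A = ∑ |T_j f_j|²` is in `L^r(S^r)`. So the estimate is applied to
`u = B^{r-1}`, where `B` is a compression of `A` to finitely many coordinates, cut off to a set of
finite measure on which `A` is bounded. Then `∫ Tr B^r` is finite and the estimate improves to a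
bound of it by `∫ Tr(∑ |f_j|²)^r` (`lintegral_opTrace_compression_le`), and Fatou's lemma removes
the cut-offs (`columnNorm_intOp_le`). Boundedness of `T_z` on the scalar `L^p(Ω)` enters here: it
shows that `A` lives on a `σ`-finite set (`exists_exhaustion`). The compressions exhaust the trace
since `A` takes values in the compact operators (`opTrace_rpow_le_liminf`).

The row estimate is the column estimate for the adjoint functions and the conjugate kernels. Column
and row estimates give R-boundedness by the noncommutative Khintchine inequality
(`exists_khintchine`): the norm of a random sum is controlled by the column and the row norm on
average, and each of these is at most the average (`columnNorm_le_rademacherNorm`). The Khintchine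
inequality is proved by flipping signs: for self-adjoint `S = ∑ ε_j A_j` and `f(x) = x |x|^{p-2}`,
the average of `Tr |S|^p` over the signs is that of `(1/4) ∑_j Tr (S - S_j)(f(S) - f(S_j))`, where
`S_j` has the `j`-th sign reversed; a mean value inequality, seen in eigenbases of `S` and `S_j`
(`trace_sub_le`), and Young's inequality bound this by a multiple of `Tr (∑ A_j²)^{p/2}`.

For the scalar statement a function `φ` is replaced by the multiple `φ • P` of a projection of rank
one. All functions `u` in the argument are then multiples of `P` too, so that the scalar maximal
inequality is enough.
-/

namespace SquareMax

/-! ### Hilbert–Schmidt sums -/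

theorem enorm_sq_eq_ofReal {E : Type*} [SeminormedAddCommGroup E] (x : E) :
    ‖x‖ₑ ^ 2 = ENNReal.ofReal (‖x‖ ^ 2) := by
  rw [← ofReal_norm, ENNReal.ofReal_pow (norm_nonneg x)]

theorem hasSum_norm_inner_sq {ι : Type*} (u : HilbertBasis ι ℂ L2) (x : L2) :
    HasSum (fun i => ‖⟪u i, x⟫_ℂ‖ ^ 2) (‖x‖ ^ 2) := by
  have h3 := Complex.hasSum_re (u.hasSum_inner_mul_inner x x)
  convert h3 using 1
  · ext i
    rw [← inner_conj_symm x (u i), ← Complex.normSq_eq_conj_mul_self, Complex.ofReal_re,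
      Complex.normSq_eq_norm_sq]
  · rw [inner_self_eq_norm_sq_to_K]
    norm_cast

theorem tsum_enorm_inner_sq {ι : Type*} (b : HilbertBasis ι ℂ L2) (x : L2) :
    ∑' i, ‖⟪b i, x⟫_ℂ‖ₑ ^ 2 = ‖x‖ₑ ^ 2 := by
  have h := hasSum_norm_inner_sq b x
  simp only [enorm_sq_eq_ofReal]
  rw [← h.tsum_eq, ENNReal.ofReal_tsum_of_nonneg (fun i => by positivity) h.summable]

theorem tsum_enorm_sq_le {ι : Type*} {v : ι → L2} (hv : Orthonormal ℂ v) (x : L2) :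
    ∑' i, ‖⟪v i, x⟫_ℂ‖ₑ ^ 2 ≤ ‖x‖ₑ ^ 2 := by
  simp only [enorm_sq_eq_ofReal]
  rw [← ENNReal.ofReal_tsum_of_nonneg (fun i => by positivity) (hv.inner_products_summable x)]
  exact ENNReal.ofReal_le_ofReal (hv.tsum_inner_products_le x)

theorem inner_star_left (T : Op) (x y : L2) : ⟪star T x, y⟫_ℂ = ⟪x, T y⟫_ℂ :=
  ContinuousLinearMap.adjoint_inner_left T y x

theorem inner_star_right (T : Op) (x y : L2) : ⟪x, star T y⟫_ℂ = ⟪T x, y⟫_ℂ :=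
  ContinuousLinearMap.adjoint_inner_right T x y

theorem enorm_inner_comm (x y : L2) : ‖⟪x, y⟫_ℂ‖ₑ = ‖⟪y, x⟫_ℂ‖ₑ := by
  rw [← ofReal_norm, ← ofReal_norm, norm_inner_symm]

/-- The Hilbert–Schmidt sum does not depend on the basis and is the same for `T` and `T*`. -/
theorem tsum_enorm_star {ι κ : Type*} (b : HilbertBasis ι ℂ L2) (c : HilbertBasis κ ℂ L2)
    (T : Op) : ∑' i, ‖T (b i)‖ₑ ^ 2 = ∑' j, ‖star T (c j)‖ₑ ^ 2 := by
  calc ∑' i, ‖T (b i)‖ₑ ^ 2 = ∑' i, ∑' j, ‖⟪c j, T (b i)⟫_ℂ‖ₑ ^ 2 := by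
        simp only [tsum_enorm_inner_sq]
    _ = ∑' j, ∑' i, ‖⟪c j, T (b i)⟫_ℂ‖ₑ ^ 2 := ENNReal.tsum_comm
    _ = ∑' j, ∑' i, ‖⟪b i, star T (c j)⟫_ℂ‖ₑ ^ 2 := by
        simp only [inner_star_right]
        congr! 5 with j i
        exact enorm_inner_comm _ _
    _ = _ := by simp only [tsum_enorm_inner_sq]

/-- The square of the Hilbert–Schmidt norm. -/
noncomputable def hsSq (T : Op) : ℝ≥0∞ := ∑' n, ‖T (stdBasis n)‖ₑ ^ 2

theorem hsSq_star (T : Op) : hsSq (star T) = hsSq T :=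
  (tsum_enorm_star stdBasis stdBasis T).symm

theorem hsSq_eq_tsum {ι : Type*} (b : HilbertBasis ι ℂ L2) (T : Op) :
    ∑' i, ‖T (b i)‖ₑ ^ 2 = hsSq T := by
  rw [tsum_enorm_star b stdBasis T]; exact hsSq_star T

theorem tsum_le_hsSq {ι : Type*} {v : ι → L2} (hv : Orthonormal ℂ v) (T : Op) :
    ∑' i, ‖T (v i)‖ₑ ^ 2 ≤ hsSq T := by
  calc ∑' i, ‖T (v i)‖ₑ ^ 2 = ∑' i, ∑' j, ‖⟪stdBasis j, T (v i)⟫_ℂ‖ₑ ^ 2 := by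
        simp only [tsum_enorm_inner_sq]
    _ = ∑' j, ∑' i, ‖⟪stdBasis j, T (v i)⟫_ℂ‖ₑ ^ 2 := ENNReal.tsum_comm
    _ = ∑' j, ∑' i, ‖⟪v i, star T (stdBasis j)⟫_ℂ‖ₑ ^ 2 := by
        simp only [inner_star_right]
        congr! 5 with j i
        exact enorm_inner_comm _ _
    _ ≤ ∑' j, ‖star T (stdBasis j)‖ₑ ^ 2 := ENNReal.tsum_le_tsum fun j => tsum_enorm_sq_le hv _
    _ = hsSq T := hsSq_star T

/-- The operator norm is at most the Hilbert–Schmidt norm. -/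
theorem enorm_le_hsSq (T : Op) (x : L2) : ‖T x‖ₑ ^ 2 ≤ hsSq T * ‖x‖ₑ ^ 2 := by
  rw [← hsSq_star T, ← tsum_enorm_inner_sq stdBasis (T x), hsSq, ← ENNReal.tsum_mul_right]
  refine ENNReal.tsum_le_tsum fun n => ?_
  rw [← inner_star_left, ← mul_pow]
  gcongr
  rw [← ofReal_norm, ← ofReal_norm, ← ofReal_norm,
    ← ENNReal.ofReal_mul (norm_nonneg _)]
  exact ENNReal.ofReal_le_ofReal (norm_inner_le_norm _ _)

/-- The real number `⟨v, A v⟩`, for self-adjoint `A`. -/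
noncomputable def quad (A : Op) (v : L2) : ℝ := (⟪v, A v⟫_ℂ).re

theorem quad_nonneg {A : Op} (hA : 0 ≤ A) (v : L2) : 0 ≤ quad A v := by
  have := ((ContinuousLinearMap.nonneg_iff_isPositive A).1 hA).re_inner_nonneg_right v
  exact this

theorem quad_mono {A B : Op} (h : A ≤ B) (v : L2) : quad A v ≤ quad B v := by
  have := quad_nonneg (sub_nonneg.2 h) v
  simp only [quad, sub_apply, inner_sub_right, Complex.sub_re] at this ⊢
  linarith

theorem quad_add (A B : Op) (v : L2) : quad (A + B) v = quad A v + quad B v := by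
  simp [quad]

theorem quad_sum {ι : Type*} (s : Finset ι) (A : ι → Op) (v : L2) :
    quad (∑ j ∈ s, A j) v = ∑ j ∈ s, quad (A j) v := by
  simp [quad]

theorem quad_real_smul (c : ℝ) (A : Op) (v : L2) : quad (c • A) v = c * quad A v := by
  have : (c • A) v = (c : ℂ) • A v := by simp
  simp [quad, this]

theorem quad_one (v : L2) : quad 1 v = ‖v‖ ^ 2 := by
  simp only [quad, one_apply_eq_self]
  rw [inner_self_eq_norm_sq_to_K]; norm_cast

theorem quad_star_mul (T : Op) (v : L2) : quad (star T * T) v = ‖T v‖ ^ 2 := by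
  simp only [quad, mul_apply_eq_comp, inner_star_right]
  rw [inner_self_eq_norm_sq_to_K]; norm_cast

theorem ofReal_quad_star_mul (T : Op) (v : L2) :
    ENNReal.ofReal (quad (star T * T) v) = ‖T v‖ₑ ^ 2 := by
  rw [quad_star_mul, enorm_sq_eq_ofReal]

theorem quad_le_norm (A : Op) (v : L2) : quad A v ≤ ‖A‖ * ‖v‖ ^ 2 := by
  refine (Complex.re_le_norm _).trans ((norm_inner_le_norm _ _).trans ?_)
  nlinarith [A.le_opNorm v, norm_nonneg v]

theorem nonneg_of_quad {A : Op} (hA : IsSelfAdjoint A) (h : ∀ v, 0 ≤ quad A v) : 0 ≤ A := by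
  rw [ContinuousLinearMap.nonneg_iff_isPositive]
  refine ⟨hA.isSymmetric, fun x => ?_⟩
  have := h x
  rw [quad, ← inner_conj_symm, Complex.conj_re] at this
  exact this

theorem exists_star_mul {A : Op} (hA : 0 ≤ A) : ∃ R : Op, A = star R * R :=
  CStarAlgebra.nonneg_iff_eq_star_mul_self.1 hA

theorem opTrace_def (A : Op) : opTrace A = ∑' n, ENNReal.ofReal (quad A (stdBasis n)) := rfl

theorem opTrace_star_mul (T : Op) : opTrace (star T * T) = hsSq T := by
  simp only [opTrace_def, ofReal_quad_star_mul, hsSq]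

/-- The trace of a positive operator can be computed in any orthonormal basis. -/
theorem opTrace_eq_tsum {ι : Type*} (b : HilbertBasis ι ℂ L2) {A : Op} (hA : 0 ≤ A) :
    ∑' i, ENNReal.ofReal (quad A (b i)) = opTrace A := by
  obtain ⟨R, rfl⟩ := exists_star_mul hA
  simp only [ofReal_quad_star_mul, opTrace_star_mul, hsSq_eq_tsum]

theorem tsum_le_opTrace {ι : Type*} {v : ι → L2} (hv : Orthonormal ℂ v) {A : Op} (hA : 0 ≤ A) :
    ∑' i, ENNReal.ofReal (quad A (v i)) ≤ opTrace A := by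
  obtain ⟨R, rfl⟩ := exists_star_mul hA
  simp only [ofReal_quad_star_mul, opTrace_star_mul]
  exact tsum_le_hsSq hv R

/-! ### Powers of positive operators and eigenvectors -/

/-- The functional calculus acts on eigenvectors by applying the function to the eigenvalue. -/
theorem cfc_apply_eigenvector {S : Op} (hS : IsSelfAdjoint S) {v : L2} {l : ℝ}
    (h : S v = (l : ℂ) • v) (hv : v ≠ 0) (f : ℝ → ℝ) (hf : ContinuousOn f (spectrum ℝ S)) :
    cfc f S v = (f l : ℂ) • v := by
  have hl : l ∈ spectrum ℝ S := by
    intro hu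
    obtain ⟨u, hu⟩ := hu
    have h1 : (u : Op) v = 0 := by
      rw [hu, sub_apply, h]
      simp [Algebra.algebraMap_eq_smul_one]
    apply hv
    have h2 : ((↑u⁻¹ : Op) * (u : Op)) v = v := by simp
    rw [← h2, mul_apply_eq_comp, h1, map_zero]
  rw [cfc_apply f S hS hf]
  have key : ∀ g : C(spectrum ℝ S, ℝ), cfcHom hS g v = ((g ⟨l, hl⟩ : ℝ) : ℂ) • v := by
    intro g
    induction g using ContinuousMap.induction_on_of_compact with
    | const r =>
      have : ContinuousMap.const (spectrum ℝ S) r = algebraMap ℝ C(spectrum ℝ S, ℝ) r := rfl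
      rw [this, AlgHomClass.commutes, Algebra.algebraMap_eq_smul_one]
      simp
    | id =>
      rw [cfcHom_id hS]
      simpa using h
    | star_id =>
      rw [map_star, cfcHom_id hS, hS.star_eq]
      simpa using h
    | add f g hf hg =>
      rw [map_add, add_apply, hf, hg, ← add_smul]
      simp
    | mul f g hf hg =>
      rw [map_mul, mul_apply_eq_comp, hg, map_smul, hf, smul_smul]
      congr 1
      simp [mul_comm]
    | frequently f hfr =>
      have hcl : IsClosed {g : C(spectrum ℝ S, ℝ) |
          cfcHom hS g v = ((g ⟨l, hl⟩ : ℝ) : ℂ) • v} := by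
        refine isClosed_eq ?_ ?_
        · exact ((ContinuousLinearMap.apply ℂ L2 v).continuous).comp (cfcHom_continuous hS)
        · refine Continuous.smul (Complex.continuous_ofReal.comp ?_) continuous_const
          exact continuous_eval_const (⟨l, hl⟩ : spectrum ℝ S)
      exact hcl.mem_of_frequently_of_tendsto hfr Filter.tendsto_id
  exact key _

theorem rpow_nonneg' (A : Op) (r : ℝ) : 0 ≤ A ^ r := CFC.rpow_nonneg

theorem continuousOn_rpow_const_spectrum {A : Op} {r : ℝ} (hr : 0 ≤ r) :
    ContinuousOn (fun x : ℝ => x ^ r) (spectrum ℝ A) :=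
  (Real.continuous_rpow_const hr).continuousOn

theorem rpow_apply_eigenvector {A : Op} (hA : 0 ≤ A) {v : L2} {l : ℝ}
    (h : A v = (l : ℂ) • v) {r : ℝ} (hr : 0 ≤ r) : (A ^ r) v = ((l ^ r : ℝ) : ℂ) • v := by
  by_cases hv : v = 0
  · simp [hv]
  rw [CFC.rpow_eq_cfc_real hA]
  exact cfc_apply_eigenvector (IsSelfAdjoint.of_nonneg hA) h hv _
    (continuousOn_rpow_const_spectrum hr)

theorem quad_eigenvector {A : Op} {v : L2} (hv : ‖v‖ = 1) {l : ℝ} (h : A v = (l : ℂ) • v) :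
    quad A v = l := by
  rw [quad, h, inner_smul_right, inner_self_eq_norm_sq_to_K, hv]
  simp

/-- Jensen's inequality `⟨v, A v⟩ ^ r ≤ ⟨v, A ^ r v⟩` for a unit vector `v`. -/
theorem quad_rpow_le {A : Op} (hA : 0 ≤ A) {v : L2} (hv : ‖v‖ = 1) {r : ℝ} (hr : 1 ≤ r) :
    quad A v ^ r ≤ quad (A ^ r) v := by
  set t := quad A v with ht
  have ht0 : 0 ≤ t := quad_nonneg hA v
  -- the tangent line of `x ↦ x ^ r` at `t`
  have key : cfc (fun x : ℝ => r * t ^ (r - 1) * x + (1 - r) * t ^ r) A ≤ A ^ r := by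
    rw [CFC.rpow_eq_cfc_real hA]
    refine cfc_mono (fun x hx => ?_) (by fun_prop)
      (continuousOn_rpow_const_spectrum (by linarith))
    have hx0 : 0 ≤ x := spectrum_nonneg_of_nonneg hA hx
    rcases ht0.eq_or_lt with h0 | h0
    · rw [← h0, Real.zero_rpow (x := r) (by linarith)]
      rcases hr.eq_or_lt with h1 | h1
      · simp [← h1]
      · rw [Real.zero_rpow (by linarith)]
        simpa using Real.rpow_nonneg hx0 r
    · have hb := one_add_mul_self_le_rpow_one_add (s := x / t - 1)
        (by linarith [div_nonneg hx0 h0.le]) hr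
      have e1 : 1 + (x / t - 1) = x / t := by ring
      rw [e1, Real.div_rpow hx0 h0.le, le_div_iff₀ (Real.rpow_pos_of_pos h0 r)] at hb
      rw [Real.rpow_sub_one h0.ne']
      calc r * (t ^ r / t) * x + (1 - r) * t ^ r = (1 + r * (x / t - 1)) * t ^ r := by
            field_simp; ring
        _ ≤ x ^ r := hb
  have e : cfc (fun x : ℝ => r * t ^ (r - 1) * x + (1 - r) * t ^ r) A =
      (r * t ^ (r - 1)) • A + ((1 - r) * t ^ r) • (1 : Op) := by
    have hsa : IsSelfAdjoint A := IsSelfAdjoint.of_nonneg hA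
    rw [cfc_add A (fun x : ℝ => r * t ^ (r - 1) * x) (fun _ => (1 - r) * t ^ r) (by fun_prop)
      (by fun_prop), cfc_const_mul_id _ A, cfc_const _ A, Algebra.algebraMap_eq_smul_one]
  rw [e] at key
  have h2 := quad_mono key v
  rw [quad_add, quad_real_smul, quad_real_smul, quad_one, hv, ← ht] at h2
  have h3 : t ^ (r - 1) * t = t ^ r := by
    rcases ht0.eq_or_lt with h0 | h0
    · rw [← h0, Real.zero_rpow (x := r) (by linarith), mul_zero]
    · rw [Real.rpow_sub_one h0.ne']; field_simp
  calc t ^ r = r * (t ^ (r - 1) * t) + (1 - r) * t ^ r := by rw [h3]; ring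
    _ ≤ _ := by linarith

/-! ### Coordinate projections -/

/-- The orthogonal projection onto the span of the first `n` basis vectors. -/
noncomputable def coordProj (n : ℕ) : Op :=
  ∑ k ∈ Finset.range n, InnerProductSpace.rankOne ℂ (stdBasis k) (stdBasis k)

theorem norm_stdBasis (k : ℕ) : ‖stdBasis k‖ = 1 := stdBasis.orthonormal.1 k

theorem inner_stdBasis (i j : ℕ) :
    ⟪stdBasis i, stdBasis j⟫_ℂ = if i = j then 1 else 0 :=
  orthonormal_iff_ite.1 stdBasis.orthonormal i j

theorem coordProj_apply (n : ℕ) (x : L2) :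
    coordProj n x = ∑ k ∈ Finset.range n, ⟪stdBasis k, x⟫_ℂ • stdBasis k := by
  simp [coordProj]

theorem coordProj_stdBasis (n k : ℕ) :
    coordProj n (stdBasis k) = if k < n then stdBasis k else 0 := by
  rw [coordProj_apply]
  simp only [inner_stdBasis, ite_smul, one_smul, zero_smul]
  simp

theorem inner_coordProj (n : ℕ) (x y : L2) : ⟪coordProj n x, y⟫_ℂ = ⟪x, coordProj n y⟫_ℂ := by
  simp only [coordProj_apply, sum_inner, inner_sum, inner_smul_left, inner_smul_right,
    inner_conj_symm]
  exact Finset.sum_congr rfl fun _ _ => mul_comm _ _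

theorem star_coordProj (n : ℕ) : star (coordProj n) = coordProj n := by
  refine ContinuousLinearMap.ext fun x => ext_inner_right ℂ fun y => ?_
  rw [inner_star_left, inner_coordProj]

theorem coordProj_mul_self (n : ℕ) : coordProj n * coordProj n = coordProj n := by
  refine ContinuousLinearMap.ext fun x => ?_
  rw [mul_apply_eq_comp, coordProj_apply n x, map_sum]
  refine Finset.sum_congr rfl fun k hk => ?_
  rw [map_smul, coordProj_stdBasis, if_pos (Finset.mem_range.1 hk)]

theorem tendsto_coordProj (x : L2) :
    Filter.Tendsto (fun n => coordProj n x) Filter.atTop (nhds x) := by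
  have h := (stdBasis.hasSum_repr x).tendsto_sum_nat
  simpa only [coordProj_apply, HilbertBasis.repr_apply_apply] using h

theorem norm_coordProj_apply_le (n : ℕ) (x : L2) : ‖coordProj n x‖ ≤ ‖x‖ := by
  have h : ‖coordProj n x‖ ^ 2 ≤ ‖coordProj n x‖ * ‖x‖ := by
    have h1 : ⟪coordProj n x, coordProj n x⟫_ℂ = ⟪coordProj n x, x⟫_ℂ := by
      rw [inner_coordProj, inner_coordProj, ← mul_apply_eq_comp, coordProj_mul_self]
    have h2 := norm_inner_le_norm (𝕜 := ℂ) (coordProj n x) x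
    rw [← h1, inner_self_eq_norm_sq_to_K] at h2
    simpa using h2
  by_contra! hc
  nlinarith [norm_nonneg x]

theorem norm_coordProj_le (n : ℕ) : ‖coordProj n‖ ≤ 1 :=
  ContinuousLinearMap.opNorm_le_bound _ zero_le_one fun x => by
    simpa using norm_coordProj_apply_le n x

/-! ### Compact operators -/

theorem isCompactOperator_coordProj (n : ℕ) : IsCompactOperator (coordProj n : L2 → L2) := by
  suffices h : coordProj n ∈ compactOperator (RingHom.id ℂ) L2 L2 from h
  refine Submodule.sum_mem _ fun k _ => ?_
  change IsCompactOperator _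
  rw [InnerProductSpace.rankOne_def']
  exact (isCompactOperator_of_locallyCompactSpace_rng
    (ContinuousLinearMap.toSpanSingleton ℂ (stdBasis k))).comp_clm (innerSL ℂ (stdBasis k))

theorem isCompactOperator_mul_left {K : Op} (hK : IsCompactOperator (K : L2 → L2)) (T : Op) :
    IsCompactOperator ((T * K : Op) : L2 → L2) := hK.clm_comp T

theorem isCompactOperator_mul_right {K : Op} (hK : IsCompactOperator (K : L2 → L2)) (T : Op) :
    IsCompactOperator ((K * T : Op) : L2 → L2) := hK.comp_clm T

theorem enorm_sq_le_hsSq (T : Op) : ‖T‖ₑ ^ 2 ≤ hsSq T := by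
  by_cases hT : hsSq T = ∞
  · simp [hT]
  have h : ‖T‖ ≤ Real.sqrt (hsSq T).toReal := by
    refine T.opNorm_le_bound (Real.sqrt_nonneg _) fun x => ?_
    have h1 := enorm_le_hsSq T x
    rw [enorm_sq_eq_ofReal, enorm_sq_eq_ofReal, ← ENNReal.ofReal_toReal hT,
      ← ENNReal.ofReal_mul ENNReal.toReal_nonneg,
      ENNReal.ofReal_le_ofReal_iff (by positivity)] at h1
    refine le_of_sq_le_sq ?_ (by positivity)
    rwa [mul_pow, Real.sq_sqrt ENNReal.toReal_nonneg]
  rw [enorm_sq_eq_ofReal, ENNReal.ofReal_le_iff_le_toReal hT]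
  calc ‖T‖ ^ 2 ≤ Real.sqrt (hsSq T).toReal ^ 2 := by gcongr
    _ = _ := Real.sq_sqrt ENNReal.toReal_nonneg

theorem hsSq_mul_coordProj_sub (T : Op) (n : ℕ) :
    hsSq (T * coordProj n - T) = ∑' k, ‖T (stdBasis (k + n))‖ₑ ^ 2 := by
  have h2 : ∀ k, ‖(T * coordProj n - T) (stdBasis k)‖ₑ ^ 2 =
      if k < n then 0 else ‖T (stdBasis k)‖ₑ ^ 2 := by
    intro k
    rw [sub_apply, mul_apply_eq_comp, coordProj_stdBasis]
    split_ifs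
    · rw [sub_self, enorm_zero, zero_pow two_ne_zero]
    · rw [map_zero, zero_sub, enorm_neg]
  have h3 := Summable.sum_add_tsum_nat_add' (k := n)
    (f := fun k => ‖(T * coordProj n - T) (stdBasis k)‖ₑ ^ 2) ENNReal.summable
  rw [hsSq, ← h3, Finset.sum_eq_zero, zero_add]
  · refine tsum_congr fun k => ?_
    rw [h2, if_neg (by omega)]
  · intro k hk
    rw [h2, if_pos (Finset.mem_range.1 hk)]

/-- Hilbert–Schmidt operators are norm limits of finite rank operators. -/
theorem isCompactOperator_of_hsSq {T : Op} (hT : hsSq T ≠ ∞) :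
    IsCompactOperator (T : L2 → L2) := by
  have hlim : Filter.Tendsto (fun n => T * coordProj n) Filter.atTop (nhds T) := by
    rw [tendsto_iff_norm_sub_tendsto_zero]
    have h1 : ∀ n, ‖T * coordProj n - T‖ₑ ^ 2 ≤ ∑' k, ‖T (stdBasis (k + n))‖ₑ ^ 2 :=
      fun n => (enorm_sq_le_hsSq _).trans (hsSq_mul_coordProj_sub T n).le
    have h3 : Filter.Tendsto (fun n => ‖T * coordProj n - T‖ₑ ^ 2) Filter.atTop (nhds 0) :=
      tendsto_of_tendsto_of_tendsto_of_le_of_le tendsto_const_nhds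
        (ENNReal.tendsto_sum_nat_add (fun k => ‖T (stdBasis k)‖ₑ ^ 2) hT)
        (fun _ => zero_le) h1
    have h4 := (ENNReal.tendsto_toReal ENNReal.zero_ne_top).comp h3
    have h5 := (Real.continuous_sqrt.tendsto _).comp h4
    simpa [Function.comp_def] using h5
  exact isCompactOperator_of_tendsto hlim (Filter.Eventually.of_forall fun n =>
    isCompactOperator_mul_left (isCompactOperator_coordProj n) T)

/-- The non-unital functional calculus preserves compactness, since compact operators form a closed
ideal. -/
theorem isCompactOperator_cfcₙ {A : Op} (hA : IsCompactOperator (A : L2 → L2)) (f : ℝ → ℝ) :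
    IsCompactOperator ((cfcₙ f A : Op) : L2 → L2) := by
  refine cfcₙ_cases (R := ℝ) (p := IsSelfAdjoint)
    (fun B : Op => IsCompactOperator (B : L2 → L2)) A f ?_ ?_
  · exact (compactOperator (RingHom.id ℂ) L2 L2).zero_mem
  intro hf h0 hsa
  have key : ∀ g : ContinuousMapZero (quasispectrum ℝ A) ℝ,
      cfcₙHom hsa g ∈ compactOperator (RingHom.id ℂ) L2 L2 := by
    intro g
    induction g using ContinuousMapZero.induction_on_of_compact with
    | zero => rw [map_zero]; exact Submodule.zero_mem _
    | id => rw [cfcₙHom_id hsa]; exact hA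
    | star_id => rw [map_star, cfcₙHom_id hsa, hsa.star_eq]; exact hA
    | add f g hf hg => rw [map_add]; exact Submodule.add_mem _ hf hg
    | mul f g hf hg => rw [map_mul]; exact isCompactOperator_mul_left hg _
    | smul r f hf =>
      rw [map_smul]
      have : r • cfcₙHom hsa f = (r : ℂ) • cfcₙHom hsa f := (Complex.coe_smul _ _).symm
      rw [this]
      exact Submodule.smul_mem _ _ hf
    | frequently f hfr =>
      have hcl : IsClosed {g : ContinuousMapZero (quasispectrum ℝ A) ℝ |
          IsCompactOperator ((cfcₙHom hsa g : Op) : L2 → L2)} :=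
        isClosed_setOfPred_isCompactOperator.preimage (cfcₙHom_continuous hsa)
      exact hcl.mem_of_frequently_of_tendsto hfr Filter.tendsto_id
  exact key _

theorem isCompactOperator_rpow {A : Op} (hA0 : 0 ≤ A) (hA : IsCompactOperator (A : L2 → L2))
    {s : ℝ} (hs : 0 < s) : IsCompactOperator ((A ^ s : Op) : L2 → L2) := by
  lift s to ℝ≥0 using hs.le
  rw [← CFC.nnrpow_eq_rpow (a := A) (by exact_mod_cast hs), CFC.nnrpow_eq_cfcₙ_real A _ hA0]
  exact isCompactOperator_cfcₙ hA _

/-- A domination `‖T x‖ ≤ ‖K x‖` passes total boundedness from the image of the ball under `K` to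
the one under `T`. -/
theorem isCompactOperator_of_norm_le {T K : Op} (hK : IsCompactOperator (K : L2 → L2))
    (h : ∀ x, ‖T x‖ ≤ ‖K x‖) : IsCompactOperator (T : L2 → L2) := by
  have h1 := (isCompactOperator_iff_isCompact_closure_image_closedBall
    (K : L2 →ₗ[ℂ] L2) one_pos).1 hK
  refine (isCompactOperator_iff_isCompact_closure_image_closedBall
    (T : L2 →ₗ[ℂ] L2) one_pos).2 ?_
  refine TotallyBounded.isCompact_of_isClosed (TotallyBounded.closure ?_) isClosed_closure
  have h2 : TotallyBounded ((K : L2 → L2) '' Metric.closedBall 0 1) :=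
    h1.totallyBounded.subset subset_closure
  rw [Metric.totallyBounded_iff]
  intro ε hε
  obtain ⟨t, hts, htf, ht⟩ := totallyBounded_iff_subset.1 h2 _ (Metric.dist_mem_uniformity hε)
  choose! g hg using fun y (hy : y ∈ t) => hts hy
  refine ⟨(fun y => T (g y)) '' t, htf.image _, ?_⟩
  rintro _ ⟨x, hx, rfl⟩
  have := ht ⟨x, hx, rfl⟩
  simp only [Set.mem_iUnion] at this ⊢
  obtain ⟨y, hy, hxy⟩ := this
  refine ⟨T (g y), ⟨y, hy, rfl⟩, ?_⟩
  rw [Metric.mem_ball, dist_eq_norm]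
  change dist (K x) y < ε at hxy
  rw [← (hg y hy).2, dist_eq_norm, ← map_sub] at hxy
  change ‖T x - T (g y)‖ < ε
  rw [← map_sub]
  exact (h _).trans_lt hxy

theorem norm_sqrt_apply_sq {A : Op} (hA : 0 ≤ A) (x : L2) : ‖CFC.sqrt A x‖ ^ 2 = quad A x := by
  rw [← quad_star_mul, (IsSelfAdjoint.of_nonneg (CFC.sqrt_nonneg A)).star_eq,
    CFC.sqrt_mul_sqrt_self A hA]

theorem isCompactOperator_sqrt {A : Op} (hA0 : 0 ≤ A) (hA : IsCompactOperator (A : L2 → L2)) :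
    IsCompactOperator ((CFC.sqrt A : Op) : L2 → L2) := by
  rw [CFC.sqrt_eq_rpow]; exact isCompactOperator_rpow hA0 hA (by norm_num)

theorem isCompactOperator_of_quad_le {A T : Op} (hA0 : 0 ≤ A)
    (hA : IsCompactOperator (A : L2 → L2)) (h : star T * T ≤ A) :
    IsCompactOperator (T : L2 → L2) := by
  refine isCompactOperator_of_norm_le (isCompactOperator_sqrt hA0 hA) fun x => ?_
  refine le_of_sq_le_sq ?_ (norm_nonneg _)
  rw [norm_sqrt_apply_sq hA0, ← quad_star_mul]
  exact quad_mono h x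

theorem isCompactOperator_of_le {A B : Op} (hA : 0 ≤ A) (hAB : A ≤ B)
    (hB : IsCompactOperator (B : L2 → L2)) : IsCompactOperator (A : L2 → L2) := by
  obtain ⟨R, rfl⟩ := exists_star_mul hA
  exact isCompactOperator_mul_left (isCompactOperator_of_quad_le (hA.trans hAB) hB hAB) _

/-- If `Tr (A ^ r)` is finite then `A ^ {r/2}` is Hilbert–Schmidt, so `A` is compact. -/
theorem isCompactOperator_of_opTrace_rpow {A : Op} (hA : 0 ≤ A) {r : ℝ} (hr : 0 < r)
    (h : opTrace (A ^ r) ≠ ∞) : IsCompactOperator (A : L2 → L2) := by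
  have h0 : 0 ≤ A ^ r := CFC.rpow_nonneg
  have h1 : IsCompactOperator ((CFC.sqrt (A ^ r) : Op) : L2 → L2) := by
    apply isCompactOperator_of_hsSq
    rwa [← opTrace_star_mul, (IsSelfAdjoint.of_nonneg (CFC.sqrt_nonneg _)).star_eq,
      CFC.sqrt_mul_sqrt_self _ h0]
  have h2 := isCompactOperator_mul_left h1 (CFC.sqrt (A ^ r))
  rw [CFC.sqrt_mul_sqrt_self _ h0] at h2
  have h3 := isCompactOperator_rpow h0 h2 (inv_pos.2 hr)
  rwa [CFC.rpow_rpow_of_exponent_nonneg A r r⁻¹ hr.le (inv_pos.2 hr).le hA,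
    mul_inv_cancel₀ hr.ne', CFC.rpow_one A hA] at h3

/-- The spectral theorem: an orthonormal basis of eigenvectors of a compact self-adjoint
operator. -/
theorem exists_eigenbasis {S : Op} (hS : IsSelfAdjoint S)
    (hc : IsCompactOperator (S : L2 → L2)) :
    ∃ (ι : Type) (b : HilbertBasis ι ℂ L2) (l : ι → ℝ), ∀ i, S (b i) = (l i : ℂ) • b i := by
  have hsymm := hS.isSymmetric
  have hbot := ContinuousLinearMap.orthogonalComplement_iSup_eigenspaces_eq_bot hc hsymm
  let V : ℂ → Submodule ℂ L2 := fun μ => Module.End.eigenspace (S : L2 →ₗ[ℂ] L2) μ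
  have hV : ∀ μ, IsClosed (V μ : Set L2) := by
    intro μ
    have : (V μ : Set L2) = {x | S x = μ • x} := by
      ext x; exact Module.End.mem_eigenspace_iff
    rw [this]
    exact isClosed_eq S.continuous (continuous_const_smul μ)
  have : ∀ μ, CompleteSpace (V μ) := fun μ => (hV μ).completeSpace_coe
  choose w B hB using fun μ => exists_hilbertBasis (𝕜 := ℂ) (E := V μ)
  have hon : Orthonormal ℂ (fun a : Σ μ, w μ => ((B a.1 a.2 : V a.1) : L2)) :=
    hsymm.orthogonalFamily_eigenspaces.orthonormal_sigma_orthonormal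
      (v_family := fun μ i => B μ i) (fun μ => (B μ).orthonormal)
  have hspan : (Submodule.span ℂ (Set.range
      (fun a : Σ μ, w μ => ((B a.1 a.2 : V a.1) : L2))))ᗮ = ⊥ := by
    rw [eq_bot_iff, ← hbot]
    intro x hx
    rw [Submodule.mem_orthogonal] at hx
    rw [← Submodule.iInf_orthogonal, Submodule.mem_iInf]
    intro μ
    rw [Submodule.mem_orthogonal]
    intro u hu
    have h1 := (B μ).hasSum_repr ⟨u, hu⟩
    have h2 : HasSum (fun i => ⟪x, (((B μ).repr ⟨u, hu⟩ i • B μ i : V μ) : L2)⟫_ℂ)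
        ⟪x, u⟫_ℂ :=
      (h1.mapL (V μ).subtypeL).mapL (innerSL ℂ x)
    have h3 : ∀ i, ⟪x, (((B μ).repr ⟨u, hu⟩ i • B μ i : V μ) : L2)⟫_ℂ = 0 := by
      intro i
      rw [Submodule.coe_smul, inner_smul_right, ← inner_conj_symm,
        hx _ (Submodule.subset_span ⟨⟨μ, i⟩, rfl⟩)]
      simp
    simp only [h3] at h2
    rw [← inner_conj_symm, h2.unique hasSum_zero, map_zero]
  refine ⟨Σ μ, w μ, HilbertBasis.mkOfOrthogonalEqBot hon hspan, fun a => a.1.re, fun a => ?_⟩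
  rw [HilbertBasis.coe_mkOfOrthogonalEqBot]
  have hmem : ((B a.1 a.2 : V a.1) : L2) ∈ V a.1 := (B a.1 a.2).2
  have h1 : S (B a.1 a.2 : V a.1) = a.1 • ((B a.1 a.2 : V a.1) : L2) :=
    Module.End.mem_eigenspace_iff.1 hmem
  have h2 : ((a.1.re : ℝ) : ℂ) = a.1 := by
    rw [← Complex.conj_eq_iff_re]
    refine hsymm.conj_eigenvalue_eq_self (Module.End.hasEigenvalue_of_hasEigenvector
      (x := ((B a.1 a.2 : V a.1) : L2)) ⟨hmem, ?_⟩)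
    exact hon.ne_zero a
  rw [h2, h1]

/-! ### Sequence inequalities in `[0, ∞]` -/

theorem tsum_mul_le_Lp_mul_Lq {ι : Type*} {p q : ℝ} (hpq : p.HolderConjugate q)
    (f g : ι → ℝ≥0∞) :
    ∑' i, f i * g i ≤ (∑' i, f i ^ p) ^ (1 / p) * (∑' i, g i ^ q) ^ (1 / q) := by
  let _ : MeasurableSpace ι := ⊤
  have h := ENNReal.lintegral_mul_le_Lp_mul_Lq (Measure.count : Measure ι) hpq
    (f := f) (g := g) measurable_from_top.aemeasurable measurable_from_top.aemeasurable
  simpa only [lintegral_count, Pi.mul_apply] using h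

theorem tsum_Lp_add_le {ι : Type*} {p : ℝ} (hp : 1 ≤ p) (f g : ι → ℝ≥0∞) :
    (∑' i, (f i + g i) ^ p) ^ (1 / p) ≤
      (∑' i, f i ^ p) ^ (1 / p) + (∑' i, g i ^ p) ^ (1 / p) := by
  let _ : MeasurableSpace ι := ⊤
  have h := ENNReal.lintegral_Lp_add_le (μ := (Measure.count : Measure ι))
    (f := f) (g := g) measurable_from_top.aemeasurable measurable_from_top.aemeasurable hp
  simpa only [lintegral_count, Pi.add_apply] using h

/-! ### Traces of powers of positive operators -/

theorem eigenvalue_nonneg {A : Op} (hA : 0 ≤ A) {v : L2} (hv : ‖v‖ = 1) {l : ℝ}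
    (h : A v = (l : ℂ) • v) : 0 ≤ l := by
  rw [← quad_eigenvector hv h]; exact quad_nonneg hA v

theorem hilbertBasis_norm {ι : Type*} (b : HilbertBasis ι ℂ L2) (i : ι) : ‖b i‖ = 1 :=
  b.orthonormal.1 i

theorem opTrace_rpow_eq_tsum {ι : Type*} (b : HilbertBasis ι ℂ L2) {A : Op} (hA : 0 ≤ A)
    {l : ι → ℝ} (hl : ∀ i, A (b i) = (l i : ℂ) • b i) {r : ℝ} (hr : 0 ≤ r) :
    opTrace (A ^ r) = ∑' i, ENNReal.ofReal (l i) ^ r := by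
  rw [← opTrace_eq_tsum b (rpow_nonneg' A r)]
  refine tsum_congr fun i => ?_
  rw [quad_eigenvector (hilbertBasis_norm b i) (rpow_apply_eigenvector hA (hl i) hr),
    ENNReal.ofReal_rpow_of_nonneg (eigenvalue_nonneg hA (hilbertBasis_norm b i) (hl i)) hr]

/-- The `ℓ^r` norm of diagonal coefficients is at most the norm in `S^r`, by Jensen's inequality. -/
theorem tsum_quad_rpow_le {ι : Type*} {v : ι → L2} (hv : Orthonormal ℂ v) {A : Op} (hA : 0 ≤ A)
    {r : ℝ} (hr : 1 ≤ r) : ∑' i, ENNReal.ofReal (quad A (v i)) ^ r ≤ opTrace (A ^ r) := by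
  refine (ENNReal.tsum_le_tsum fun i => ?_).trans (tsum_le_opTrace hv (rpow_nonneg' A r))
  rw [ENNReal.ofReal_rpow_of_nonneg (quad_nonneg hA _) (by linarith)]
  exact ENNReal.ofReal_le_ofReal (quad_rpow_le hA (hv.1 i) hr)

theorem exists_eigenbasis_of_nonneg {A : Op} (hA : 0 ≤ A)
    (hc : IsCompactOperator (A : L2 → L2)) :
    ∃ (ι : Type) (b : HilbertBasis ι ℂ L2) (l : ι → ℝ),
      (∀ i, A (b i) = (l i : ℂ) • b i) ∧ (∀ i, 0 ≤ l i) ∧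
      ∀ i, quad A (b i) = l i := by
  obtain ⟨ι, b, l, h⟩ := exists_eigenbasis (IsSelfAdjoint.of_nonneg hA) hc
  exact ⟨ι, b, l, h, fun i => eigenvalue_nonneg hA (hilbertBasis_norm b i) (h i),
    fun i => quad_eigenvector (hilbertBasis_norm b i) (h i)⟩

/-- In an eigenbasis of `A` the eigenvalues of `A` are at most the diagonal coefficients of `B`, and
Jensen's inequality compares those with the coefficients of `B ^ r`. -/
theorem opTrace_rpow_mono {A B : Op} (hA : 0 ≤ A) (hAB : A ≤ B) {r : ℝ} (hr : 1 ≤ r) :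
    opTrace (A ^ r) ≤ opTrace (B ^ r) := by
  by_cases h : opTrace (B ^ r) = ∞
  · simp [h]
  have hB := hA.trans hAB
  have hc := isCompactOperator_of_le hA hAB
    (isCompactOperator_of_opTrace_rpow hB (by linarith) h)
  obtain ⟨ι, b, l, hl, hl0, hq⟩ := exists_eigenbasis_of_nonneg hA hc
  rw [opTrace_rpow_eq_tsum b hA hl (by linarith)]
  refine le_trans (ENNReal.tsum_le_tsum fun i => ?_) (tsum_quad_rpow_le b.orthonormal hB hr)
  rw [← hq]
  have := quad_mono hAB (b i)
  gcongr

/-- The triangle inequality in `S^r` for positive operators: it is Minkowski's inequality for the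
diagonal coefficients in an eigenbasis of `A + B`. -/
theorem opTrace_rpow_add_le {A B : Op} (hA : 0 ≤ A) (hB : 0 ≤ B) {r : ℝ} (hr : 1 ≤ r) :
    opTrace ((A + B) ^ r) ^ (1 / r) ≤ opTrace (A ^ r) ^ (1 / r) + opTrace (B ^ r) ^ (1 / r) := by
  have hr0 : 0 < r := by linarith
  by_cases h1 : opTrace (A ^ r) = ∞
  · simp [h1, hr0]
  by_cases h2 : opTrace (B ^ r) = ∞
  · simp [h2, hr0]
  have hc : IsCompactOperator ((A + B : Op) : L2 → L2) :=
    (isCompactOperator_of_opTrace_rpow hA hr0 h1).add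
      (isCompactOperator_of_opTrace_rpow hB hr0 h2)
  obtain ⟨ι, b, l, hl, hl0, hq⟩ := exists_eigenbasis_of_nonneg (add_nonneg hA hB) hc
  rw [opTrace_rpow_eq_tsum b (add_nonneg hA hB) hl hr0.le]
  have e : ∀ i, ENNReal.ofReal (l i) =
      ENNReal.ofReal (quad A (b i)) + ENNReal.ofReal (quad B (b i)) := fun i => by
    rw [← hq, quad_add, ENNReal.ofReal_add (quad_nonneg hA _) (quad_nonneg hB _)]
  simp only [e]
  refine (tsum_Lp_add_le hr _ _).trans ?_
  gcongr
  · exact tsum_quad_rpow_le b.orthonormal hA hr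
  · exact tsum_quad_rpow_le b.orthonormal hB hr

theorem opTrace_zero : opTrace 0 = 0 := by simp [opTrace_def, quad]

theorem opTrace_zero_rpow {r : ℝ} (hr : 0 < r) : opTrace ((0 : Op) ^ r) = 0 := by
  have : (0 : Op) ^ r = 0 := CFC.zero_rpow hr.ne'
  rw [this, opTrace_zero]

theorem opTrace_rpow_sum_le {ι : Type*} (s : Finset ι) {A : ι → Op} (hA : ∀ j, 0 ≤ A j) {r : ℝ}
    (hr : 1 ≤ r) :
    opTrace ((∑ j ∈ s, A j) ^ r) ^ (1 / r) ≤ ∑ j ∈ s, opTrace (A j ^ r) ^ (1 / r) := by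
  have hr0 : 0 < r := by linarith
  classical
  induction s using Finset.induction_on with
  | empty => simp [opTrace_zero_rpow hr0, hr0]
  | insert a s ha ih =>
    rw [Finset.sum_insert ha, Finset.sum_insert ha]
    refine (opTrace_rpow_add_le (hA a) (Finset.sum_nonneg fun j _ => hA j) hr).trans ?_
    gcongr

theorem real_smul_rpow {A : Op} (hA : 0 ≤ A) {c : ℝ} (hc : 0 ≤ c) {r : ℝ} (hr : 0 ≤ r) :
    (c • A) ^ r = (c ^ r) • A ^ r := by
  have hcA : 0 ≤ c • A := smul_nonneg hc hA
  have hsa : IsSelfAdjoint A := IsSelfAdjoint.of_nonneg hA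
  rw [CFC.rpow_eq_cfc_real hcA, CFC.rpow_eq_cfc_real hA,
    ← cfc_comp_smul c (fun x : ℝ => x ^ r) A (Real.continuous_rpow_const hr).continuousOn,
    ← cfc_smul (c ^ r) (fun x : ℝ => x ^ r) A (Real.continuous_rpow_const hr).continuousOn]
  refine cfc_congr fun x hx => ?_
  simp only [smul_eq_mul]
  exact Real.mul_rpow hc (spectrum_nonneg_of_nonneg hA hx)

theorem opTrace_real_smul {A : Op} {c : ℝ} (hc : 0 ≤ c) :
    opTrace (c • A) = ENNReal.ofReal c * opTrace A := by
  simp only [opTrace_def, quad_real_smul, ENNReal.ofReal_mul hc, ENNReal.tsum_mul_left]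

theorem opTrace_smul_rpow {A : Op} (hA : 0 ≤ A) {c : ℝ} (hc : 0 ≤ c) {r : ℝ} (hr : 0 ≤ r) :
    opTrace ((c • A) ^ r) = ENNReal.ofReal c ^ r * opTrace (A ^ r) := by
  rw [real_smul_rpow hA hc hr, opTrace_real_smul (Real.rpow_nonneg hc r),
    ENNReal.ofReal_rpow_of_nonneg hc hr]

theorem opTrace_star_mul_rpow_le (T : Op) {r : ℝ} (hr : 1 ≤ r) :
    opTrace ((star T * T) ^ r) ≤ opTrace ((T * star T) ^ r) := by
  have hr0 : 0 < r := by linarith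
  by_cases h : opTrace ((T * star T) ^ r) = ∞
  · simp [h]
  have hA : 0 ≤ T * star T := mul_star_self_nonneg T
  have hB : 0 ≤ star T * T := star_mul_self_nonneg T
  have hcT : IsCompactOperator ((star T : Op) : L2 → L2) :=
    isCompactOperator_of_quad_le hA (isCompactOperator_of_opTrace_rpow hA hr0 h)
      (by rw [star_star])
  obtain ⟨ι, b, l, hl, hl0, hq⟩ := exists_eigenbasis_of_nonneg hB
    (isCompactOperator_mul_right hcT T)
  rw [opTrace_rpow_eq_tsum b hB hl hr0.le]
  classical
  -- the vectors `T b_i / √l_i` with `l_i ≠ 0` are orthonormal eigenvectors of `T T*`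
  let w : {i // l i ≠ 0} → L2 := fun i => ((Real.sqrt (l i))⁻¹ : ℂ) • T (b i)
  have hin : ∀ i j, ⟪T (b i), T (b j)⟫_ℂ = if i = j then (l j : ℂ) else 0 := by
    intro i j
    rw [← inner_star_right, ← mul_apply_eq_comp, hl, inner_smul_right,
      orthonormal_iff_ite.1 b.orthonormal]
    simp
  have hw : Orthonormal ℂ w := by
    rw [orthonormal_iff_ite]
    intro i j
    simp only [w, inner_smul_left, inner_smul_right, hin, Subtype.ext_iff]
    split_ifs with hij
    · have h0 : 0 < l j := lt_of_le_of_ne (hl0 j) (Ne.symm j.2)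
      have hs : Real.sqrt (l j) ≠ 0 := (Real.sqrt_pos.2 h0).ne'
      rw [hij, map_inv₀, Complex.conj_ofReal, ← Complex.ofReal_inv, ← Complex.ofReal_mul,
        ← Complex.ofReal_mul]
      norm_cast
      field_simp
      rw [Real.sq_sqrt h0.le]
    · simp
  have hq' : ∀ i, quad (T * star T) (w i) = l i := by
    intro i
    have h1 : (T * star T) (w i) = (l i : ℂ) • w i := by
      simp only [w, map_smul]
      rw [mul_apply_eq_comp, ← mul_apply_eq_comp (star T) T, hl, map_smul, smul_comm]
    exact quad_eigenvector (hw.1 i) h1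
  have h2 := tsum_quad_rpow_le hw hA hr
  simp only [hq'] at h2
  refine le_trans (le_of_eq ?_) h2
  refine (tsum_subtype_eq_of_support_subset (s := {i | l i ≠ 0})
    (f := fun i => ENNReal.ofReal (l i) ^ r) ?_).symm
  intro i hi h0
  simp [h0, hr0] at hi

theorem opTrace_star_mul_rpow (T : Op) {r : ℝ} (hr : 1 ≤ r) :
    opTrace ((star T * T) ^ r) = opTrace ((T * star T) ^ r) :=
  le_antisymm (opTrace_star_mul_rpow_le T hr)
    (by simpa using opTrace_star_mul_rpow_le (star T) hr)

/-- Lower semicontinuity of `A ↦ Tr (A ^ r)` along the compressions of a compact operator. -/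
theorem opTrace_rpow_le_liminf {A : Op} (hA : 0 ≤ A) (hc : IsCompactOperator (A : L2 → L2))
    {r : ℝ} (hr : 1 ≤ r) :
    opTrace (A ^ r) ≤
      Filter.liminf (fun n => opTrace ((coordProj n * A * coordProj n) ^ r)) Filter.atTop := by
  have hr0 : 0 < r := by linarith
  have hAn : ∀ n, 0 ≤ coordProj n * A * coordProj n := fun n => by
    simpa [star_coordProj] using star_left_conjugate_nonneg hA (coordProj n)
  obtain ⟨ι, b, l, hl, hl0, hq⟩ := exists_eigenbasis_of_nonneg hA hc
  rw [opTrace_rpow_eq_tsum b hA hl hr0.le, ENNReal.tsum_eq_iSup_sum]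
  refine iSup_le fun s => ?_
  have hlim : Filter.Tendsto
      (fun n => ∑ i ∈ s, ENNReal.ofReal (quad (coordProj n * A * coordProj n) (b i)) ^ r)
      Filter.atTop (nhds (∑ i ∈ s, ENNReal.ofReal (l i) ^ r)) := by
    refine tendsto_finsetSum s fun i _ => ?_
    refine (ENNReal.continuous_rpow_const.tendsto _).comp
      ((ENNReal.continuous_ofReal.tendsto _).comp ?_)
    have h1 : ∀ n, quad (coordProj n * A * coordProj n) (b i) =
        quad A (coordProj n (b i)) := fun n => by
      simp only [quad, mul_apply_eq_comp, inner_coordProj]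
    simp only [h1, ← hq]
    have h2 : Continuous (fun v : L2 => quad A v) := by
      unfold quad; fun_prop
    exact (h2.tendsto _).comp (tendsto_coordProj (b i))
  rw [← hlim.liminf_eq]
  refine Filter.liminf_le_liminf (Filter.Eventually.of_forall fun n => ?_)
  exact (ENNReal.sum_le_tsum s).trans (tsum_quad_rpow_le b.orthonormal (hAn n) hr)

/-! ### Schatten norms -/

theorem abs_rpow (T : Op) {s : ℝ} (hs : 0 ≤ s) : CFC.abs T ^ s = (star T * T) ^ (s / 2) := by
  have h0 : 0 ≤ star T * T := star_mul_self_nonneg T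
  rw [CFC.abs, CFC.sqrt_eq_rpow, CFC.rpow_rpow_of_exponent_nonneg _ _ _ (by norm_num) hs h0]
  congr 1; ring

theorem schattenNorm_of_ne_top {p : ℝ≥0∞} (hp : p ≠ ∞) (T : Op) :
    schattenNorm p T = opTrace ((star T * T) ^ (p.toReal / 2)) ^ (1 / p.toReal) := by
  rw [schattenNorm, if_neg hp, abs_rpow T ENNReal.toReal_nonneg]

theorem schattenNorm_rpow {p : ℝ≥0∞} (hp : p ≠ ∞) (hp0 : p ≠ 0) (T : Op) :
    schattenNorm p T ^ p.toReal = opTrace ((star T * T) ^ (p.toReal / 2)) := by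
  have : p.toReal ≠ 0 := (ENNReal.toReal_pos hp0 hp).ne'
  rw [schattenNorm_of_ne_top hp, ← ENNReal.rpow_mul, one_div, inv_mul_cancel₀ this,
    ENNReal.rpow_one]

theorem enorm_le_opTrace {A : Op} (hA : 0 ≤ A) : ‖A‖ₑ ≤ opTrace A := by
  obtain ⟨R, rfl⟩ := exists_star_mul hA
  rw [opTrace_star_mul]
  refine le_trans (le_of_eq ?_) (enorm_sq_le_hsSq R)
  rw [enorm_sq_eq_ofReal, ← ofReal_norm, CStarRing.norm_star_mul_self, sq]

theorem enorm_le_schattenNorm {p : ℝ≥0∞} (hp0 : p ≠ 0) (T : Op) : ‖T‖ₑ ≤ schattenNorm p T := by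
  by_cases hp : p = ∞
  · simp [schattenNorm, hp]
  have hpos := ENNReal.toReal_pos hp0 hp
  rw [← ENNReal.rpow_le_rpow_iff hpos, schattenNorm_rpow hp hp0]
  refine le_trans (le_of_eq ?_) (enorm_le_opTrace (rpow_nonneg' _ _))
  rw [← ofReal_norm, ← ofReal_norm, CFC.norm_rpow _ (by positivity) (star_mul_self_nonneg T),
    CStarRing.norm_star_mul_self, ENNReal.ofReal_rpow_of_nonneg (norm_nonneg _) hpos.le,
    ← sq, ← Real.rpow_natCast, ← Real.rpow_mul (norm_nonneg _)]
  congr 2; push_cast; ring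

theorem schattenNorm_star {p : ℝ≥0∞} (hp : 2 ≤ p) (T : Op) :
    schattenNorm p (star T) = schattenNorm p T := by
  by_cases h : p = ∞
  · simp only [schattenNorm, h, if_true, ← ofReal_norm, norm_star]
  have h2 : 1 ≤ p.toReal / 2 := by
    have := ENNReal.toReal_mono h hp
    simp at this; linarith
  rw [schattenNorm_of_ne_top h, schattenNorm_of_ne_top h, star_star, opTrace_star_mul_rpow T h2]

theorem isCompactOperator_of_schattenNorm {p : ℝ≥0∞} (hp : p ≠ ∞) (hp0 : p ≠ 0) {T : Op}
    (hT : schattenNorm p T ≠ ∞) : IsCompactOperator (T : L2 → L2) := by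
  have hpos := ENNReal.toReal_pos hp0 hp
  have h : opTrace ((star T * T) ^ (p.toReal / 2)) ≠ ∞ := by
    rw [← schattenNorm_rpow hp hp0]; exact ENNReal.rpow_ne_top_of_nonneg hpos.le hT
  have h0 : 0 ≤ star T * T := star_mul_self_nonneg T
  exact isCompactOperator_of_quad_le h0
    (isCompactOperator_of_opTrace_rpow h0 (by positivity) h) le_rfl

theorem hsSq_mul_le (X Y : Op) : hsSq (X * Y) ≤ ‖X‖ₑ ^ 2 * hsSq Y := by
  rw [hsSq, hsSq, ← ENNReal.tsum_mul_left]
  refine ENNReal.tsum_le_tsum fun n => ?_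
  rw [← mul_pow]
  gcongr
  exact X.le_opENorm _

/-- Hölder's inequality `‖X B^{1/2}‖₂² ≤ ‖X‖²_{2q} (Tr B^r)^{1/r}` for conjugate exponents. -/
theorem opTrace_conj_le {B : Op} (hB : 0 ≤ B) (hc : IsCompactOperator (B : L2 → L2)) (X : Op)
    {q r : ℝ≥0∞} (hr : r ≠ ∞) (hqr : q.HolderConjugate r) :
    opTrace (X * B * star X) ≤
      schattenNorm (2 * q) X ^ 2 * opTrace (B ^ r.toReal) ^ (1 / r.toReal) := by
  have e : opTrace (X * B * star X) = hsSq (X * CFC.sqrt B) := by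
    have h1 : X * B * star X = star (CFC.sqrt B * star X) * (CFC.sqrt B * star X) := by
      conv_lhs => rw [← CFC.sqrt_mul_sqrt_self B hB]
      rw [star_mul, star_star, (IsSelfAdjoint.of_nonneg (CFC.sqrt_nonneg B)).star_eq]
      simp only [mul_assoc]
    rw [h1, opTrace_star_mul, ← hsSq_star, star_mul, star_star,
      (IsSelfAdjoint.of_nonneg (CFC.sqrt_nonneg B)).star_eq]
  rw [e]
  by_cases hq : q = ∞
  · have hr1 : r = 1 := by
      have := hqr.inv_add_inv_eq_one
      simpa [hq] using this
    subst hr1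
    have h2 : schattenNorm (2 * q) X = ‖X‖ₑ := by
      rw [hq, ENNReal.mul_top two_ne_zero, schattenNorm, if_pos rfl]
    rw [h2, ENNReal.toReal_one, CFC.rpow_one B hB, div_one, ENNReal.rpow_one]
    refine (hsSq_mul_le X _).trans (le_of_eq ?_)
    rw [← opTrace_star_mul, (IsSelfAdjoint.of_nonneg (CFC.sqrt_nonneg B)).star_eq,
      CFC.sqrt_mul_sqrt_self B hB]
  have hq0 : q ≠ 0 := hqr.ne_zero
  have hr0 : r ≠ 0 := hqr.symm.ne_zero
  have hconj : r.toReal.HolderConjugate q.toReal := by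
    have := hqr.inv_add_inv_eq_one
    have hqp := ENNReal.toReal_pos hq0 hq
    have hrp := ENNReal.toReal_pos hr0 hr
    refine ⟨?_, hrp, hqp⟩
    rw [inv_one, ← ENNReal.toReal_inv, ← ENNReal.toReal_inv, ← ENNReal.toReal_add
      (ENNReal.inv_ne_top.2 hr0) (ENNReal.inv_ne_top.2 hq0), add_comm, this, ENNReal.toReal_one]
  have hq1 : 1 ≤ q.toReal := hconj.symm.lt.le
  obtain ⟨ι, b, l, hl, hl0, hq'⟩ := exists_eigenbasis_of_nonneg hB hc
  have h1 : ∀ i, ‖(X * CFC.sqrt B) (b i)‖ₑ ^ 2 =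
      ENNReal.ofReal (l i) * ENNReal.ofReal (quad (star X * X) (b i)) := by
    intro i
    have h2 : CFC.sqrt B (b i) = (((l i) ^ (1 / 2 : ℝ) : ℝ) : ℂ) • b i := by
      rw [CFC.sqrt_eq_rpow]; exact rpow_apply_eigenvector hB (hl i) (by norm_num)
    rw [mul_apply_eq_comp, h2, map_smul, enorm_sq_eq_ofReal, norm_smul, mul_pow, quad_star_mul,
      ← ENNReal.ofReal_mul (hl0 i), ← Real.sqrt_eq_rpow, Complex.norm_real,
      Real.norm_of_nonneg (Real.sqrt_nonneg _), Real.sq_sqrt (hl0 i)]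
  rw [← hsSq_eq_tsum b]
  simp only [h1]
  refine (tsum_mul_le_Lp_mul_Lq hconj _ _).trans ?_
  rw [mul_comm, opTrace_rpow_eq_tsum b hB hl hconj.nonneg]
  gcongr
  have h3 : schattenNorm (2 * q) X ^ 2 =
      opTrace ((star X * X) ^ q.toReal) ^ (1 / q.toReal) := by
    have h4 : (2 * q).toReal = 2 * q.toReal := by simp
    rw [schattenNorm_of_ne_top (ENNReal.mul_ne_top ENNReal.ofNat_ne_top hq), h4,
      mul_div_cancel_left₀ _ two_ne_zero, ← ENNReal.rpow_natCast, ← ENNReal.rpow_mul]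
    congr 1
    have := (ENNReal.toReal_pos hq0 hq).ne'
    push_cast; field_simp
  rw [h3]
  gcongr
  exact tsum_quad_rpow_le b.orthonormal (star_mul_self_nonneg X) hq1

/-! ### The noncommutative Khintchine inequality -/

theorem rpow_sub_rpow_le {x y s : ℝ} (hy : 0 ≤ y) (hyx : y ≤ x) (hs : 1 ≤ s) :
    x ^ s - y ^ s ≤ s * (x - y) * x ^ (s - 1) := by
  rcases (hy.trans hyx).eq_or_lt with h0 | h0
  · have : y = 0 := le_antisymm (by rwa [← h0] at hyx) hy
    simp [← h0, this]
  · have hb := one_add_mul_self_le_rpow_one_add (s := y / x - 1)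
      (by linarith [div_nonneg hy h0.le]) hs
    have e1 : 1 + (y / x - 1) = y / x := by ring
    rw [e1, Real.div_rpow hy h0.le, le_div_iff₀ (Real.rpow_pos_of_pos h0 s)] at hb
    rw [Real.rpow_sub_one h0.ne']
    have : (1 + s * (y / x - 1)) * x ^ s = x ^ s - s * (x - y) * (x ^ s / x) := by
      field_simp; ring
    linarith

/-- The derivative of `x ↦ x |x|^{p-2}` controls its difference quotients. -/
theorem mul_abs_rpow_sub_le {p : ℝ} (hp : 2 ≤ p) (x y : ℝ) :
    (x * |x| ^ (p - 2) - y * |y| ^ (p - 2)) * (x - y) ≤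
      (p - 1) * ((|x| ^ (p - 2) + |y| ^ (p - 2)) * (x - y) ^ 2) := by
  have e : ∀ {t : ℝ}, 0 ≤ t → t * t ^ (p - 2) = t ^ (p - 1) := by
    intro t ht
    rcases ht.eq_or_lt with h | h
    · rw [← h, zero_mul, Real.zero_rpow (by linarith)]
    · rw [show p - 2 = p - 1 - 1 by ring, Real.rpow_sub_one h.ne']; field_simp
  have h1 : ∀ {x y : ℝ}, 0 ≤ y → y ≤ x →
      (x * x ^ (p - 2) - y * y ^ (p - 2)) * (x - y) ≤
        (p - 1) * ((x ^ (p - 2) + y ^ (p - 2)) * (x - y) ^ 2) := by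
    intro x y hy hyx
    rw [e hy, e (hy.trans hyx)]
    have h := rpow_sub_rpow_le hy hyx (s := p - 1) (by linarith)
    rw [show p - 1 - 1 = p - 2 by ring] at h
    have h2 := Real.rpow_nonneg hy (p - 2)
    have h3 := mul_le_mul_of_nonneg_right h (sub_nonneg.2 hyx)
    nlinarith [mul_nonneg (mul_nonneg (show 0 ≤ p - 1 by linarith) h2) (sq_nonneg (x - y))]
  have h2 : ∀ {x y : ℝ}, 0 ≤ x → 0 ≤ y →
      (x * x ^ (p - 2) + y * y ^ (p - 2)) * (x + y) ≤
        (p - 1) * ((x ^ (p - 2) + y ^ (p - 2)) * (x + y) ^ 2) := by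
    intro x y hx hy
    have a := Real.rpow_nonneg hx (p - 2)
    have b := Real.rpow_nonneg hy (p - 2)
    have c : (x * x ^ (p - 2) + y * y ^ (p - 2)) * (x + y) ≤
        (x ^ (p - 2) + y ^ (p - 2)) * (x + y) ^ 2 := by
      nlinarith [mul_nonneg (mul_nonneg hx b) (add_nonneg hx hy),
        mul_nonneg (mul_nonneg hy a) (add_nonneg hx hy)]
    have d : 0 ≤ (x ^ (p - 2) + y ^ (p - 2)) * (x + y) ^ 2 := by positivity
    nlinarith
  rcases le_total 0 x with hx | hx <;> rcases le_total 0 y with hy | hy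
  · rw [abs_of_nonneg hx, abs_of_nonneg hy]
    rcases le_total y x with h | h
    · exact h1 hy h
    · have := h1 hx h
      linarith
  · rw [abs_of_nonneg hx, abs_of_nonpos hy]
    have := h2 hx (neg_nonneg.2 hy)
    simpa [sub_eq_add_neg] using this
  · rw [abs_of_nonpos hx, abs_of_nonneg hy]
    have := h2 (neg_nonneg.2 hx) hy
    nlinarith
  · rw [abs_of_nonpos hx, abs_of_nonpos hy]
    rcases le_total y x with h | h
    · have := h1 (neg_nonneg.2 hx) (neg_le_neg h)
      nlinarith
    · have := h1 (neg_nonneg.2 hy) (neg_le_neg h)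
      nlinarith

theorem ofReal_le_tsum_ofReal {ι : Type*} {a b : ι → ℝ} {t : ℝ} (ha : HasSum a t)
    (hab : ∀ i, a i ≤ b i) (hb : ∀ i, 0 ≤ b i) :
    ENNReal.ofReal t ≤ ∑' i, ENNReal.ofReal (b i) := by
  by_cases h : ∑' i, ENNReal.ofReal (b i) = ∞
  · simp [h]
  have hs : Summable b := by
    have := ENNReal.summable_toReal h
    simpa [ENNReal.toReal_ofReal (hb _)] using this
  rw [← ENNReal.ofReal_tsum_of_nonneg hb hs]
  refine ENNReal.ofReal_le_ofReal ?_
  exact hasSum_le hab ha hs.hasSum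

section TwoOperators

variable {ι κ : Type*} (u : HilbertBasis ι ℂ L2) (v : HilbertBasis κ ℂ L2)

theorem summable_mul_norm_inner_sq {a : ι → ℝ} (ha : Summable a) (ha0 : ∀ i, 0 ≤ a i) :
    Summable (fun x : ι × κ => a x.1 * ‖⟪u x.1, v x.2⟫_ℂ‖ ^ 2) := by
  have h : ∀ i, HasSum (fun j => a i * ‖⟪u i, v j⟫_ℂ‖ ^ 2) (a i) := by
    intro i
    have h1 := (hasSum_norm_inner_sq v (u i)).mul_left (a i)
    simp only [norm_inner_symm (v _) (u i)] at h1
    simpa [hilbertBasis_norm] using h1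
  rw [summable_prod_of_nonneg (fun x => by have := ha0 x.1; positivity)]
  refine ⟨fun i => (h i).summable, ?_⟩
  simpa only [(h _).tsum_eq] using ha

variable {u v} {X Y : Op} (hY : IsSelfAdjoint Y) {l : ι → ℝ} {m : κ → ℝ}
  (hl : ∀ i, X (u i) = (l i : ℂ) • u i) (hm : ∀ j, Y (v j) = (m j : ℂ) • v j)

include hY hl hm in
theorem inner_sub_eigenvector (i : ι) (j : κ) :
    ⟪v j, (X - Y) (u i)⟫_ℂ = ((l i - m j : ℝ) : ℂ) * ⟪v j, u i⟫_ℂ := by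
  have h1 : ⟪v j, Y (u i)⟫_ℂ = (m j : ℂ) * ⟪v j, u i⟫_ℂ := by
    rw [← hY.star_eq, inner_star_right, hm, inner_smul_left, Complex.conj_ofReal]
  rw [sub_apply, inner_sub_right, hl, inner_smul_right, h1]
  push_cast; ring

include hY hl hm in
theorem hasSum_quad_sub (i : ι) :
    HasSum (fun j => (l i - m j) * ‖⟪u i, v j⟫_ℂ‖ ^ 2) (quad (X - Y) (u i)) := by
  have h := Complex.hasSum_re (v.hasSum_inner_mul_inner (u i) ((X - Y) (u i)))
  change HasSum _ (quad (X - Y) (u i)) at h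
  convert h using 2 with j
  rw [inner_sub_eigenvector hY hl hm, mul_left_comm, Complex.re_ofReal_mul,
    ← inner_conj_symm (v j) (u i), Complex.mul_conj, Complex.ofReal_re,
    Complex.normSq_eq_norm_sq]

include hY hl hm in
/-- The trace of `(X - Y) f(X)`, `f(x) = x |x|^{p-2}`, as a double sum over the eigenbases. -/
theorem exists_hasSum_trace {p : ℝ} (hp : 2 ≤ p) (hls : Summable fun i => |l i| ^ p)
    (hms : Summable fun j => |m j| ^ p) :
    ∃ t, HasSum (fun i => l i * |l i| ^ (p - 2) * quad (X - Y) (u i)) t ∧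
      HasSum (fun x : ι × κ => l x.1 * |l x.1| ^ (p - 2) * ((l x.1 - m x.2) *
        ‖⟪u x.1, v x.2⟫_ℂ‖ ^ 2)) t := by
  have hsum : Summable (fun x : ι × κ => l x.1 * |l x.1| ^ (p - 2) * ((l x.1 - m x.2) *
        ‖⟪u x.1, v x.2⟫_ℂ‖ ^ 2)) := by
    have s1 := summable_mul_norm_inner_sq u v hls (fun i => by positivity)
    have s2 : Summable (fun x : ι × κ => |m x.2| ^ p * ‖⟪u x.1, v x.2⟫_ℂ‖ ^ 2) := by
      have := (summable_mul_norm_inner_sq v u hms (fun i => by positivity)).comp_injective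
        (Equiv.prodComm ι κ).injective
      refine this.congr fun x => ?_
      simp [norm_inner_symm (u x.1) (v x.2)]
    refine Summable.of_norm_bounded ((s1.mul_left 2).add s2) fun x => ?_
    have key : |l x.1| * |l x.1| ^ (p - 2) * |l x.1 - m x.2| ≤
        2 * |l x.1| ^ p + |m x.2| ^ p := by
      set a := |l x.1| with ha
      set b := |m x.2| with hb
      have ha0 : 0 ≤ a := abs_nonneg _
      have hb0 : 0 ≤ b := abs_nonneg _
      have e : ∀ {t : ℝ}, 0 ≤ t → t * t ^ (p - 2) * t = t ^ p := by
        intro t ht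
        rcases ht.eq_or_lt with h | h
        · rw [← h, zero_mul, mul_zero, Real.zero_rpow (by linarith)]
        · rw [show p = (p - 2) + 1 + 1 by ring, Real.rpow_add_one h.ne', Real.rpow_add_one h.ne']
          ring_nf
      have h1 : |l x.1 - m x.2| ≤ a + b := abs_sub _ _
      have h3 : 0 ≤ a * a ^ (p - 2) := by positivity
      have h4 : a * a ^ (p - 2) * b ≤ a ^ p + b ^ p := by
        have : 0 ≤ a ^ p := by positivity
        have : 0 ≤ b ^ p := by positivity
        rcases le_total a b with h | h
        · have : a * a ^ (p - 2) * b ≤ b * b ^ (p - 2) * b := by gcongr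
          rw [e hb0] at this; linarith
        · have : a * a ^ (p - 2) * b ≤ a * a ^ (p - 2) * a := by gcongr
          rw [e ha0] at this; linarith
      calc a * a ^ (p - 2) * |l x.1 - m x.2| ≤ a * a ^ (p - 2) * (a + b) := by gcongr
        _ = a * a ^ (p - 2) * a + a * a ^ (p - 2) * b := by ring
        _ ≤ _ := by rw [e ha0]; linarith
    have h0 : 0 ≤ ‖⟪u x.1, v x.2⟫_ℂ‖ ^ 2 := by positivity
    calc ‖l x.1 * |l x.1| ^ (p - 2) * ((l x.1 - m x.2) * ‖⟪u x.1, v x.2⟫_ℂ‖ ^ 2)‖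
        = |l x.1| * |l x.1| ^ (p - 2) * |l x.1 - m x.2| * ‖⟪u x.1, v x.2⟫_ℂ‖ ^ 2 := by
          rw [Real.norm_eq_abs, abs_mul, abs_mul, abs_mul, abs_of_nonneg h0,
            abs_of_nonneg (Real.rpow_nonneg (abs_nonneg _) _)]
          ring
      _ ≤ (2 * |l x.1| ^ p + |m x.2| ^ p) * ‖⟪u x.1, v x.2⟫_ℂ‖ ^ 2 := by gcongr
      _ = _ := by ring
  obtain ⟨t, ht⟩ := hsum
  exact ⟨t, ht.prod_fiberwise fun i => (hasSum_quad_sub hY hl hm i).mul_left _, ht⟩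

include hY hl hm in
theorem tsum_sq_sub_mul (i : ι) :
    ∑' j, ENNReal.ofReal ((l i - m j) ^ 2 * ‖⟪u i, v j⟫_ℂ‖ ^ 2) = ‖(X - Y) (u i)‖ₑ ^ 2 := by
  rw [← tsum_enorm_inner_sq v]
  refine tsum_congr fun j => ?_
  rw [enorm_sq_eq_ofReal, inner_sub_eigenvector hY hl hm, norm_mul, mul_pow, Complex.norm_real,
    Real.norm_eq_abs, sq_abs, norm_inner_symm (u i)]

/-- A mean value inequality for `tr (X - Y)(f(X) - f(Y))`, `f(x) = x |x|^{p-2}`. -/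
theorem trace_sub_le {p : ℝ} (hp : 2 ≤ p) (hX : IsSelfAdjoint X) (hY : IsSelfAdjoint Y)
    (hl : ∀ i, X (u i) = (l i : ℂ) • u i) (hm : ∀ j, Y (v j) = (m j : ℂ) • v j)
    (hls : Summable fun i => |l i| ^ p) (hms : Summable fun j => |m j| ^ p) {t t' : ℝ}
    (ht : HasSum (fun i => l i * |l i| ^ (p - 2) * quad (X - Y) (u i)) t)
    (ht' : HasSum (fun j => m j * |m j| ^ (p - 2) * quad (Y - X) (v j)) t') :
    ENNReal.ofReal (t + t') ≤ ENNReal.ofReal (p - 1) *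
      (∑' i, ENNReal.ofReal (|l i| ^ (p - 2)) * ‖(X - Y) (u i)‖ₑ ^ 2 +
        ∑' j, ENNReal.ofReal (|m j| ^ (p - 2)) * ‖(Y - X) (v j)‖ₑ ^ 2) := by
  obtain ⟨s, hs, hs2⟩ := exists_hasSum_trace hY hl hm hp hls hms
  obtain ⟨s', hs', hs2'⟩ := exists_hasSum_trace hX hm hl hp hms hls
  rw [ht.unique hs, ht'.unique hs']
  have hs3 := hs2.add ((Equiv.prodComm ι κ).hasSum_iff.2 hs2')
  have hp1 : 0 ≤ p - 1 := by linarith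
  have h := ofReal_le_tsum_ofReal hs3
    (b := fun x => (p - 1) * (|l x.1| ^ (p - 2) * ((l x.1 - m x.2) ^ 2 *
      ‖⟪u x.1, v x.2⟫_ℂ‖ ^ 2) + |m x.2| ^ (p - 2) * ((m x.2 - l x.1) ^ 2 *
      ‖⟪v x.2, u x.1⟫_ℂ‖ ^ 2))) (fun x => ?_) (fun x => by positivity)
  · refine h.trans (le_of_eq ?_)
    have e : ∀ x : ι × κ, ENNReal.ofReal ((p - 1) * (|l x.1| ^ (p - 2) * ((l x.1 - m x.2) ^ 2 *
      ‖⟪u x.1, v x.2⟫_ℂ‖ ^ 2) + |m x.2| ^ (p - 2) * ((m x.2 - l x.1) ^ 2 *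
      ‖⟪v x.2, u x.1⟫_ℂ‖ ^ 2))) = ENNReal.ofReal (p - 1) *
        (ENNReal.ofReal (|l x.1| ^ (p - 2)) * ENNReal.ofReal ((l x.1 - m x.2) ^ 2 *
          ‖⟪u x.1, v x.2⟫_ℂ‖ ^ 2) + ENNReal.ofReal (|m x.2| ^ (p - 2)) *
          ENNReal.ofReal ((m x.2 - l x.1) ^ 2 * ‖⟪v x.2, u x.1⟫_ℂ‖ ^ 2)) := by
      intro x
      rw [ENNReal.ofReal_mul hp1, ENNReal.ofReal_add (by positivity) (by positivity),
        ENNReal.ofReal_mul (p := |l x.1| ^ (p - 2)) (by positivity),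
        ENNReal.ofReal_mul (p := |m x.2| ^ (p - 2)) (by positivity)]
    simp only [e]
    rw [ENNReal.tsum_mul_left, ENNReal.tsum_add, ENNReal.tsum_prod', ENNReal.tsum_prod',
      ENNReal.tsum_comm (α := ι) (β := κ) (f := fun i j => ENNReal.ofReal (|m j| ^ (p - 2)) *
          ENNReal.ofReal ((m j - l i) ^ 2 * ‖⟪v j, u i⟫_ℂ‖ ^ 2))]
    simp only [ENNReal.tsum_mul_left, tsum_sq_sub_mul hY hl hm, tsum_sq_sub_mul hX hm hl]
  · have h1 := mul_abs_rpow_sub_le hp (l x.1) (m x.2)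
    have h0 : 0 ≤ ‖⟪u x.1, v x.2⟫_ℂ‖ ^ 2 := by positivity
    have h2 := mul_le_mul_of_nonneg_right h1 h0
    simp only [Function.comp_apply, Equiv.prodComm_apply, Prod.fst_swap, Prod.snd_swap,
      norm_inner_symm (v x.2) (u x.1)]
    linarith

end TwoOperators

/-- The signed sum `∑ ε_j v_j`. -/
def signSum {V : Type*} [AddCommGroup V] {N : ℕ} (ε : Fin N → ℤˣ) (v : Fin N → V) : V :=
  ∑ j, ((ε j : ℤˣ) : ℤ) • v j

theorem norm_units_smul {E : Type*} [SeminormedAddCommGroup E] (e : ℤˣ) (x : E) :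
    ‖((e : ℤˣ) : ℤ) • x‖ = ‖x‖ := by
  rcases Int.units_eq_one_or e with rfl | rfl <;> simp

theorem signSum_apply {N : ℕ} (ε : Fin N → ℤˣ) (A : Fin N → Op) (x : L2) :
    signSum ε A x = ∑ j, ((ε j : ℤˣ) : ℤ) • A j x := by
  simp [signSum]

theorem isSelfAdjoint_signSum {N : ℕ} (ε : Fin N → ℤˣ) {A : Fin N → Op}
    (hA : ∀ j, IsSelfAdjoint (A j)) : IsSelfAdjoint (signSum ε A) := by
  rw [IsSelfAdjoint, signSum, star_sum]
  refine Finset.sum_congr rfl fun j _ => ?_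
  rw [star_zsmul, (hA j).star_eq]

theorem le_of_quad {A B : Op} (hA : IsSelfAdjoint A) (hB : IsSelfAdjoint B)
    (h : ∀ x, quad A x ≤ quad B x) : A ≤ B := by
  rw [← sub_nonneg]
  refine nonneg_of_quad (hB.sub hA) fun x => ?_
  have := h x
  simp only [quad, sub_apply, inner_sub_right, Complex.sub_re] at this ⊢
  linarith

theorem sum_star_mul_nonneg {N : ℕ} (A : Fin N → Op) : 0 ≤ ∑ j, star (A j) * A j :=
  Finset.sum_nonneg fun j _ => star_mul_self_nonneg (A j)

/-- A crude bound, used only to know that the moments of the random sum are finite. -/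
theorem signSum_star_mul_le {N : ℕ} (ε : Fin N → ℤˣ) (A : Fin N → Op) :
    star (signSum ε A) * signSum ε A ≤ (N : ℝ) • ∑ j, star (A j) * A j := by
  refine le_of_quad (.star_mul_self _)
    (.of_nonneg (smul_nonneg N.cast_nonneg (sum_star_mul_nonneg A))) fun x => ?_
  rw [quad_star_mul, quad_real_smul, quad_sum, signSum_apply]
  simp only [quad_star_mul]
  have h1 : ‖∑ j, ((ε j : ℤˣ) : ℤ) • A j x‖ ≤ ∑ j, ‖A j x‖ :=
    (norm_sum_le _ _).trans (by simp only [norm_units_smul]; exact le_rfl)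
  have h2 := sq_sum_le_card_mul_sum_sq (s := Finset.univ) (f := fun j => ‖A j x‖)
  rw [Finset.card_univ, Fintype.card_fin] at h2
  exact (pow_le_pow_left₀ (norm_nonneg _) h1 2).trans h2

/-- A form of Young's inequality with exponents `p / (p - 2)` and `p / 2`. -/
theorem mul_rpow_sub_two_mul_le {p : ℝ} (hp : 2 ≤ p) {x c b : ℝ} (hx : 0 ≤ x) (hc : 0 ≤ c)
    (hb : 0 ≤ b) : c * (x ^ (p - 2) * b) ≤ 1 / 2 * x ^ p + (2 * c * b) ^ (p / 2) := by
  have hcb : 0 ≤ 2 * c * b := by positivity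
  have h1 : 0 ≤ x ^ p := by positivity
  have h2 : 0 ≤ (2 * c * b) ^ (p / 2) := by positivity
  have h3 : 0 ≤ x ^ (p - 2) := by positivity
  rcases le_total (2 * c * b) (x ^ 2) with h | h
  · have e : x ^ (p - 2) * x ^ 2 = x ^ p := by
      rw [← Real.rpow_natCast, ← Real.rpow_add_of_nonneg hx (by linarith) (by norm_num)]
      congr 1; push_cast; ring
    nlinarith [mul_le_mul_of_nonneg_left h h3]
  · have e : (2 * c * b) ^ ((p - 2) / 2) * (2 * c * b) = (2 * c * b) ^ (p / 2) := by
      nth_rw 2 [← Real.rpow_one (2 * c * b)]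
      rw [← Real.rpow_add_of_nonneg hcb (by linarith) zero_le_one]
      congr 1; ring
    have h4 : x ^ (p - 2) ≤ (2 * c * b) ^ ((p - 2) / 2) := by
      calc x ^ (p - 2) = (x ^ 2) ^ ((p - 2) / 2) := by
            rw [← Real.rpow_natCast, ← Real.rpow_mul hx]
            congr 1; push_cast; ring
        _ ≤ _ := Real.rpow_le_rpow (by positivity) h (by linarith)
    nlinarith [mul_le_mul_of_nonneg_right h4 hcb, mul_nonneg h3 hcb]

/-- Reversal of the `j`-th sign. -/
def flipSign {N : ℕ} (j : Fin N) (ε : Fin N → ℤˣ) : Fin N → ℤˣ := Function.update ε j (-ε j)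

theorem flipSign_flipSign {N : ℕ} (j : Fin N) (ε : Fin N → ℤˣ) :
    flipSign j (flipSign j ε) = ε := by
  simp [flipSign]

theorem sum_flipSign {M : Type*} [AddCommMonoid M] {N : ℕ} (j : Fin N)
    (F : (Fin N → ℤˣ) → M) : ∑ ε, F (flipSign j ε) = ∑ ε, F ε :=
  Equiv.sum_comp (Function.Involutive.toPerm (flipSign j) (flipSign_flipSign j)) F

theorem signSum_sub_flipSign {V : Type*} [AddCommGroup V] {N : ℕ} (j : Fin N)
    (ε : Fin N → ℤˣ) (v : Fin N → V) :
    signSum ε v - signSum (flipSign j ε) v = 2 • (((ε j : ℤˣ) : ℤ) • v j) := by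
  rw [signSum, signSum, ← Finset.sum_sub_distrib, Finset.sum_eq_single j]
  · simp [flipSign, two_smul]
  · intro i _ hi
    simp [flipSign, hi]
  · simp

/-- `Tr |S|^p` in terms of the eigenvalues of a self-adjoint `S`. -/
theorem opTrace_eq_tsum_abs {ι : Type*} (b : HilbertBasis ι ℂ L2) {S : Op}
    (hS : IsSelfAdjoint S) {l : ι → ℝ} (hl : ∀ i, S (b i) = (l i : ℂ) • b i) {p : ℝ}
    (hp : 0 ≤ p) :
    opTrace ((star S * S) ^ (p / 2)) = ∑' i, ENNReal.ofReal (|l i| ^ p) := by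
  have h : ∀ i, (star S * S) (b i) = ((l i ^ 2 : ℝ) : ℂ) • b i := by
    intro i
    rw [hS.star_eq, mul_apply_eq_comp, hl, map_smul, hl, smul_smul]
    push_cast; rw [sq]
  rw [opTrace_rpow_eq_tsum b (star_mul_self_nonneg S) h (by positivity)]
  refine tsum_congr fun i => ?_
  rw [ENNReal.ofReal_rpow_of_nonneg (sq_nonneg _) (by positivity), ← sq_abs,
    ← Real.rpow_natCast, ← Real.rpow_mul (abs_nonneg _)]
  congr 2; push_cast; ring

theorem ofReal_sum_le {ι : Type*} (s : Finset ι) (f : ι → ℝ) :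
    ENNReal.ofReal (∑ i ∈ s, f i) ≤ ∑ i ∈ s, ENNReal.ofReal (f i) :=
  Finset.le_sum_of_subadditive ENNReal.ofReal ENNReal.ofReal_zero.le
    (fun _ _ => ENNReal.ofReal_add_le) s f

theorem le_two_mul_of_le_half_mul_add {T K : ℝ≥0∞} (hT : T ≠ ∞)
    (h : T ≤ ENNReal.ofReal (1 / 2) * T + K) : T ≤ 2 * K := by
  by_cases hK : K = ∞
  · simp [hK]
  lift T to ℝ≥0 using hT
  lift K to ℝ≥0 using hK
  have e : ENNReal.ofReal (1 / 2) = ((1 / 2 : ℝ≥0) : ℝ≥0∞) := by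
    rw [ENNReal.ofReal]; congr 1
    ext; simp
  rw [e] at h
  norm_cast at h ⊢
  have h9 : (T : ℝ) ≤ 1 / 2 * T + K := by exact_mod_cast h
  have : (T : ℝ) ≤ 2 * K := by linarith
  exact_mod_cast this

/-- The Khintchine inequality for self-adjoint operators. -/
theorem khintchine_selfAdjoint {N : ℕ} {A : Fin N → Op} (hA : ∀ j, IsSelfAdjoint (A j)) {p : ℝ}
    (hp : 2 ≤ p) :
    ∑ ε : Fin N → ℤˣ, opTrace ((star (signSum ε A) * signSum ε A) ^ (p / 2)) ≤
      2 * ENNReal.ofReal (4 * (p - 1)) ^ (p / 2) * 2 ^ N *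
        opTrace ((∑ j, star (A j) * A j) ^ (p / 2)) := by
  set B := ∑ j, star (A j) * A j with hB
  have hB0 : 0 ≤ B := sum_star_mul_nonneg A
  have hr : 1 ≤ p / 2 := by linarith
  by_cases htop : opTrace (B ^ (p / 2)) = ∞
  · rw [htop, ENNReal.mul_top]
    · exact le_top
    · have h4 : ENNReal.ofReal (4 * (p - 1)) ≠ 0 := by
        rw [Ne, ENNReal.ofReal_eq_zero, not_le]; linarith
      have : ENNReal.ofReal (4 * (p - 1)) ^ (p / 2) ≠ 0 := by
        simp only [Ne, ENNReal.rpow_eq_zero_iff, not_or, not_and_or]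
        exact ⟨Or.inl h4, Or.inr (by linarith)⟩
      positivity
  let S : (Fin N → ℤˣ) → Op := fun ε => signSum ε A
  have hfin : ∀ ε, opTrace ((star (S ε) * S ε) ^ (p / 2)) ≠ ∞ := by
    intro ε
    refine ne_top_of_le_ne_top ?_ (opTrace_rpow_mono (star_mul_self_nonneg _)
      (signSum_star_mul_le ε A) hr)
    rw [opTrace_smul_rpow hB0 N.cast_nonneg (by linarith)]
    exact ENNReal.mul_ne_top (ENNReal.rpow_ne_top_of_nonneg (by linarith) ENNReal.ofReal_ne_top)
      htop
  have hSsa : ∀ ε, IsSelfAdjoint (S ε) := fun ε => isSelfAdjoint_signSum ε hA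
  have hSc : ∀ ε, IsCompactOperator (S ε : L2 → L2) := fun ε =>
    isCompactOperator_of_quad_le (star_mul_self_nonneg _)
      (isCompactOperator_of_opTrace_rpow (star_mul_self_nonneg _) (by linarith) (hfin ε)) le_rfl
  choose ι b l hl using fun ε => exists_eigenbasis (hSsa ε) (hSc ε)
  have htr : ∀ ε, opTrace ((star (S ε) * S ε) ^ (p / 2)) =
      ∑' i, ENNReal.ofReal (|l ε i| ^ p) := fun ε =>
    opTrace_eq_tsum_abs (b ε) (hSsa ε) (hl ε) (by linarith)
  have hsum : ∀ ε, Summable fun i => |l ε i| ^ p := fun ε => by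
    have := ENNReal.summable_toReal ((htr ε) ▸ hfin ε)
    simpa [ENNReal.toReal_ofReal (Real.rpow_nonneg (abs_nonneg _) _)] using this
  choose t ht _ using fun (ε : Fin N → ℤˣ) (j : Fin N) =>
    exists_hasSum_trace (hSsa (flipSign j ε)) (hl ε) (hl (flipSign j ε)) hp (hsum ε)
      (hsum (flipSign j ε))
  -- `Tr |S|^p = (1/2) ∑_j tr (S - S_j) f(S)`, where `S_j` is `S` with the `j`-th sign reversed
  have hs : ∀ ε, ∑' i, |l ε i| ^ p = 1 / 2 * ∑ j, t ε j := by
    intro ε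
    have h1 := (hasSum_sum (s := Finset.univ) fun j _ => ht ε j).mul_left (1 / 2)
    rw [← h1.tsum_eq]
    refine tsum_congr fun i => ?_
    rw [← Finset.mul_sum, ← quad_sum]
    have h2 : ∑ j, (S ε - S (flipSign j ε)) = (2 : ℝ) • S ε := by
      simp only [S, signSum_sub_flipSign]
      rw [← Finset.smul_sum, ofNat_smul_eq_nsmul ℝ 2]
      rfl
    rw [h2, quad_real_smul, quad_eigenvector (hilbertBasis_norm _ _) (hl ε i)]
    rcases eq_or_ne (l ε i) 0 with h0 | h0
    · rw [h0]; simp [show p ≠ 0 by linarith]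
    · have h3 : |l ε i| ^ p = |l ε i| ^ (p - 2) * l ε i ^ 2 := by
        rw [← sq_abs (l ε i), ← Real.rpow_natCast, ← Real.rpow_add (abs_pos.2 h0)]
        congr 1; push_cast; ring
      rw [h3]; ring
  let R : (Fin N → ℤˣ) → Fin N → ℝ≥0∞ := fun ε j =>
    ∑' i, ENNReal.ofReal (|l ε i| ^ (p - 2)) * ‖(S ε - S (flipSign j ε)) (b ε i)‖ₑ ^ 2
  have hR : ∀ ε j, ENNReal.ofReal (t ε j + t (flipSign j ε) j) ≤
      ENNReal.ofReal (p - 1) * (R ε j + R (flipSign j ε) j) := by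
    intro ε j
    have h1 := ht (flipSign j ε) j
    have h2 := trace_sub_le hp (hSsa ε) (hSsa (flipSign j ε)) (hl ε) (hl (flipSign j ε)) (hsum ε)
      (hsum (flipSign j ε)) (ht ε j) (t' := t (flipSign j ε) j) (by
        simpa only [flipSign_flipSign] using h1)
    simpa only [R, flipSign_flipSign] using h2
  have hRsum : ∀ ε, ∑ j, R ε j =
      4 * ∑' i, ENNReal.ofReal (|l ε i| ^ (p - 2)) * ENNReal.ofReal (quad B (b ε i)) := by
    intro ε
    have h1 : ∀ j i, ‖(S ε - S (flipSign j ε)) (b ε i)‖ₑ ^ 2 = 4 * ‖A j (b ε i)‖ₑ ^ 2 := by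
      intro j i
      have h2 : ‖(S ε - S (flipSign j ε)) (b ε i)‖ = 2 * ‖A j (b ε i)‖ := by
        simp only [S, signSum_sub_flipSign]
        have h3 : (2 • (((ε j : ℤˣ) : ℤ) • A j)) (b ε i) =
            ((ε j : ℤˣ) : ℤ) • A j (b ε i) + ((ε j : ℤˣ) : ℤ) • A j (b ε i) := by
          rw [two_smul]; simp
        rw [h3, ← two_smul ℂ, norm_smul, norm_units_smul]
        simp
      rw [enorm_sq_eq_ofReal, enorm_sq_eq_ofReal, h2, mul_pow, ENNReal.ofReal_mul (by norm_num)]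
      norm_num
    have h4 : ∀ i, ENNReal.ofReal (quad B (b ε i)) = ∑ j, ‖A j (b ε i)‖ₑ ^ 2 := by
      intro i
      rw [hB, quad_sum, ENNReal.ofReal_sum_of_nonneg fun j _ =>
        quad_nonneg (star_mul_self_nonneg _) _]
      simp only [ofReal_quad_star_mul]
    simp only [R, h1, h4]
    rw [← Summable.tsum_finsetSum (fun _ _ => ENNReal.summable), ← ENNReal.tsum_mul_left]
    refine tsum_congr fun i => ?_
    rw [Finset.mul_sum, Finset.mul_sum]
    refine Finset.sum_congr rfl fun j _ => by ring
  set T := ∑ ε, opTrace ((star (S ε) * S ε) ^ (p / 2)) with hT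
  have hTtop : T ≠ ∞ := ENNReal.sum_ne_top.2 fun ε _ => hfin ε
  have hTs : T = ENNReal.ofReal (∑ ε, ∑' i, |l ε i| ^ p) := by
    rw [ENNReal.ofReal_sum_of_nonneg fun ε _ => tsum_nonneg fun i => by positivity]
    refine Finset.sum_congr rfl fun ε _ => ?_
    rw [htr, ENNReal.ofReal_tsum_of_nonneg (fun i => by positivity) (hsum ε)]
  have h4T : ∑ ε, ∑' i, |l ε i| ^ p =
      1 / 4 * ∑ j, ∑ ε, (t ε j + t (flipSign j ε) j) := by
    simp only [hs, Finset.sum_add_distrib]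
    rw [← Finset.mul_sum, Finset.sum_comm]
    have : ∀ j, ∑ ε, t (flipSign j ε) j = ∑ ε, t ε j := fun j =>
      sum_flipSign j fun ε => t ε j
    simp only [this]
    ring
  have h4 : 4 * T ≤ ∑ j, ∑ ε, ENNReal.ofReal (p - 1) * (R ε j + R (flipSign j ε) j) := by
    have h5 : 4 * T = ENNReal.ofReal (∑ j, ∑ ε, (t ε j + t (flipSign j ε) j)) := by
      rw [hTs, h4T, show (4 : ℝ≥0∞) = ENNReal.ofReal 4 by norm_num,
        ← ENNReal.ofReal_mul (by norm_num)]
      congr 1; ring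
    rw [h5]
    refine (ofReal_sum_le _ _).trans (Finset.sum_le_sum fun j _ => ?_)
    refine (ofReal_sum_le _ _).trans (Finset.sum_le_sum fun ε _ => hR ε j)
  have h6 : ∑ j, ∑ ε, ENNReal.ofReal (p - 1) * (R ε j + R (flipSign j ε) j) =
      4 * (ENNReal.ofReal (2 * (p - 1)) * ∑ ε, ∑' i, ENNReal.ofReal (|l ε i| ^ (p - 2)) *
        ENNReal.ofReal (quad B (b ε i))) := by
    simp only [← Finset.mul_sum, Finset.sum_add_distrib]
    have : ∀ j, ∑ ε, R (flipSign j ε) j = ∑ ε, R ε j := fun j =>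
      sum_flipSign j fun ε => R ε j
    simp only [this]
    rw [Finset.sum_comm]
    simp only [hRsum]
    rw [← Finset.mul_sum, ENNReal.ofReal_mul (by norm_num), ENNReal.ofReal_ofNat]
    ring
  rw [h6, ENNReal.mul_le_mul_iff_right (by norm_num) (by norm_num)] at h4
  have hyoung : ∀ ε i, ENNReal.ofReal (2 * (p - 1)) * (ENNReal.ofReal (|l ε i| ^ (p - 2)) *
      ENNReal.ofReal (quad B (b ε i))) ≤ ENNReal.ofReal (1 / 2) * ENNReal.ofReal (|l ε i| ^ p) +
        ENNReal.ofReal (4 * (p - 1)) ^ (p / 2) * ENNReal.ofReal (quad B (b ε i)) ^ (p / 2) := by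
    intro ε i
    have hq := quad_nonneg hB0 (b ε i)
    have h := mul_rpow_sub_two_mul_le hp (abs_nonneg (l ε i))
      (show 0 ≤ 2 * (p - 1) by linarith) hq
    have hx : 0 ≤ |l ε i| ^ (p - 2) := by positivity
    have h4p : 0 ≤ 4 * (p - 1) := by linarith
    rw [← ENNReal.ofReal_mul hx, ← ENNReal.ofReal_mul (by linarith),
      ← ENNReal.ofReal_mul (by norm_num), ← ENNReal.mul_rpow_of_nonneg _ _ (by linarith),
      ← ENNReal.ofReal_mul h4p, ENNReal.ofReal_rpow_of_nonneg (mul_nonneg h4p hq) (by linarith),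
      ← ENNReal.ofReal_add (by positivity) (Real.rpow_nonneg (mul_nonneg h4p hq) _)]
    refine ENNReal.ofReal_le_ofReal (h.trans (le_of_eq ?_))
    ring_nf
  have h7 : T ≤ ENNReal.ofReal (1 / 2) * T +
      2 ^ N * (ENNReal.ofReal (4 * (p - 1)) ^ (p / 2) * opTrace (B ^ (p / 2))) := by
    refine h4.trans ?_
    rw [hT, Finset.mul_sum, Finset.mul_sum]
    have hcard : (2 : ℝ≥0∞) ^ N * (ENNReal.ofReal (4 * (p - 1)) ^ (p / 2) *
        opTrace (B ^ (p / 2))) = ∑ _ε : Fin N → ℤˣ, (ENNReal.ofReal (4 * (p - 1)) ^ (p / 2) *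
        opTrace (B ^ (p / 2))) := by
      rw [Finset.sum_const, Finset.card_univ, Fintype.card_fun, Fintype.card_fin,
        show Fintype.card ℤˣ = 2 from rfl, nsmul_eq_mul]
      push_cast; rfl
    rw [hcard, ← Finset.sum_add_distrib]
    refine Finset.sum_le_sum fun ε _ => ?_
    rw [← ENNReal.tsum_mul_left]
    refine (ENNReal.tsum_le_tsum fun i => hyoung ε i).trans ?_
    rw [ENNReal.tsum_add, ENNReal.tsum_mul_left, ENNReal.tsum_mul_left, htr]
    gcongr
    exact tsum_quad_rpow_le (b ε).orthonormal hB0 hr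
  -- absorb `T / 2` into the left-hand side
  set K := (2 : ℝ≥0∞) ^ N * (ENNReal.ofReal (4 * (p - 1)) ^ (p / 2) * opTrace (B ^ (p / 2)))
    with hK
  refine (le_two_mul_of_le_half_mul_add hTtop h7).trans (le_of_eq ?_)
  rw [hK]; ring

theorem opTrace_rpow_add_le_two_rpow_mul {A B : Op} (hA : 0 ≤ A) (hB : 0 ≤ B) {r : ℝ}
    (hr : 1 ≤ r) :
    opTrace ((A + B) ^ r) ≤ 2 ^ (r - 1) * (opTrace (A ^ r) + opTrace (B ^ r)) := by
  have hr0 : 0 < r := by linarith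
  have e : ∀ x : ℝ≥0∞, (x ^ (1 / r)) ^ r = x := fun x => by
    rw [← ENNReal.rpow_mul, one_div, inv_mul_cancel₀ hr0.ne', ENNReal.rpow_one]
  have h := ENNReal.rpow_le_rpow (opTrace_rpow_add_le hA hB hr) hr0.le
  have h2 := ENNReal.rpow_add_le_mul_rpow_add_rpow (opTrace (A ^ r) ^ (1 / r))
    (opTrace (B ^ r) ^ (1 / r)) hr
  rw [e, e] at h2
  rw [e] at h
  exact h.trans h2

theorem star_mul_le_of_norm_sq_le {T U V : Op} {c : ℝ} (hc : 0 ≤ c)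
    (h : ∀ x, ‖T x‖ ^ 2 ≤ c * (‖U x‖ ^ 2 + ‖V x‖ ^ 2)) :
    star T * T ≤ c • (star U * U + star V * V) := by
  refine le_of_quad (.star_mul_self _) (.of_nonneg (smul_nonneg hc
    (add_nonneg (star_mul_self_nonneg U) (star_mul_self_nonneg V)))) fun x => ?_
  rw [quad_real_smul, quad_add]
  simpa only [quad_star_mul] using h x

theorem norm_add_sq_le_two_mul {E : Type*} [SeminormedAddCommGroup E] (x y : E) :
    ‖x + y‖ ^ 2 ≤ 2 * (‖x‖ ^ 2 + ‖y‖ ^ 2) := by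
  have h := norm_add_le x y
  nlinarith [norm_nonneg (x + y), sq_nonneg (‖x‖ - ‖y‖)]

/-- The noncommutative Khintchine inequality in `S^p`, `2 ≤ p < ∞`. -/
theorem exists_khintchine {p : ℝ} (hp : 2 ≤ p) : ∃ K : ℝ≥0, ∀ {N : ℕ} (a : Fin N → Op),
    ∑ ε : Fin N → ℤˣ, opTrace ((star (signSum ε a) * signSum ε a) ^ (p / 2)) ≤
      K * 2 ^ N * (opTrace ((∑ j, star (a j) * a j) ^ (p / 2)) +
        opTrace ((∑ j, a j * star (a j)) ^ (p / 2))) := by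
  have hr : 1 ≤ p / 2 := by linarith
  have hr0 : 0 ≤ p / 2 := by linarith
  set c : ℝ≥0∞ := 2 * ENNReal.ofReal (4 * (p - 1)) ^ (p / 2) with hc
  have hctop : c ≠ ∞ := ENNReal.mul_ne_top (by simp)
    (ENNReal.rpow_ne_top_of_nonneg hr0 ENNReal.ofReal_ne_top)
  have h2top : (2 : ℝ≥0∞) ^ (p / 2 - 1) ≠ ∞ :=
    ENNReal.rpow_ne_top_of_nonneg (by linarith) (by simp)
  have h2top' : (2 : ℝ≥0∞) ^ (p / 2) ≠ ∞ := ENNReal.rpow_ne_top_of_nonneg hr0 (by simp)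
  set K : ℝ≥0∞ := 2 ^ (p / 2) * 2 ^ (p / 2 - 1) * (2 * c * 2 ^ (p / 2 - 1)) with hK
  have hKtop : K ≠ ∞ := by
    refine ENNReal.mul_ne_top (ENNReal.mul_ne_top h2top' h2top) ?_
    exact ENNReal.mul_ne_top (ENNReal.mul_ne_top (by simp) hctop) h2top
  refine ⟨K.toNNReal, fun {N} a => ?_⟩
  rw [ENNReal.coe_toNNReal hKtop]
  let h : Fin N → Op := fun j => (realPart (a j) : Op)
  let g : Fin N → Op := fun j => (imaginaryPart (a j) : Op)
  have hh : ∀ j, IsSelfAdjoint (h j) := fun j => (realPart (a j)).2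
  have hg : ∀ j, IsSelfAdjoint (g j) := fun j => (imaginaryPart (a j)).2
  set C := ∑ j, star (a j) * a j with hC
  set R := ∑ j, a j * star (a j) with hR
  have hC0 : 0 ≤ C := sum_star_mul_nonneg a
  have hR0 : 0 ≤ R := Finset.sum_nonneg fun j _ => mul_star_self_nonneg (a j)
  have hpart : ∀ f : Fin N → Op,
      (∀ j x, ‖f j x‖ ^ 2 ≤ 1 * (‖a j x‖ ^ 2 + ‖star (a j) x‖ ^ 2)) →
      ∑ j, star (f j) * f j ≤ C + R := by
    intro f hf
    rw [hC, hR, ← Finset.sum_add_distrib]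
    refine Finset.sum_le_sum fun j _ => ?_
    have := star_mul_le_of_norm_sq_le zero_le_one (hf j)
    rwa [one_smul, star_star] at this
  have hhle : ∑ j, star (h j) * h j ≤ C + R := by
    refine hpart h fun j x => ?_
    have e : h j x = (1 / 2 : ℝ) • (a j x + star (a j) x) := by
      simp only [h, realPart_apply_coe]
      simp
    rw [e, norm_smul, mul_pow]
    have := norm_add_sq_le_two_mul (a j x) (star (a j) x)
    norm_num
    nlinarith [norm_nonneg (a j x), norm_nonneg (star (a j) x)]
  have hgle : ∑ j, star (g j) * g j ≤ C + R := by
    refine hpart g fun j x => ?_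
    have e : g j x = -Complex.I • ((1 / 2 : ℝ) • (a j x + -star (a j) x)) := by
      simp only [g, imaginaryPart_apply_coe, ← sub_eq_add_neg]
      simp
    rw [e, norm_smul, norm_smul, mul_pow, mul_pow]
    have := norm_add_sq_le_two_mul (a j x) (-star (a j) x)
    rw [norm_neg] at this
    norm_num
    nlinarith [norm_nonneg (a j x), norm_nonneg (star (a j) x)]
  have hbound : ∀ f : Fin N → Op, (∀ j, IsSelfAdjoint (f j)) →
      ∑ j, star (f j) * f j ≤ C + R →
      ∑ ε : Fin N → ℤˣ, opTrace ((star (signSum ε f) * signSum ε f) ^ (p / 2)) ≤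
        c * 2 ^ N * (2 ^ (p / 2 - 1) * (opTrace (C ^ (p / 2)) + opTrace (R ^ (p / 2)))) := by
    intro f hf hle
    refine (khintchine_selfAdjoint hf hp).trans ?_
    gcongr
    exact (opTrace_rpow_mono (sum_star_mul_nonneg f) hle hr).trans
      (opTrace_rpow_add_le_two_rpow_mul hC0 hR0 hr)
  have hε : ∀ ε : Fin N → ℤˣ, opTrace ((star (signSum ε a) * signSum ε a) ^ (p / 2)) ≤
      2 ^ (p / 2) * (2 ^ (p / 2 - 1) *
        (opTrace ((star (signSum ε h) * signSum ε h) ^ (p / 2)) +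
          opTrace ((star (signSum ε g) * signSum ε g) ^ (p / 2)))) := by
    intro ε
    have e : ∀ x, signSum ε a x = signSum ε h x + Complex.I • signSum ε g x := by
      intro x
      simp only [signSum_apply, Finset.smul_sum, ← Finset.sum_add_distrib]
      refine Finset.sum_congr rfl fun j _ => ?_
      rw [smul_comm Complex.I, ← smul_add]
      congr 1
      have := realPart_add_I_smul_imaginaryPart (a j)
      conv_lhs => rw [← this]
      rfl
    have h1 : star (signSum ε a) * signSum ε a ≤ (2 : ℝ) •
        (star (signSum ε h) * signSum ε h + star (signSum ε g) * signSum ε g) := by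
      refine star_mul_le_of_norm_sq_le (by norm_num) fun x => ?_
      have := norm_add_sq_le_two_mul (signSum ε h x) (Complex.I • signSum ε g x)
      rwa [norm_smul, Complex.norm_I, one_mul, ← e] at this
    have h0 := star_mul_self_nonneg (signSum ε h)
    have h0' := star_mul_self_nonneg (signSum ε g)
    refine (opTrace_rpow_mono (star_mul_self_nonneg _) h1 hr).trans ?_
    rw [opTrace_smul_rpow (add_nonneg h0 h0') (by norm_num) hr0, ENNReal.ofReal_ofNat]
    gcongr
    exact opTrace_rpow_add_le_two_rpow_mul h0 h0' hr
  refine (Finset.sum_le_sum fun ε _ => hε ε).trans ?_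
  rw [← Finset.mul_sum, ← Finset.mul_sum, Finset.sum_add_distrib]
  refine (mul_le_mul_right (mul_le_mul_right
    (add_le_add (hbound h hh hhle) (hbound g hg hgle)) _) _).trans (le_of_eq ?_)
  rw [hK]; ring

/-! ### Measurability of traces and Schatten norms -/

theorem continuous_quad (x : L2) : Continuous (fun A : Op => quad A x) := by
  unfold quad; fun_prop

/-- Composing with `CFC.abs` makes the power continuous on all of `B(ℓ²)`, not only on the cone of
positive operators; hence powers of measurable positive functions are measurable. -/
theorem continuous_abs_rpow {s : ℝ} (hs : 0 < s) : Continuous (fun A : Op => CFC.abs A ^ s) := by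
  lift s to ℝ≥0 using hs.le
  have h := (CFC.continuousOn_nnrpow (A := Op) s).comp_continuous
    (CFC.continuous_abs (A := Op)) fun A => CFC.abs_nonneg A
  refine h.congr fun A => ?_
  exact CFC.nnrpow_eq_rpow (by exact_mod_cast hs)

section

variable {Ω : Type*} [MeasurableSpace Ω] {μ : Measure Ω}

theorem stronglyMeasurable_rpow {g : Ω → Op} (hg : StronglyMeasurable g) (h0 : ∀ x, 0 ≤ g x)
    {s : ℝ} (hs : 0 < s) : StronglyMeasurable (fun x => g x ^ s) := by
  have h := (continuous_abs_rpow hs).comp_stronglyMeasurable hg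
  simpa only [CFC.abs_of_nonneg (g _) (h0 _)] using h

theorem aestronglyMeasurable_rpow {g : Ω → Op} (hg : AEStronglyMeasurable g μ)
    (h0 : ∀ x, 0 ≤ g x) {s : ℝ} (hs : 0 < s) : AEStronglyMeasurable (fun x => g x ^ s) μ := by
  refine ((continuous_abs_rpow hs).comp_aestronglyMeasurable hg).congr
    (Filter.Eventually.of_forall fun x => ?_)
  simp only [CFC.abs_of_nonneg (g x) (h0 x)]

theorem aemeasurable_opTrace {g : Ω → Op} (hg : AEStronglyMeasurable g μ) :
    AEMeasurable (fun x => opTrace (g x)) μ := by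
  unfold opTrace
  refine AEMeasurable.tsum fun n => ?_
  exact ((continuous_quad (stdBasis n)).comp_aestronglyMeasurable hg).aemeasurable.ennreal_ofReal

theorem measurable_opTrace {g : Ω → Op} (hg : StronglyMeasurable g) :
    Measurable (fun x => opTrace (g x)) := by
  unfold opTrace
  refine Measurable.tsum fun n => ?_
  exact ((continuous_quad (stdBasis n)).comp_stronglyMeasurable hg).measurable.ennreal_ofReal

theorem stronglyMeasurable_apply {g : Ω → Op} (hg : StronglyMeasurable g) (x : L2) :
    StronglyMeasurable (fun z => g z x) :=
  (ContinuousLinearMap.apply ℂ L2 x).continuous.comp_stronglyMeasurable hg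

theorem measurable_hsSq {g : Ω → Op} (hg : StronglyMeasurable g) :
    Measurable (fun x => hsSq (g x)) := by
  unfold hsSq
  refine Measurable.tsum fun n => ?_
  exact (stronglyMeasurable_apply hg _).enorm.pow_const 2

theorem aemeasurable_schattenNorm {p : ℝ≥0∞} (hp0 : p ≠ 0) {f : Ω → Op}
    (hf : AEStronglyMeasurable f μ) : AEMeasurable (fun x => schattenNorm p (f x)) μ := by
  by_cases hp : p = ∞
  · simp only [schattenNorm, hp, if_true]
    exact hf.enorm
  · simp only [schattenNorm, hp, if_false]
    refine AEMeasurable.pow_const (aemeasurable_opTrace ?_) _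
    exact (continuous_abs_rpow (ENNReal.toReal_pos hp0 hp)).comp_aestronglyMeasurable hf

theorem schattenLpNorm_rpow {p : ℝ≥0∞} (hp : p ≠ ∞) (hp0 : p ≠ 0) (f : Ω → Op) :
    schattenLpNorm p μ f ^ p.toReal =
      ∫⁻ x, opTrace ((star (f x) * f x) ^ (p.toReal / 2)) ∂μ := by
  have h0 : p.toReal ≠ 0 := (ENNReal.toReal_pos hp0 hp).ne'
  rw [schattenLpNorm, eLpNorm_eq_lintegral_rpow_enorm_toReal hp0 hp, ← ENNReal.rpow_mul,
    one_div, inv_mul_cancel₀ h0, ENNReal.rpow_one]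
  simp only [enorm_eq_self, schattenNorm_rpow hp hp0]

theorem columnNorm_rpow {p : ℝ≥0∞} (hp : p ≠ ∞) (hp0 : p ≠ 0) {N : ℕ} (f : Fin N → Ω → Op) :
    columnNorm p μ f ^ p.toReal =
      ∫⁻ x, opTrace ((∑ j, star (f j x) * f j x) ^ (p.toReal / 2)) ∂μ := by
  rw [columnNorm, schattenLpNorm_rpow hp hp0]
  congr! with x
  have h := sum_star_mul_nonneg fun j => f j x
  rw [(CFC.sqrt_nonneg _).isSelfAdjoint.star_eq, CFC.sqrt_mul_sqrt_self _ h]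

theorem schattenLpNorm_congr {p : ℝ≥0∞} {f g : Ω → Op} (h : f =ᵐ[μ] g) :
    schattenLpNorm p μ f = schattenLpNorm p μ g :=
  eLpNorm_congr_ae (h.mono fun x hx => by simp only [hx])

theorem columnNorm_one {p : ℝ≥0∞} (hp : p ≠ ∞) (hp0 : p ≠ 0) (f : Ω → Op) :
    columnNorm p μ (fun _ : Fin 1 => f) = schattenLpNorm p μ f := by
  have h0 : p.toReal ≠ 0 := (ENNReal.toReal_pos hp0 hp).ne'
  have : columnNorm p μ (fun _ : Fin 1 => f) ^ p.toReal = schattenLpNorm p μ f ^ p.toReal := by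
    rw [columnNorm_rpow hp hp0, schattenLpNorm_rpow hp hp0]
    simp
  exact (ENNReal.rpow_left_injective h0) this

theorem columnNorm_congr {p : ℝ≥0∞} {N : ℕ} {f g : Fin N → Ω → Op}
    (h : ∀ j, f j =ᵐ[μ] g j) : columnNorm p μ f = columnNorm p μ g := by
  refine schattenLpNorm_congr ?_
  filter_upwards [ae_all_iff.2 h] with x hx
  simp only [hx]

theorem rowNorm_eq_columnNorm_star {p : ℝ≥0∞} {N : ℕ} (f : Fin N → Ω → Op) :
    rowNorm p μ f = columnNorm p μ fun j x => star (f j x) := by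
  simp only [rowNorm, columnNorm, star_star]

theorem schattenLpNorm_star {p : ℝ≥0∞} (hp : 2 ≤ p) (f : Ω → Op) :
    schattenLpNorm p μ (fun x => star (f x)) = schattenLpNorm p μ f := by
  simp only [schattenLpNorm, schattenNorm_star hp]

theorem MemSchattenLp.star_fun {p : ℝ≥0∞} (hp : 2 ≤ p) {f : Ω → Op} (hf : MemSchattenLp p μ f) :
    MemSchattenLp p μ (fun x => star (f x)) :=
  ⟨hf.1.star, by rw [schattenLpNorm_star hp]; exact hf.2⟩

theorem MemSchattenLp.memLp {p : ℝ≥0∞} (hp0 : p ≠ 0) {f : Ω → Op} (hf : MemSchattenLp p μ f) :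
    MemLp f p μ := by
  refine ⟨hf.1, lt_of_le_of_lt ?_ hf.2⟩
  exact eLpNorm_mono_enorm fun x => by
    simpa using enorm_le_schattenNorm hp0 (f x)

theorem MemSchattenLp.ae_lt_top {p : ℝ≥0∞} (hp0 : p ≠ 0) {f : Ω → Op}
    (hf : MemSchattenLp p μ f) : ∀ᵐ x ∂μ, schattenNorm p (f x) < ∞ := by
  by_cases hp : p = ∞
  · refine Filter.Eventually.of_forall fun x => ?_
    simp [schattenNorm, hp]
  · have h := hf.2
    have h0 := ENNReal.toReal_pos hp0 hp
    rw [schattenLpNorm, eLpNorm_lt_top_iff_lintegral_rpow_enorm_lt_top hp0 hp] at h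
    have := ae_lt_top' (((aemeasurable_schattenNorm hp0 hf.1).enorm).pow_const _) h.ne
    filter_upwards [this] with x hx
    simpa [ENNReal.rpow_lt_top_iff_of_pos h0] using hx

theorem MemSchattenLp.ae_isCompactOperator {p : ℝ≥0∞} (hp0 : p ≠ 0) (hp : p ≠ ∞) {f : Ω → Op}
    (hf : MemSchattenLp p μ f) : ∀ᵐ x ∂μ, IsCompactOperator (f x : L2 → L2) :=
  (hf.ae_lt_top hp0).mono fun _ hx => isCompactOperator_of_schattenNorm hp hp0 hx.ne

/-- A function in `L^p(Ω, S^p)`, `p < ∞`, lives on a `σ`-finite set. -/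
theorem MemSchattenLp.exists_stronglyMeasurable {p : ℝ≥0∞} (hp0 : p ≠ 0) (hp : p ≠ ∞) {f : Ω → Op}
    (hf : MemSchattenLp p μ f) : ∃ (g : Ω → Op) (S : Set Ω), StronglyMeasurable g ∧ f =ᵐ[μ] g ∧
      MeasurableSet S ∧ SigmaFinite (μ.restrict S) ∧ ∀ x ∉ S, g x = 0 := by
  have h := (hf.memLp hp0).aefinStronglyMeasurable hp0 hp
  obtain ⟨S, hS, h0, hσ⟩ := h.exists_set_sigmaFinite
  refine ⟨S.indicator (hf.1.mk f), S, hf.1.stronglyMeasurable_mk.indicator hS, ?_, hS, hσ,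
    fun x hx => Set.indicator_of_notMem hx _⟩
  have h0' := (ae_restrict_iff' hS.compl).1 h0
  filter_upwards [h0', hf.1.ae_eq_mk] with x hx hx'
  by_cases hxS : x ∈ S
  · rw [Set.indicator_of_mem hxS, hx']
  · rw [Set.indicator_of_notMem hxS]
    exact hx hxS

theorem intOp_congr {E : Type*} [NormedAddCommGroup E] [NormedSpace ℂ E] {f g : Ω → E}
    (h : f =ᵐ[μ] g) (k : Ω → Ω → ℂ) : intOp μ k f = intOp μ k g := by
  funext x
  exact integral_congr_ae (h.mono fun y hy => by simp only [hy])

/-- The compact operators form a closed subspace, so Bochner integrals stay in it. -/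
theorem isCompactOperator_intOp {f : Ω → Op} (hf : ∀ᵐ y ∂μ, IsCompactOperator (f y : L2 → L2))
    (k : Ω → Ω → ℂ) (x : Ω) : IsCompactOperator (intOp (E := Op) μ k f x : L2 → L2) := by
  let K : Submodule ℂ Op := compactOperator (RingHom.id ℂ) L2 L2
  have hK : IsClosed (K : Set Op) := isClosed_setOfPred_isCompactOperator
  change intOp (E := Op) μ k f x ∈ K
  by_cases hi : Integrable (fun y => k x y • f y) μ
  · rw [← Submodule.Quotient.mk_eq_zero K]
    have h := K.mkQL.integral_comp_comm hi
    have h0 : ∫ y, K.mkQL (k x y • f y) ∂μ = 0 := by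
      refine integral_eq_zero_of_ae (hf.mono fun y hy => ?_)
      exact (Submodule.Quotient.mk_eq_zero K).2 (K.smul_mem _ hy)
    rw [h0] at h
    exact h.symm
  · rw [intOp, integral_undef hi]
    exact K.zero_mem

theorem ae_integrable_smul {p : ℝ≥0∞} {k : Ω → Ω → ℂ} (hk : Measurable (Function.uncurry k))
    (hd : IsDefinedOn p μ k) {f : Ω → Op} (hf : MemLp f p μ) :
    ∀ᵐ x ∂μ, Integrable (fun y => k x y • f y) μ := by
  have h := hd (fun y => (‖f y‖ : ℂ)) hf.norm.ofReal
  filter_upwards [h] with x hx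
  refine hx.mono (((hk.comp measurable_prodMk_left).aestronglyMeasurable).smul hf.1) ?_
  exact Filter.Eventually.of_forall fun y => by simp [norm_smul]

end

/-! ### The duality estimate -/

section

variable {Ω : Type*} [MeasurableSpace Ω] {μ : Measure Ω}

theorem intOp_eq_restrict {E : Type*} [NormedAddCommGroup E] [NormedSpace ℂ E] {f : Ω → E}
    {S : Set Ω} (hf : ∀ x ∉ S, f x = 0) (k : Ω → Ω → ℂ) :
    intOp μ k f = intOp (μ.restrict S) k f := by
  funext x
  refine (setIntegral_eq_integral_of_forall_compl_eq_zero fun y hy => ?_).symm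
  rw [hf y hy, smul_zero]

theorem stronglyMeasurable_intOp {E : Type*} [NormedAddCommGroup E] [NormedSpace ℂ E] {f : Ω → E}
    {S : Set Ω} [SigmaFinite (μ.restrict S)] (hf : StronglyMeasurable f) (h0 : ∀ x ∉ S, f x = 0)
    {k : Ω → Ω → ℂ} (hk : Measurable (Function.uncurry k)) : StronglyMeasurable (intOp μ k f) := by
  rw [intOp_eq_restrict h0]
  refine StronglyMeasurable.integral_prod_right (f := fun x y => k x y • f y) ?_
  exact (hk.stronglyMeasurable).smul (hf.comp_measurable measurable_snd)

/-- Tonelli's theorem for a measure that is not assumed `σ`-finite, when the integrand is supported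
in a rectangle with `s`-finite sides. -/
theorem lintegral_swap_of_support {S E : Set Ω} [SFinite (μ.restrict S)] [SFinite (μ.restrict E)]
    {F : Ω → Ω → ℝ≥0∞} (hF : Measurable (Function.uncurry F))
    (hE : ∀ x ∉ E, ∀ y, F x y = 0) (hS : ∀ x, ∀ y ∉ S, F x y = 0) :
    ∫⁻ x, ∫⁻ y, F x y ∂μ ∂μ = ∫⁻ y, ∫⁻ x, F x y ∂μ ∂μ := by
  have key : ∀ {A : Set Ω} {g : Ω → ℝ≥0∞}, (∀ x ∉ A, g x = 0) →
      ∫⁻ x, g x ∂μ = ∫⁻ x in A, g x ∂μ := fun {A g} h =>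
    (setLIntegral_eq_of_support_subset fun x hx => by
      by_contra hxA
      exact hx (h x hxA)).symm
  calc ∫⁻ x, ∫⁻ y, F x y ∂μ ∂μ = ∫⁻ x in E, ∫⁻ y in S, F x y ∂μ ∂μ := by
        rw [key (A := E) fun x hx => by simp [hE x hx]]
        exact lintegral_congr fun x => key (hS x)
    _ = ∫⁻ y in S, ∫⁻ x in E, F x y ∂μ ∂μ := lintegral_lintegral_swap hF.aemeasurable
    _ = _ := by
        rw [key (A := S) (g := fun y => ∫⁻ x, F x y ∂μ) fun y hy => by simp [hS _ y hy]]
        exact lintegral_congr fun y => (key fun x hx => hE x hx y).symm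

theorem eLpNorm_two_sq (g : Ω → ℂ) : eLpNorm g 2 μ ^ 2 = ∫⁻ x, ‖g x‖ₑ ^ 2 ∂μ := by
  rw [eLpNorm_eq_lintegral_rpow_enorm_toReal two_ne_zero ENNReal.ofNat_ne_top]
  rw [← ENNReal.rpow_natCast, ← ENNReal.rpow_mul]
  simp

theorem lintegral_mul_sq_le {f g : Ω → ℝ≥0∞} (hf : AEMeasurable f μ) (hg : AEMeasurable g μ) :
    (∫⁻ x, f x * g x ∂μ) ^ 2 ≤ (∫⁻ x, f x ^ 2 ∂μ) * ∫⁻ x, g x ^ 2 ∂μ := by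
  have h := ENNReal.lintegral_mul_le_Lp_mul_Lq μ Real.HolderConjugate.two_two hf hg
  calc (∫⁻ x, f x * g x ∂μ) ^ 2 ≤ _ := pow_le_pow_left' h 2
    _ = _ := by
      rw [mul_pow, ← ENNReal.rpow_natCast, ← ENNReal.rpow_mul, ← ENNReal.rpow_natCast (_ ^ _),
        ← ENNReal.rpow_mul]
      simp

/-- Operator-valued Cauchy–Schwarz inequality for the kernel `s m`, applied to a vector. -/
theorem enorm_intOp_apply_sq_le {k s m : Ω → Ω → ℂ} (hs : Measurable (Function.uncurry s))
    (hm : Measurable (Function.uncurry m)) (hk : ∀ x y, k x y = s x y * m x y)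
    {f : Ω → Op} (hf : StronglyMeasurable f) (x : Ω) (ξ : L2) :
    ‖intOp (E := Op) μ k f x ξ‖ₑ ^ 2 ≤
      eLpNorm (s x) 2 μ ^ 2 * ∫⁻ y, ‖m x y‖ₑ ^ 2 * ‖f y ξ‖ₑ ^ 2 ∂μ := by
  by_cases hi : Integrable (fun y => k x y • f y) μ
  · have h1 : ‖intOp (E := Op) μ k f x ξ‖ₑ ≤ ∫⁻ y, ‖s x y‖ₑ * (‖m x y‖ₑ * ‖f y ξ‖ₑ) ∂μ := by
      rw [intOp, ContinuousLinearMap.integral_apply hi]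
      refine (enorm_integral_le_lintegral_enorm _).trans (le_of_eq ?_)
      refine lintegral_congr fun y => ?_
      rw [smul_apply, enorm_smul, hk, enorm_mul, mul_assoc]
    have hsx : Measurable (s x) := hs.comp measurable_prodMk_left
    have hmx : Measurable (m x) := hm.comp measurable_prodMk_left
    calc _ ≤ _ := pow_le_pow_left' h1 2
      _ ≤ _ := lintegral_mul_sq_le hsx.enorm.aemeasurable
        (hmx.enorm.mul (stronglyMeasurable_apply hf ξ).enorm).aemeasurable
      _ = _ := by rw [eLpNorm_two_sq]; simp only [mul_pow]
  · rw [intOp, integral_undef hi]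
    simp

/-- The Cauchy–Schwarz inequality `enorm_intOp_apply_sq_le`, summed over the basis. -/
theorem hsSq_intOp_mul_le {k s m : Ω → Ω → ℂ} (hs : Measurable (Function.uncurry s))
    (hm : Measurable (Function.uncurry m)) (hk : ∀ x y, k x y = s x y * m x y)
    {f : Ω → Op} (hf : StronglyMeasurable f) (x : Ω) (w : Op) :
    hsSq (intOp (E := Op) μ k f x * star w) ≤
      eLpNorm (s x) 2 μ ^ 2 * ∫⁻ y, ‖m x y‖ₑ ^ 2 * hsSq (w * star (f y)) ∂μ := by
  have hmx : Measurable (m x) := hm.comp measurable_prodMk_left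
  calc hsSq (intOp (E := Op) μ k f x * star w)
      = ∑' n, ‖intOp (E := Op) μ k f x (star w (stdBasis n))‖ₑ ^ 2 := rfl
    _ ≤ ∑' n, eLpNorm (s x) 2 μ ^ 2 *
        ∫⁻ y, ‖m x y‖ₑ ^ 2 * ‖f y (star w (stdBasis n))‖ₑ ^ 2 ∂μ :=
        ENNReal.tsum_le_tsum fun n => enorm_intOp_apply_sq_le hs hm hk hf x _
    _ = _ := by
        have h := lintegral_tsum (μ := μ)
          (f := fun n y => ‖m x y‖ₑ ^ 2 * ‖f y (star w (stdBasis n))‖ₑ ^ 2) fun n =>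
          ((hmx.enorm.pow_const 2).mul
            ((stronglyMeasurable_apply hf _).enorm.pow_const 2)).aemeasurable
        rw [ENNReal.tsum_mul_left, ← h]
        congr! 3 with y
        rw [ENNReal.tsum_mul_left, ← hsSq_star (w * star (f y)), star_mul, star_star]
        rfl

theorem lintegral_hsSq_intOp_mul_le {k s m : Ω → Ω → ℂ} (hs : Measurable (Function.uncurry s))
    (hm : Measurable (Function.uncurry m)) (hk : ∀ x y, k x y = s x y * m x y)
    {M : ℝ≥0∞} (hM' : M ≠ ∞) (hM : ∀ x, eLpNorm (s x) 2 μ ≤ M)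
    {f v : Ω → Op} (hf : StronglyMeasurable f) (hv : StronglyMeasurable v) {S E : Set Ω}
    [SFinite (μ.restrict S)] [SFinite (μ.restrict E)]
    (hfS : ∀ y ∉ S, f y = 0) (hvE : ∀ x ∉ E, v x = 0) :
    ∫⁻ x, hsSq (intOp (E := Op) μ k f x * star (v x)) ∂μ ≤
      M ^ 2 * ∫⁻ y, ∫⁻ x, ‖m x y‖ₑ ^ 2 * hsSq (v x * star (f y)) ∂μ ∂μ := by
  have hh0 : hsSq 0 = 0 := by simp [hsSq]
  have hF : Measurable (Function.uncurry fun x y => ‖m x y‖ₑ ^ 2 * hsSq (v x * star (f y))) := by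
    refine (hm.enorm.pow_const 2).mul (measurable_hsSq ?_)
    exact (hv.comp_measurable measurable_fst).mul (hf.comp_measurable measurable_snd).star
  rw [← lintegral_swap_of_support (S := S) (E := E) hF
    (fun x hx y => by simp [hvE x hx, hh0]) (fun x y hy => by simp [hfS y hy, hh0])]
  calc _ ≤ ∫⁻ x, M ^ 2 * ∫⁻ y, ‖m x y‖ₑ ^ 2 * hsSq (v x * star (f y)) ∂μ ∂μ := by
        refine lintegral_mono fun x => (hsSq_intOp_mul_le hs hm hk hf x (v x)).trans ?_
        gcongr
        exact hM x
    _ = _ := lintegral_const_mul' _ _ (ENNReal.pow_ne_top hM')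

/-- Integrating `|m(x, y)|² v(x)* v(x)` in `x` produces the adjoint operator applied to `u = v* v`. -/
theorem lintegral_mul_hsSq_eq {m : Ω → Ω → ℂ} {v : Ω → Op} (hv : StronglyMeasurable v) (g : Op)
    (hm : Measurable (Function.uncurry m)) (y : Ω)
    (hi : Integrable (fun x => adjSqKernel m y x • (star (v x) * v x)) μ) :
    ∫⁻ x, ‖m x y‖ₑ ^ 2 * hsSq (v x * star g) ∂μ =
      opTrace (g * intOp (E := Op) μ (adjSqKernel m) (fun x => star (v x) * v x) y * star g) := by
  have hmy : Measurable (fun x => m x y) := hm.comp measurable_prodMk_right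
  have h1 : ∀ ξ : L2, ∫⁻ x, ‖m x y‖ₑ ^ 2 * ‖v x ξ‖ₑ ^ 2 ∂μ = ENNReal.ofReal
      (quad (intOp (E := Op) μ (adjSqKernel m) (fun x => star (v x) * v x) y) ξ) := by
    intro ξ
    let L : Op →L[ℝ] ℝ := (Complex.reCLM.comp ((innerSL ℂ ξ).restrictScalars ℝ)).comp
      ((ContinuousLinearMap.apply ℂ L2 ξ).restrictScalars ℝ)
    have hL : ∀ A : Op, L A = quad A ξ := fun A => rfl
    have hpt : ∀ x, L (adjSqKernel m y x • (star (v x) * v x)) = ‖m x y‖ ^ 2 * ‖v x ξ‖ ^ 2 := by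
      intro x
      have h2 : adjSqKernel m y x • (star (v x) * v x) =
          (‖m x y‖ ^ 2 : ℝ) • (star (v x) * v x) := by
        simp only [adjSqKernel]
        exact Complex.coe_smul _ _
      rw [h2, map_smul, hL, quad_star_mul, smul_eq_mul]
    have hint := L.integrable_comp hi
    have h3 := L.integral_comp_comm hi
    rw [intOp, ← hL, ← h3, ofReal_integral_eq_lintegral_ofReal hint]
    · refine lintegral_congr fun x => ?_
      rw [hpt, ENNReal.ofReal_mul (by positivity), enorm_sq_eq_ofReal, enorm_sq_eq_ofReal]
    · exact Filter.Eventually.of_forall fun x => by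
        show 0 ≤ L _
        rw [hpt]; positivity
  calc ∫⁻ x, ‖m x y‖ₑ ^ 2 * hsSq (v x * star g) ∂μ
      = ∫⁻ x, ∑' n, ‖m x y‖ₑ ^ 2 * ‖v x (star g (stdBasis n))‖ₑ ^ 2 ∂μ := by
        refine lintegral_congr fun x => ?_
        rw [ENNReal.tsum_mul_left]; rfl
    _ = ∑' n, ∫⁻ x, ‖m x y‖ₑ ^ 2 * ‖v x (star g (stdBasis n))‖ₑ ^ 2 ∂μ :=
        lintegral_tsum fun n => ((hmy.enorm.pow_const 2).mul
            ((stronglyMeasurable_apply hv _).enorm.pow_const 2)).aemeasurable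
    _ = _ := by
        rw [opTrace_def]
        refine tsum_congr fun n => ?_
        rw [h1]
        congr 1
        simp only [quad, mul_assoc, mul_apply_eq_comp]
        rw [← inner_star_left g]

/-- Cauchy–Schwarz for `Tr(g a y b g*)`. -/
theorem opTrace_mul_mul_le (g a c b : Op) :
    opTrace (g * (a * c * b) * star g) ≤
      ‖c‖ₑ * ∑' n, ‖(star a * star g) (stdBasis n)‖ₑ * ‖(b * star g) (stdBasis n)‖ₑ := by
  rw [opTrace_def, ← ENNReal.tsum_mul_left]
  refine ENNReal.tsum_le_tsum fun n => ?_
  set e := stdBasis n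
  have h : ⟪e, (g * (a * c * b) * star g) e⟫_ℂ =
      ⟪(star a * star g) e, c ((b * star g) e)⟫_ℂ := by
    rw [← star_mul, inner_star_left]
    simp only [mul_apply_eq_comp]
  rw [quad, h]
  calc _ ≤ ENNReal.ofReal ‖⟪(star a * star g) e, c ((b * star g) e)⟫_ℂ‖ :=
        ENNReal.ofReal_le_ofReal (Complex.re_le_norm _)
    _ ≤ ENNReal.ofReal (‖(star a * star g) e‖ * (‖c‖ * ‖(b * star g) e‖)) := by
        refine ENNReal.ofReal_le_ofReal ((norm_inner_le_norm _ _).trans ?_)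
        gcongr
        exact c.le_opNorm _
    _ = _ := by
        rw [ENNReal.ofReal_mul (norm_nonneg _), ENNReal.ofReal_mul (norm_nonneg _), ofReal_norm,
          ofReal_norm, ofReal_norm]
        ring

theorem opTrace_sum {ι : Type*} (s : Finset ι) {A : ι → Op} (hA : ∀ j, 0 ≤ A j) :
    opTrace (∑ j ∈ s, A j) = ∑ j ∈ s, opTrace (A j) := by
  simp only [opTrace_def, quad_sum]
  rw [← Summable.tsum_finsetSum fun _ _ => ENNReal.summable]
  exact tsum_congr fun n => ENNReal.ofReal_sum_of_nonneg fun j _ => quad_nonneg (hA j) _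

theorem sum_hsSq_mul_star {N : ℕ} (b : Op) (g : Fin N → Op) :
    ∑ j, hsSq (b * star (g j)) = opTrace (b * (∑ j, star (g j) * g j) * star b) := by
  have h : b * (∑ j, star (g j) * g j) * star b =
      ∑ j, star (g j * star b) * (g j * star b) := by
    rw [Finset.mul_sum, Finset.sum_mul]
    simp only [star_mul, star_star, mul_assoc]
  rw [h, opTrace_sum _ fun j => star_mul_self_nonneg _]
  refine Finset.sum_congr rfl fun j _ => ?_
  rw [opTrace_star_mul, ← hsSq_star, star_mul, star_star]

theorem sum_tsum_mul_sq_le {N : ℕ} (u v : Fin N → ℕ → ℝ≥0∞) :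
    (∑ j, ∑' n, u j n * v j n) ^ 2 ≤
      (∑ j, ∑' n, u j n ^ 2) * (∑ j, ∑' n, v j n ^ 2) := by
  have h := lintegral_mul_sq_le (μ := (Measure.count : Measure (Fin N × ℕ)))
    (f := fun i => u i.1 i.2) (g := fun i => v i.1 i.2)
    (measurable_of_countable _).aemeasurable (measurable_of_countable _).aemeasurable
  simp only [lintegral_count] at h
  rw [ENNReal.tsum_prod (f := fun j n => u j n * v j n),
    ENNReal.tsum_prod (f := fun j n => u j n ^ 2),
    ENNReal.tsum_prod (f := fun j n => v j n ^ 2)] at h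
  simpa only [tsum_fintype] using h

end

section

variable {Ω : Type*} [MeasurableSpace Ω] {μ : Measure Ω}

theorem stronglyMeasurable_sum_star_mul {N : ℕ} {f : Fin N → Ω → Op}
    (hf : ∀ j, StronglyMeasurable (f j)) :
    StronglyMeasurable (fun x => ∑ j, star (f j x) * f j x) :=
  Finset.stronglyMeasurable_fun_sum _ fun j _ => (hf j).star.mul (hf j)

/-- Hölder's inequality `∫ Tr(b G b*) ≤ ‖b‖² ‖G‖` with `b ∈ L^{2q}(S^{2q})`, `G ∈ L^r(S^r)`. -/
theorem lintegral_opTrace_conj_le {q r : ℝ≥0∞} (hr : r ≠ ∞) (hqr : q.HolderConjugate r)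
    {b G : Ω → Op} (hb : AEStronglyMeasurable b μ) (hG : AEStronglyMeasurable G μ)
    (h0 : ∀ x, 0 ≤ G x) (hc : ∀ᵐ x ∂μ, IsCompactOperator (G x : L2 → L2)) :
    ∫⁻ x, opTrace (b x * G x * star (b x)) ∂μ ≤
      schattenLpNorm (2 * q) μ b ^ 2 *
        (∫⁻ x, opTrace (G x ^ r.toReal) ∂μ) ^ (1 / r.toReal) := by
  have hr0 : 0 < r.toReal := ENNReal.toReal_pos hqr.symm.ne_zero hr
  have hq0 : q ≠ 0 := hqr.ne_zero
  have hG' : AEMeasurable (fun x => opTrace (G x ^ r.toReal)) μ :=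
    aemeasurable_opTrace (aestronglyMeasurable_rpow hG h0 hr0)
  have h1 : ∫⁻ x, opTrace (b x * G x * star (b x)) ∂μ ≤
      ∫⁻ x, schattenNorm (2 * q) (b x) ^ 2 * opTrace (G x ^ r.toReal) ^ (1 / r.toReal) ∂μ :=
    lintegral_mono_ae (hc.mono fun x hx => opTrace_conj_le (h0 x) hx (b x) hr hqr)
  refine h1.trans ?_
  have hb' : AEMeasurable (fun x => schattenNorm (2 * q) (b x)) μ :=
    aemeasurable_schattenNorm (by simp [hq0]) hb
  by_cases hq : q = ∞
  · have hr1 : r = 1 := by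
      have := hqr.inv_add_inv_eq_one
      simpa [hq] using this
    subst hr1
    simp only [ENNReal.toReal_one, one_div_one, ENNReal.rpow_one] at hG' ⊢
    rw [← lintegral_const_mul'' _ hG']
    refine lintegral_mono_ae ?_
    have h2 : (2 * q : ℝ≥0∞) = ∞ := by rw [hq]; exact ENNReal.mul_top two_ne_zero
    rw [h2, schattenLpNorm, eLpNorm_exponent_top]
    filter_upwards [enorm_ae_le_eLpNormEssSup (fun x => schattenNorm ∞ (b x)) μ] with x hx
    gcongr
    simpa using hx
  · have hq1 : 0 < q.toReal := ENNReal.toReal_pos hq0 hq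
    have hconj : q.toReal.HolderConjugate r.toReal := by
      have := hqr
      exact ENNReal.HolderConjugate.toReal_of_ne_top hq hr
    have h := ENNReal.lintegral_mul_le_Lp_mul_Lq μ hconj (hb'.pow_const 2)
      (hG'.pow_const (1 / r.toReal))
    refine h.trans (le_of_eq ?_)
    congr 1
    · rw [schattenLpNorm, eLpNorm_eq_lintegral_rpow_enorm_toReal (by simp [hq0])
        (ENNReal.mul_ne_top ENNReal.ofNat_ne_top hq)]
      rw [← ENNReal.rpow_natCast (_ ^ _) 2, ← ENNReal.rpow_mul, ENNReal.toReal_mul]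
      simp only [ENNReal.toReal_ofNat, enorm_eq_self]
      congr 1
      · refine lintegral_congr fun x => ?_
        rw [← ENNReal.rpow_natCast, ← ENNReal.rpow_mul]
        norm_num
      · field_simp
        norm_num
    · congr 1
      refine lintegral_congr fun x => ?_
      rw [← ENNReal.rpow_mul, one_div, inv_mul_cancel₀ hr0.ne', ENNReal.rpow_one]

/-- Cauchy–Schwarz for `∑ Tr(g_j a y_j b g_j*)`, jointly in `j` and in the trace. -/
theorem sum_opTrace_mul_mul_sq_le {N : ℕ} (g : Fin N → Op) (c : Fin N → Op) (a b : Op)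
    {Y : ℝ≥0∞} (hY : ∀ j, ‖c j‖ₑ ≤ Y) :
    (∑ j, opTrace (g j * (a * c j * b) * star (g j))) ^ 2 ≤
      Y ^ 2 * (opTrace (star a * (∑ j, star (g j) * g j) * star (star a)) *
        opTrace (b * (∑ j, star (g j) * g j) * star b)) := by
  rw [← sum_hsSq_mul_star, ← sum_hsSq_mul_star]
  calc _ ≤ (∑ j, Y * ∑' n, ‖(star a * star (g j)) (stdBasis n)‖ₑ *
        ‖(b * star (g j)) (stdBasis n)‖ₑ) ^ 2 := by
        gcongr with j
        refine (opTrace_mul_mul_le _ _ _ _).trans ?_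
        gcongr
        exact hY j
    _ ≤ _ := by
        rw [← Finset.mul_sum, mul_pow]
        gcongr
        exact sum_tsum_mul_sq_le _ _

/-- The duality estimate for one factorization `a y b` of the maximal function. -/
theorem sum_lintegral_hsSq_le_of_factorization {Z : Type*} {q r : ℝ≥0∞} (hr : r ≠ ∞)
    (hqr : q.HolderConjugate r) {k s m : Z → Ω → Ω → ℂ} (hd : SquareDecomposition q μ k s m)
    {M : ℝ≥0∞} (hM' : M ≠ ∞) (hM : ∀ z x, eLpNorm (s z x) 2 μ ≤ M) {N : ℕ} (z : Fin N → Z)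
    {f : Fin N → Ω → Op} (hf : ∀ j, StronglyMeasurable (f j))
    (hc : ∀ j, ∀ᵐ x ∂μ, IsCompactOperator (f j x : L2 → L2))
    {v : Ω → Op} (hv : StronglyMeasurable v) {S : Fin N → Set Ω} {E : Set Ω}
    [∀ j, SFinite (μ.restrict (S j))] [SFinite (μ.restrict E)] (hfS : ∀ j, ∀ y ∉ S j, f j y = 0)
    (hvE : ∀ x ∉ E, v x = 0) (hu : MemSchattenLp q μ fun x => star (v x) * v x)
    {a b : Ω → Op} {y : Z → Ω → Op} (hab : OpFactorization q μ
      (fun z => intOp (E := Op) μ (adjSqKernel (m z)) fun x => star (v x) * v x) a b y) :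
    ∑ j, ∫⁻ x, hsSq (intOp (E := Op) μ (k (z j)) (f j) x * star (v x)) ∂μ ≤
      M ^ 2 * (∫⁻ x, opTrace ((∑ j, star (f j x) * f j x) ^ r.toReal) ∂μ) ^ (1 / r.toReal) *
        (schattenLpNorm (2 * q) μ a * (⨆ z, eLpNorm (fun x => ‖y z x‖ₑ) ∞ μ) *
          schattenLpNorm (2 * q) μ b) := by
  have hq0 : q ≠ 0 := hqr.ne_zero
  have hq2 : 2 ≤ 2 * q := by
    have : 1 ≤ q := hqr.one_le
    calc (2 : ℝ≥0∞) = 2 * 1 := by simp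
      _ ≤ _ := by gcongr
  set Y := ⨆ z, eLpNorm (fun x => ‖y z x‖ₑ) ∞ μ
  set G : Ω → Op := fun x => ∑ j, star (f j x) * f j x with hGdef
  set W := (∫⁻ x, opTrace (G x ^ r.toReal) ∂μ) ^ (1 / r.toReal)
  have hG : StronglyMeasurable G := stronglyMeasurable_sum_star_mul hf
  have hG0 : ∀ x, 0 ≤ G x := fun x => sum_star_mul_nonneg fun j => f j x
  have hGc : ∀ᵐ x ∂μ, IsCompactOperator (G x : L2 → L2) := by
    filter_upwards [ae_all_iff.2 hc] with x hx
    exact (compactOperator (RingHom.id ℂ) L2 L2).sum_mem fun j _ =>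
      isCompactOperator_mul_left (hx j) _
  have hYae : ∀ᵐ x ∂μ, ∀ j, ‖y (z j) x‖ₑ ≤ Y := by
    rw [ae_all_iff]
    intro j
    filter_upwards [enorm_ae_le_eLpNormEssSup (fun x => ‖y (z j) x‖ₑ) μ] with x hx
    refine le_trans ?_ (le_iSup (fun z => eLpNorm (fun x => ‖y z x‖ₑ) ∞ μ) (z j))
    rw [eLpNorm_exponent_top]
    simpa using hx
  have hint : ∀ᵐ t ∂μ, ∀ j, Integrable
      (fun x => adjSqKernel (m (z j)) t x • (star (v x) * v x)) μ := by
    rw [ae_all_iff]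
    intro j
    refine ae_integrable_smul ?_ (hd.isDefinedOn (z j)) (hu.memLp hq0)
    have := ((hd.measurable_m (z j)).comp measurable_swap).norm.pow_const 2
    exact Complex.measurable_ofReal.comp this
  set A : Ω → ℝ≥0∞ := fun t => opTrace (star (a t) * G t * star (star (a t)))
  set B : Ω → ℝ≥0∞ := fun t => opTrace (b t * G t * star (b t))
  have hA : AEMeasurable A μ := aemeasurable_opTrace
    ((hab.left_mem.1.star.mul hG.aestronglyMeasurable).mul hab.left_mem.1.star.star)
  have hB : AEMeasurable B μ := aemeasurable_opTrace
    ((hab.right_mem.1.mul hG.aestronglyMeasurable).mul hab.right_mem.1.star)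
  have hAle : ∫⁻ t, A t ∂μ ≤ schattenLpNorm (2 * q) μ a ^ 2 * W := by
    rw [← schattenLpNorm_star hq2]
    exact lintegral_opTrace_conj_le hr hqr hab.left_mem.1.star hG.aestronglyMeasurable hG0 hGc
  have hBle : ∫⁻ t, B t ∂μ ≤ schattenLpNorm (2 * q) μ b ^ 2 * W :=
    lintegral_opTrace_conj_le hr hqr hab.right_mem.1 hG.aestronglyMeasurable hG0 hGc
  have hmeas : ∀ j, Measurable fun t =>
      ∫⁻ x, ‖m (z j) x t‖ₑ ^ 2 * hsSq (v x * star (f j t)) ∂(μ.restrict E) := by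
    intro j
    refine Measurable.lintegral_prod_left (f := fun x t => ‖m (z j) x t‖ₑ ^ 2 * hsSq (v x * star (f j t))) ?_
    refine ((hd.measurable_m _).enorm.pow_const 2).mul (measurable_hsSq ?_)
    exact (hv.comp_measurable measurable_fst).mul ((hf j).comp_measurable measurable_snd).star
  have hpt : ∀ᵐ t ∂μ, ∑ j, ∫⁻ x, ‖m (z j) x t‖ₑ ^ 2 * hsSq (v x * star (f j t)) ∂μ ≤
      Y * (A t ^ (1 / 2 : ℝ) * B t ^ (1 / 2 : ℝ)) := by
    filter_upwards [hYae, hint, ae_all_iff.2 fun j => hab.eq_mul (z j)] with t h1 h2 h3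
    have h4 : ∑ j, ∫⁻ x, ‖m (z j) x t‖ₑ ^ 2 * hsSq (v x * star (f j t)) ∂μ =
        ∑ j, opTrace (f j t * (a t * y (z j) t * b t) * star (f j t)) := by
      refine Finset.sum_congr rfl fun j _ => ?_
      rw [lintegral_mul_hsSq_eq hv (f j t) (hd.measurable_m (z j)) t (h2 j)]
      exact congrArg (fun U => opTrace (f j t * U * star (f j t))) (h3 j)
    rw [h4]
    have h5 := sum_opTrace_mul_mul_sq_le (fun j => f j t) (fun j => y (z j) t) (a t) (b t) h1
    rw [← ENNReal.mul_rpow_of_nonneg _ _ (by norm_num : (0:ℝ) ≤ 1 / 2)]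
    have h6 := ENNReal.rpow_le_rpow h5 (by norm_num : (0:ℝ) ≤ 1 / 2)
    rw [ENNReal.mul_rpow_of_nonneg _ _ (by norm_num : (0:ℝ) ≤ 1 / 2),
      ← ENNReal.rpow_natCast, ← ENNReal.rpow_natCast, ← ENNReal.rpow_mul, ← ENNReal.rpow_mul] at h6
    simpa [A, B, G] using h6
  calc ∑ j, ∫⁻ x, hsSq (intOp (E := Op) μ (k (z j)) (f j) x * star (v x)) ∂μ
      ≤ ∑ j, M ^ 2 * ∫⁻ t, ∫⁻ x, ‖m (z j) x t‖ₑ ^ 2 * hsSq (v x * star (f j t)) ∂μ ∂μ :=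
        Finset.sum_le_sum fun j _ => lintegral_hsSq_intOp_mul_le (hd.measurable_s _)
          (hd.measurable_m _) (hd.eq_mul _) hM' (hM _) (hf j) hv (hfS j) hvE
    _ = M ^ 2 * ∫⁻ t, ∑ j, ∫⁻ x, ‖m (z j) x t‖ₑ ^ 2 * hsSq (v x * star (f j t)) ∂μ ∂μ := by
        rw [← Finset.mul_sum, lintegral_finsetSum']
        intro j _
        refine (hmeas j).aemeasurable.congr (Filter.Eventually.of_forall fun t => ?_)
        refine setLIntegral_eq_of_support_subset fun x hx => ?_
        by_contra hxE
        exact hx (by simp [hvE x hxE, hsSq])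
    _ ≤ M ^ 2 * ∫⁻ t, Y * (A t ^ (1 / 2 : ℝ) * B t ^ (1 / 2 : ℝ)) ∂μ := by
        exact mul_le_mul_right (lintegral_mono_ae hpt) _
    _ = M ^ 2 * (Y * ∫⁻ t, A t ^ (1 / 2 : ℝ) * B t ^ (1 / 2 : ℝ) ∂μ) := by
        rw [lintegral_const_mul' _ _ hab.mid_bounded.ne]
    _ ≤ M ^ 2 * (Y * ((∫⁻ t, A t ∂μ) ^ (1 / 2 : ℝ) * (∫⁻ t, B t ∂μ) ^ (1 / 2 : ℝ))) := by
        gcongr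
        have h := ENNReal.lintegral_mul_le_Lp_mul_Lq μ Real.HolderConjugate.two_two
          (hA.pow_const (1 / 2 : ℝ)) (hB.pow_const (1 / 2 : ℝ))
        have e : ∀ t : ℝ≥0∞, (t ^ (1 / 2 : ℝ)) ^ (2 : ℝ) = t := fun t => by
          rw [← ENNReal.rpow_mul]; norm_num
        simp only [e] at h
        exact h
    _ ≤ M ^ 2 * (Y * ((schattenLpNorm (2 * q) μ a ^ 2 * W) ^ (1 / 2 : ℝ) *
          (schattenLpNorm (2 * q) μ b ^ 2 * W) ^ (1 / 2 : ℝ))) := by gcongr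
    _ = _ := by
        have e : ∀ t : ℝ≥0∞, (t ^ 2 * W) ^ (1 / 2 : ℝ) = t * W ^ (1 / 2 : ℝ) := fun t => by
          rw [ENNReal.mul_rpow_of_nonneg _ _ (by norm_num), ← ENNReal.rpow_natCast,
            ← ENNReal.rpow_mul]
          norm_num
        have e2 : W ^ (1 / 2 : ℝ) * W ^ (1 / 2 : ℝ) = W := by
          rw [← ENNReal.rpow_add_of_nonneg _ _ (by norm_num) (by norm_num)]; norm_num
        rw [e, e]
        conv_rhs => rw [← e2]
        ring

/-- The duality estimate: `Σ ∫ Tr(|T_j f_j|² u)` is controlled by the maximal norm of `T* u`. -/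
theorem sum_lintegral_hsSq_le {Z : Type*} {q r : ℝ≥0∞} (hr : r ≠ ∞)
    (hqr : q.HolderConjugate r) {k s m : Z → Ω → Ω → ℂ} (hd : SquareDecomposition q μ k s m)
    {M : ℝ≥0∞} (hM' : M ≠ ∞) (hM : ∀ z x, eLpNorm (s z x) 2 μ ≤ M) {N : ℕ} (z : Fin N → Z)
    {f : Fin N → Ω → Op} (hf : ∀ j, StronglyMeasurable (f j))
    (hc : ∀ j, ∀ᵐ x ∂μ, IsCompactOperator (f j x : L2 → L2))
    {v : Ω → Op} (hv : StronglyMeasurable v) {S : Fin N → Set Ω} {E : Set Ω}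
    [∀ j, SFinite (μ.restrict (S j))] [SFinite (μ.restrict E)] (hfS : ∀ j, ∀ y ∉ S j, f j y = 0)
    (hvE : ∀ x ∉ E, v x = 0) (hu : MemSchattenLp q μ fun x => star (v x) * v x)
    (hW : ∫⁻ x, opTrace ((∑ j, star (f j x) * f j x) ^ r.toReal) ∂μ ≠ ∞) {L : ℝ≥0∞} (hL' : L ≠ ∞)
    (hL : opSupNorm q μ (fun z => intOp (E := Op) μ (adjSqKernel (m z))
      fun x => star (v x) * v x) ≤ L) :
    ∑ j, ∫⁻ x, hsSq (intOp (E := Op) μ (k (z j)) (f j) x * star (v x)) ∂μ ≤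
      M ^ 2 * (∫⁻ x, opTrace ((∑ j, star (f j x) * f j x) ^ r.toReal) ∂μ) ^ (1 / r.toReal) *
        L := by
  set W := (∫⁻ x, opTrace ((∑ j, star (f j x) * f j x) ^ r.toReal) ∂μ) ^ (1 / r.toReal)
  have hc' : M ^ 2 * W ≠ ∞ := ENNReal.mul_ne_top (ENNReal.pow_ne_top hM')
    (ENNReal.rpow_ne_top_of_nonneg (by positivity) hW)
  have key : ∀ t, L < t → ∑ j, ∫⁻ x, hsSq (intOp (E := Op) μ (k (z j)) (f j) x * star (v x)) ∂μ ≤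
      M ^ 2 * W * t := by
    intro t ht
    have h := hL.trans_lt ht
    simp only [opSupNorm, iInf_lt_iff] at h
    obtain ⟨a, b, y, hab, h⟩ := h
    refine (sum_lintegral_hsSq_le_of_factorization hr hqr hd hM' hM z hf hc hv hfS hvE hu
      hab).trans ?_
    gcongr
  have hlim : Filter.Tendsto (fun t => M ^ 2 * W * t) (nhdsWithin L (Set.Ioi L))
      (nhds (M ^ 2 * W * L)) :=
    (ENNReal.Tendsto.const_mul Filter.tendsto_id (Or.inr hc')).mono_left nhdsWithin_le_nhds
  have : (nhdsWithin L (Set.Ioi L)).NeBot := nhdsGT_neBot_of_exists_gt ⟨∞, hL'.lt_top⟩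
  exact ge_of_tendsto hlim (eventually_nhdsWithin_of_forall fun t ht => key t ht)

end

/-! ### Self-improvement of the duality estimate -/

theorem rpow_add_of_nonneg (B : Op) {x y : ℝ} (hx : 0 ≤ x) (hy : 0 ≤ y) :
    B ^ (x + y) = B ^ x * B ^ y := by
  simp only [CFC.rpow_def]
  rw [← cfc_mul _ _ B (NNReal.continuous_rpow_const hx).continuousOn
    (NNReal.continuous_rpow_const hy).continuousOn]
  exact cfc_congr fun z _ => NNReal.rpow_add_of_nonneg z hx hy

theorem star_rpow (B : Op) (x : ℝ) : star (B ^ x) = B ^ x :=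
  (IsSelfAdjoint.of_nonneg (rpow_nonneg' B x)).star_eq

/-- `Tr B^r ≤ ‖B‖^{r-1} Tr B`, which makes the integrals below finite. -/
theorem opTrace_rpow_le_mul {B : Op} (hB : 0 ≤ B) (hc : IsCompactOperator (B : L2 → L2)) {c r : ℝ}
    (hr : 1 ≤ r) (hB' : ‖B‖ ≤ c) :
    opTrace (B ^ r) ≤ ENNReal.ofReal c ^ (r - 1) * opTrace B := by
  obtain ⟨ι, b, l, hl, hl0, hq⟩ := exists_eigenbasis_of_nonneg hB hc
  rw [opTrace_rpow_eq_tsum b hB hl (by linarith), ← opTrace_eq_tsum b hB, ← ENNReal.tsum_mul_left]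
  refine ENNReal.tsum_le_tsum fun i => ?_
  rw [hq]
  have h1 : l i ≤ c := by
    rw [← hq]
    refine (quad_le_norm B (b i)).trans ?_
    simpa [hilbertBasis_norm] using hB'
  calc ENNReal.ofReal (l i) ^ r = ENNReal.ofReal (l i) ^ (r - 1) * ENNReal.ofReal (l i) := by
        conv_lhs => rw [show r = (r - 1) + 1 by ring]
        rw [ENNReal.rpow_add_of_nonneg _ _ (by linarith) zero_le_one, ENNReal.rpow_one]
    _ ≤ _ := by gcongr

theorem opTrace_conj_coordProj_le (A : Op) (d : ℕ) :
    opTrace (coordProj d * A * coordProj d) ≤ d * ‖A‖ₑ := by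
  have h : ∀ n, ENNReal.ofReal (quad (coordProj d * A * coordProj d) (stdBasis n)) ≤
      if n ∈ Finset.range d then ‖A‖ₑ else 0 := by
    intro n
    have h1 : quad (coordProj d * A * coordProj d) (stdBasis n) =
        quad A (coordProj d (stdBasis n)) := by
      simp only [quad, mul_apply_eq_comp, inner_coordProj]
    rw [h1, coordProj_stdBasis]
    simp only [Finset.mem_range]
    split_ifs
    · rw [← ofReal_norm]
      refine ENNReal.ofReal_le_ofReal ((quad_le_norm _ _).trans ?_)
      simp [norm_stdBasis]
    · simp [quad]
  rw [opTrace_def]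
  refine (ENNReal.tsum_le_tsum h).trans ?_
  rw [tsum_eq_sum (s := Finset.range d) fun n hn => if_neg hn]
  simp +contextual

theorem conj_coordProj_nonneg {A : Op} (hA : 0 ≤ A) (d : ℕ) :
    0 ≤ coordProj d * A * coordProj d := by
  simpa [star_coordProj] using star_left_conjugate_nonneg hA (coordProj d)

theorem opTrace_conj_coordProj_rpow_le {A : Op} (hA : 0 ≤ A) (d : ℕ) {r : ℝ} (hr : 1 ≤ r) :
    opTrace ((coordProj d * A * coordProj d) ^ r) ≤ opTrace (A ^ r) := by
  have h1 : coordProj d * A * coordProj d =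
      star (CFC.sqrt A * coordProj d) * (CFC.sqrt A * coordProj d) := by
    conv_lhs => rw [← CFC.sqrt_mul_sqrt_self A hA]
    rw [star_mul, star_coordProj, (IsSelfAdjoint.of_nonneg (CFC.sqrt_nonneg A)).star_eq]
    simp only [mul_assoc]
  have h2 : (CFC.sqrt A * coordProj d) * star (CFC.sqrt A * coordProj d) ≤ A := by
    have h3 : coordProj d ≤ 1 := by
      refine le_of_quad (star_coordProj d) (IsSelfAdjoint.one _) fun v => ?_
      rw [quad_one]
      refine (quad_le_norm _ _).trans ?_
      exact mul_le_of_le_one_left (by positivity) (norm_coordProj_le d)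
    have h4 := star_right_conjugate_le_conjugate h3 (CFC.sqrt A)
    rw [(IsSelfAdjoint.of_nonneg (CFC.sqrt_nonneg A)).star_eq, mul_one,
      CFC.sqrt_mul_sqrt_self A hA] at h4
    rw [star_mul, star_coordProj, (IsSelfAdjoint.of_nonneg (CFC.sqrt_nonneg A)).star_eq]
    calc _ = CFC.sqrt A * (coordProj d * coordProj d) * CFC.sqrt A := by simp only [mul_assoc]
      _ ≤ A := by rwa [coordProj_mul_self]
  rw [h1, opTrace_star_mul_rpow _ hr]
  exact opTrace_rpow_mono (mul_star_self_nonneg _) h2 hr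

/-- If `I ≤ K I^{1/q}` with `I` finite, then `I ≤ K^r`. -/
theorem le_rpow_of_le_mul_rpow {I K : ℝ≥0∞} (hI : I ≠ ∞) {q r : ℝ≥0∞} (hr : r ≠ ∞)
    (hqr : q.HolderConjugate r) (h : I ≤ K * I ^ (1 / q.toReal)) : I ≤ K ^ r.toReal := by
  have hr0 : 0 < r.toReal := ENNReal.toReal_pos hqr.symm.ne_zero hr
  by_cases h0 : I = 0
  · simp [h0]
  have hsum : 1 / q.toReal + 1 / r.toReal = 1 := by
    have h1 := hqr.inv_add_inv_eq_one
    have h2 := congrArg ENNReal.toReal h1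
    rw [ENNReal.toReal_add (ENNReal.inv_ne_top.2 hqr.ne_zero)
      (ENNReal.inv_ne_top.2 hqr.symm.ne_zero)] at h2
    simpa using h2
  have h1 : I = I ^ (1 / r.toReal) * I ^ (1 / q.toReal) := by
    rw [← ENNReal.rpow_add _ _ h0 hI, add_comm, hsum, ENNReal.rpow_one]
  have h2 : I ^ (1 / r.toReal) ≤ K := by
    have h3 : I ^ (1 / q.toReal) ≠ 0 := by simp [ENNReal.rpow_eq_zero_iff, h0, hI]
    have h4 : I ^ (1 / q.toReal) ≠ ∞ := ENNReal.rpow_ne_top_of_nonneg (by positivity) hI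
    rw [← ENNReal.mul_le_mul_iff_left h3 h4, ← h1]
    exact h
  calc I = (I ^ (1 / r.toReal)) ^ r.toReal := by
        rw [← ENNReal.rpow_mul, one_div, inv_mul_cancel₀ hr0.ne', ENNReal.rpow_one]
    _ ≤ _ := ENNReal.rpow_le_rpow h2 hr0.le

section

variable {Ω : Type*} [MeasurableSpace Ω] {μ : Measure Ω}

/-- The dual function `P B^{r-1} P` has `q`-th power norm at most `∫ Tr B^r`, as `(r-1) q = r`. For
`q = ∞` the exponent `1 / q.toReal` is `0` and the bound is `1`. -/
theorem schattenLpNorm_compression_le {q r : ℝ≥0∞} (hr : r ≠ ∞) (hqr : q.HolderConjugate r)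
    {B : Ω → Op} (h0 : ∀ x, 0 ≤ B x) {E : Set Ω} (hE : MeasurableSet E) (d : ℕ) :
    schattenLpNorm q μ (E.indicator fun x => coordProj d * B x ^ (r.toReal - 1) * coordProj d) ≤
      (∫⁻ x in E, opTrace (B x ^ r.toReal) ∂μ) ^ (1 / q.toReal) := by
  by_cases hq : q = ∞
  · have hr1 : r = 1 := by simpa [hq] using hqr.inv_add_inv_eq_one
    subst hq hr1
    simp only [ENNReal.toReal_one, sub_self, ENNReal.toReal_top, div_zero, ENNReal.rpow_zero]
    rw [schattenLpNorm, eLpNorm_exponent_top]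
    refine essSup_le_of_ae_le _ (Filter.Eventually.of_forall fun x => ?_)
    simp only [schattenNorm, if_true, enorm_eq_self]
    by_cases hx : x ∈ E
    · rw [Set.indicator_of_mem hx, CFC.rpow_zero _ (h0 x), mul_one, coordProj_mul_self]
      rw [← ofReal_norm]
      exact ENNReal.ofReal_le_one.2 (norm_coordProj_le d)
    · simp [Set.indicator_of_notMem hx]
  · have hq0 := hqr.ne_zero
    have hconj : q.toReal.HolderConjugate r.toReal := by
      have := hqr
      exact ENNReal.HolderConjugate.toReal_of_ne_top hq hr
    have hexp : (r.toReal - 1) * q.toReal = r.toReal := by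
      have := hconj.symm.sub_one_mul_conj
      linarith
    rw [schattenLpNorm, eLpNorm_eq_lintegral_rpow_enorm_toReal hq0 hq, ← lintegral_indicator hE]
    gcongr with x
    rw [enorm_eq_self, schattenNorm_rpow hq hq0]
    by_cases hx : x ∈ E
    · simp only [Set.indicator_of_mem hx]
      rw [← abs_rpow _ hconj.nonneg, CFC.abs_of_nonneg _ (conj_coordProj_nonneg
        (rpow_nonneg' _ _) d)]
      refine (opTrace_conj_coordProj_rpow_le (rpow_nonneg' _ _) d hconj.lt.le).trans ?_
      rw [CFC.rpow_rpow_of_exponent_nonneg _ _ _ hconj.symm.sub_one_pos.le hconj.nonneg (h0 x),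
        hexp]
    · have hq2 : 0 < q.toReal / 2 := by linarith [hconj.pos]
      simp only [Set.indicator_of_notMem hx, mul_zero, opTrace_zero_rpow hq2, zero_le]

/-- The duality estimate, applied to `v = B^{(r-1)/2} P` with `B = P A P`, `A = ∑ |h_j|²`, has
`I = ∫ Tr B^r` on the left and `I^{1/q}` on the right, and therefore bounds `I`. -/
theorem lintegral_opTrace_compression_le {q r : ℝ≥0∞} (hr : r ≠ ∞) (hqr : q.HolderConjugate r)
    {N : ℕ} {h : Fin N → Ω → Op} (hh : ∀ j, StronglyMeasurable (h j)) {d : ℕ} {E : Set Ω}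
    (hE : MeasurableSet E) (hμ : μ E ≠ ∞) {c : ℝ}
    (hc : ∀ x ∈ E, ‖∑ j, star (h j x) * h j x‖ ≤ c) {K : ℝ≥0∞}
    (H : ∀ v : Ω → Op, StronglyMeasurable v → (∀ x ∉ E, v x = 0) →
      MemSchattenLp q μ (fun x => star (v x) * v x) →
      (∀ x, coordProj d * (star (v x) * v x) * coordProj d = star (v x) * v x) →
      ∑ j, ∫⁻ x, hsSq (h j x * star (v x)) ∂μ ≤
        K * schattenLpNorm q μ (fun x => star (v x) * v x)) :
    ∫⁻ x in E, opTrace ((coordProj d * (∑ j, star (h j x) * h j x) * coordProj d) ^ r.toReal) ∂μ ≤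
      K ^ r.toReal := by
  have hr1 : 1 ≤ r.toReal := by
    have := ENNReal.toReal_mono hr hqr.symm.one_le
    simpa using this
  set A : Ω → Op := fun x => ∑ j, star (h j x) * h j x with hAdef
  have hA0 : ∀ x, 0 ≤ A x := fun x => sum_star_mul_nonneg fun j => h j x
  have hAm : StronglyMeasurable A := stronglyMeasurable_sum_star_mul hh
  set B : Ω → Op := fun x => coordProj d * A x * coordProj d with hBdef
  have hB0 : ∀ x, 0 ≤ B x := fun x => conj_coordProj_nonneg (hA0 x) d
  have hBm : StronglyMeasurable B := (stronglyMeasurable_const.mul hAm).mul stronglyMeasurable_const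
  have hBc : ∀ x, IsCompactOperator (B x : L2 → L2) := fun x =>
    isCompactOperator_mul_left (isCompactOperator_coordProj d) _
  set s := (r.toReal - 1) / 2 with hs
  have hs0 : 0 ≤ s := by rw [hs]; linarith
  have hBs : StronglyMeasurable fun x => B x ^ s := by
    rcases hs0.eq_or_lt with h | h
    · simp only [← h, CFC.rpow_zero _ (hB0 _)]
      exact stronglyMeasurable_const
    · exact stronglyMeasurable_rpow hBm hB0 h
  set v : Ω → Op := E.indicator fun x => B x ^ s * coordProj d with hv
  have hvm : StronglyMeasurable v := (hBs.mul stronglyMeasurable_const).indicator hE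
  have hu : (fun x => star (v x) * v x) =
      E.indicator fun x => coordProj d * B x ^ (r.toReal - 1) * coordProj d := by
    funext x
    by_cases hx : x ∈ E
    · simp only [hv, Set.indicator_of_mem hx]
      rw [star_mul, star_coordProj, star_rpow, show r.toReal - 1 = s + s by rw [hs]; ring,
        rpow_add_of_nonneg (B x) hs0 hs0]
      simp only [mul_assoc]
    · simp [hv, Set.indicator_of_notMem hx]
  set I := ∫⁻ x in E, opTrace (B x ^ r.toReal) ∂μ with hI
  have hIfin : I ≠ ∞ := by
    have h1 : ∀ x ∈ E, opTrace (B x ^ r.toReal) ≤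
        ENNReal.ofReal c ^ (r.toReal - 1) * (d * ENNReal.ofReal c) := by
      intro x hx
      have h2 : ‖B x‖ ≤ c := by
        refine le_trans ?_ (hc x hx)
        calc ‖B x‖ ≤ ‖coordProj d‖ * ‖A x‖ * ‖coordProj d‖ :=
              (norm_mul_le _ _).trans (by gcongr; exact norm_mul_le _ _)
          _ ≤ 1 * ‖A x‖ * 1 := by gcongr <;> exact norm_coordProj_le d
          _ = _ := by ring
      refine (opTrace_rpow_le_mul (hB0 x) (hBc x) hr1 h2).trans ?_
      gcongr
      refine (opTrace_conj_coordProj_le (A x) d).trans ?_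
      rw [← ofReal_norm]
      gcongr
      exact hc x hx
    refine ne_top_of_le_ne_top ?_ (setLIntegral_mono' hE h1)
    rw [setLIntegral_const]
    refine ENNReal.mul_ne_top (ENNReal.mul_ne_top ?_ ?_) hμ
    · exact ENNReal.rpow_ne_top_of_nonneg (by linarith) ENNReal.ofReal_ne_top
    · exact ENNReal.mul_ne_top (ENNReal.natCast_ne_top d) ENNReal.ofReal_ne_top
  have hnorm := schattenLpNorm_compression_le (μ := μ) hr hqr hB0 hE d
  rw [← hu] at hnorm
  have hmem : MemSchattenLp q μ (fun x => star (v x) * v x) :=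
    ⟨(hvm.star.mul hvm).aestronglyMeasurable, hnorm.trans_lt
      (ENNReal.rpow_lt_top_of_nonneg (by positivity) hIfin)⟩
  have hH := H v hvm (fun x hx => Set.indicator_of_notMem hx _) hmem fun x => by
    have hux := congrFun hu x
    beta_reduce at hux
    rw [hux]
    by_cases hx : x ∈ E
    · simp only [Set.indicator_of_mem hx]
      calc _ = (coordProj d * coordProj d) * B x ^ (r.toReal - 1) *
            (coordProj d * coordProj d) := by simp only [mul_assoc]
        _ = _ := by rw [coordProj_mul_self]
    · simp [Set.indicator_of_notMem hx]
  have hsum : ∑ j, ∫⁻ x, hsSq (h j x * star (v x)) ∂μ = I := by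
    have hms : ∀ j ∈ Finset.univ, Measurable fun x => hsSq (h j x * star (v x)) :=
      fun j _ => measurable_hsSq ((hh j).mul hvm.star)
    rw [← lintegral_finsetSum _ hms, hI, ← lintegral_indicator hE]
    refine lintegral_congr fun x => ?_
    by_cases hx : x ∈ E
    · have h1 : ∀ j, hsSq (h j x * star (v x)) = hsSq (v x * star (h j x)) := fun j => by
        rw [← hsSq_star, star_mul, star_star]
      simp only [h1]
      rw [sum_hsSq_mul_star]
      simp only [hv, Set.indicator_of_mem hx]
      congr 1
      rw [star_mul, star_coordProj, star_rpow]
      calc _ = B x ^ s * B x * B x ^ s := by simp only [hBdef, hAdef, mul_assoc]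
        _ = B x ^ s * B x ^ (1 : ℝ) * B x ^ s := by rw [CFC.rpow_one _ (hB0 x)]
        _ = _ := by
          rw [← rpow_add_of_nonneg (B x) hs0 zero_le_one,
            ← rpow_add_of_nonneg (B x) (by linarith) hs0]
          congr 1
          rw [hs]; ring
    · simp [hv, Set.indicator_of_notMem hx, hsSq]
  refine le_rpow_of_le_mul_rpow hIfin hr hqr ?_
  calc I = _ := hsum.symm
    _ ≤ _ := hH
    _ ≤ _ := by gcongr

/-- Sets of finite measure exhausting the set where `∑ |h_j|²` does not vanish, on which this sum
is bounded. -/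
theorem exists_exhaustion {p : ℝ≥0∞} (hp0 : p ≠ 0) (hp : p ≠ ∞) {N : ℕ} {h : Fin N → Ω → Op}
    (hh : ∀ j, StronglyMeasurable (h j))
    (hm : ∀ j i k, MemLp (fun x => ⟪stdBasis i, h j x (stdBasis k)⟫_ℂ) p μ) :
    ∃ E : ℕ → Set Ω, (∀ n, MeasurableSet (E n)) ∧ (∀ n, μ (E n) ≠ ∞) ∧
      (∀ n, ∀ x ∈ E n, ‖∑ j, star (h j x) * h j x‖ ≤ n) ∧
      ∀ x, ∑ j, star (h j x) * h j x ≠ 0 → ∀ᶠ n in Filter.atTop, x ∈ E n := by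
  set A : Ω → Op := fun x => ∑ j, star (h j x) * h j x with hAdef
  have hAm : StronglyMeasurable A := stronglyMeasurable_sum_star_mul hh
  have hφ : ∀ j i k, StronglyMeasurable fun x => ⟪stdBasis i, h j x (stdBasis k)⟫_ℂ :=
    fun j i k => (innerSL ℂ (stdBasis i)).continuous.comp_stronglyMeasurable
      (stronglyMeasurable_apply (hh j) _)
  -- finite unions of level sets of matrix coefficients; these have finite measure
  set F : ℕ → Set Ω := fun n => ⋃ j : Fin N, ⋃ i ∈ Finset.range n, ⋃ k ∈ Finset.range n,
    {x | ((n : ℝ≥0∞) + 1)⁻¹ ≤ ‖⟪stdBasis i, h j x (stdBasis k)⟫_ℂ‖ₑ} with hF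
  refine ⟨fun n => {x | ‖A x‖ ≤ n} ∩ F n, fun n => ?_, fun n => ?_, fun n x hx => hx.1, ?_⟩
  · refine (measurableSet_le hAm.norm.measurable measurable_const).inter ?_
    refine MeasurableSet.iUnion fun j => Finset.measurableSet_biUnion _ fun i _ =>
      Finset.measurableSet_biUnion _ fun k _ => ?_
    exact measurableSet_le measurable_const (hφ j i k).enorm
  · refine ne_top_of_le_ne_top ?_ (measure_mono Set.inter_subset_right)
    refine ((measure_iUnion_fintype_le μ _).trans_lt ?_).ne
    refine ENNReal.sum_lt_top.2 fun j _ => (measure_biUnion_finset_le _ _).trans_lt ?_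
    refine ENNReal.sum_lt_top.2 fun i _ => (measure_biUnion_finset_le _ _).trans_lt ?_
    refine ENNReal.sum_lt_top.2 fun k _ => ?_
    exact (hm j i k).meas_ge_lt_top'_enorm hp0 hp (by simp) (by simp)
  · intro x hx
    have h1 : ∃ j i k, ⟪stdBasis i, h j x (stdBasis k)⟫_ℂ ≠ 0 := by
      by_contra! hcon
      refine hx (Finset.sum_eq_zero fun j _ => ?_)
      have : h j x = 0 := by
        have h0 : hsSq (h j x) = 0 := by
          simp only [hsSq, ← tsum_enorm_inner_sq stdBasis, hcon]
          simp
        have h2 := enorm_sq_le_hsSq (h j x)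
        rw [h0] at h2
        simpa using h2
      rw [this, mul_zero]
    obtain ⟨j, i, k, hjik⟩ := h1
    obtain ⟨n1, hn1⟩ := exists_nat_ge ‖A x‖
    have h2 : ‖⟪stdBasis i, h j x (stdBasis k)⟫_ℂ‖ₑ ≠ 0 := by simpa using hjik
    obtain ⟨n2, hn2⟩ := ENNReal.exists_inv_nat_lt h2
    filter_upwards [Filter.eventually_ge_atTop (n1 + n2 + i + k + 1)] with n hn
    refine ⟨hn1.trans (by exact_mod_cast by omega), ?_⟩
    simp only [hF, Set.mem_iUnion, Finset.mem_range]
    refine ⟨j, i, by omega, k, by omega, le_trans ?_ hn2.le⟩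
    refine ENNReal.inv_le_inv.2 ?_
    exact_mod_cast by omega

end

/-! ### The column estimate -/

theorem holderConjugate_of_two_le {p : ℝ≥0∞} (hp : 2 ≤ p) (hp' : p ≠ ∞) :
    (p / (p - 2)).HolderConjugate (p / 2) := by
  have hp0 : p ≠ 0 := (lt_of_lt_of_le two_pos hp).ne'
  rw [ENNReal.holderConjugate_iff, ENNReal.inv_div (Or.inr hp') (Or.inr hp0),
    ENNReal.inv_div (Or.inr hp') (Or.inr hp0), ENNReal.div_add_div_same, tsub_add_cancel_of_le hp,
    ENNReal.div_self hp0 hp']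

section

variable {Ω : Type*} [MeasurableSpace Ω] {μ : Measure Ω}

theorem lintegral_Lp_finsetSum_le {ι : Type*} (s : Finset ι) {g : ι → Ω → ℝ≥0∞}
    (hg : ∀ j ∈ s, AEMeasurable (g j) μ) {r : ℝ} (hr : 1 ≤ r) :
    (∫⁻ x, (∑ j ∈ s, g j x) ^ r ∂μ) ^ (1 / r) ≤ ∑ j ∈ s, (∫⁻ x, g j x ^ r ∂μ) ^ (1 / r) := by
  have hr0 : 0 < r := by linarith
  classical
  induction s using Finset.induction_on with
  | empty => simp [hr0]
  | insert a s ha ih =>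
    simp only [Finset.sum_insert ha]
    have h1 := ENNReal.lintegral_Lp_add_le (hg a (Finset.mem_insert_self a s))
      (Finset.aemeasurable_fun_sum s fun j hj => hg j (Finset.mem_insert_of_mem hj)) hr
    refine h1.trans ?_
    gcongr
    exact ih fun j hj => hg j (Finset.mem_insert_of_mem hj)

theorem lintegral_opTrace_rpow_sum_le {ι : Type*} (s : Finset ι) {A : ι → Ω → Op}
    (hA : ∀ j, AEStronglyMeasurable (A j) μ) (hA0 : ∀ j x, 0 ≤ A j x) {r : ℝ} (hr : 1 ≤ r) :
    (∫⁻ x, opTrace ((∑ j ∈ s, A j x) ^ r) ∂μ) ^ (1 / r) ≤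
      ∑ j ∈ s, (∫⁻ x, opTrace (A j x ^ r) ∂μ) ^ (1 / r) := by
  have hr0 : 0 < r := by linarith
  have e : ∀ t : ℝ≥0∞, (t ^ (1 / r)) ^ r = t := fun t => by
    rw [← ENNReal.rpow_mul, one_div, inv_mul_cancel₀ hr0.ne', ENNReal.rpow_one]
  have hm : ∀ j ∈ s, AEMeasurable (fun x => opTrace (A j x ^ r) ^ (1 / r)) μ := fun j _ =>
    (aemeasurable_opTrace (aestronglyMeasurable_rpow (hA j) (hA0 j) hr0)).pow_const _
  have h := lintegral_Lp_finsetSum_le s hm hr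
  simp only [e] at h
  refine le_trans ?_ h
  gcongr with x
  rw [← e (opTrace _)]
  gcongr
  exact opTrace_rpow_sum_le s (fun j => hA0 j x) hr

theorem columnNorm_sq {p : ℝ≥0∞} (hp : p ≠ ∞) (hp0 : p ≠ 0) {N : ℕ} (f : Fin N → Ω → Op) :
    columnNorm p μ f ^ 2 =
      (∫⁻ x, opTrace ((∑ j, star (f j x) * f j x) ^ (p.toReal / 2)) ∂μ) ^
        (1 / (p.toReal / 2)) := by
  have h0 : p.toReal ≠ 0 := (ENNReal.toReal_pos hp0 hp).ne'
  rw [← columnNorm_rpow hp hp0, ← ENNReal.rpow_mul, ← ENNReal.rpow_natCast]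
  congr 1
  push_cast; field_simp

theorem schattenLpNorm_sq {p : ℝ≥0∞} (hp : p ≠ ∞) (hp0 : p ≠ 0) (f : Ω → Op) :
    schattenLpNorm p μ f ^ 2 =
      (∫⁻ x, opTrace ((star (f x) * f x) ^ (p.toReal / 2)) ∂μ) ^ (1 / (p.toReal / 2)) := by
  rw [← columnNorm_one hp hp0, columnNorm_sq hp hp0]
  simp

theorem one_le_toReal_div_two {p : ℝ≥0∞} (hp : 2 ≤ p) (hp' : p ≠ ∞) : 1 ≤ p.toReal / 2 := by
  have := ENNReal.toReal_mono hp' hp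
  simp at this
  linarith

theorem columnNorm_sq_le_sum {p : ℝ≥0∞} (hp : 2 ≤ p) (hp' : p ≠ ∞) {N : ℕ} {f : Fin N → Ω → Op}
    (hf : ∀ j, AEStronglyMeasurable (f j) μ) :
    columnNorm p μ f ^ 2 ≤ ∑ j, schattenLpNorm p μ (f j) ^ 2 := by
  have hp0 : p ≠ 0 := (lt_of_lt_of_le two_pos hp).ne'
  simp only [columnNorm_sq hp' hp0, schattenLpNorm_sq hp' hp0]
  exact lintegral_opTrace_rpow_sum_le _ (A := fun j x => star (f j x) * f j x)
    (fun j => (hf j).star.mul (hf j)) (fun j x => star_mul_self_nonneg _)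
    (one_le_toReal_div_two hp hp')

theorem columnNorm_lt_top {p : ℝ≥0∞} (hp : 2 ≤ p) (hp' : p ≠ ∞) {N : ℕ} {f : Fin N → Ω → Op}
    (hf : ∀ j, MemSchattenLp p μ (f j)) : columnNorm p μ f < ∞ := by
  have h := (columnNorm_sq_le_sum hp hp' fun j => (hf j).1).trans_lt
    (ENNReal.sum_lt_top.2 fun j _ => ENNReal.pow_lt_top (hf j).2)
  by_contra hcon
  rw [not_lt_top_iff.1 hcon] at h
  simp at h

theorem map_intOp {E F : Type*} [NormedAddCommGroup E] [NormedSpace ℂ E] [CompleteSpace E]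
    [NormedAddCommGroup F] [NormedSpace ℂ F] [CompleteSpace F] (L : E →L[ℂ] F) {k : Ω → Ω → ℂ}
    {f : Ω → E} {x : Ω} (hi : Integrable (fun y => k x y • f y) μ) :
    L (intOp μ k f x) = intOp μ k (fun y => L (f y)) x := by
  rw [intOp, ← L.integral_comp_comm hi]
  simp only [map_smul, intOp]

/-- The matrix coefficients of `C_k f` are in `L^p(Ω)`, as `C_k` is bounded on `L^p(Ω)`. -/
theorem memLp_inner_intOp {p : ℝ≥0∞} {k : Ω → Ω → ℂ} (hk : IsBoundedKernel p μ k) {f : Ω → Op}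
    (hf : MemLp f p μ) (ξ η : L2) : MemLp (fun x => ⟪ξ, intOp (E := Op) μ k f x η⟫_ℂ) p μ := by
  let L : Op →L[ℂ] ℂ := (innerSL ℂ ξ).comp (ContinuousLinearMap.apply ℂ L2 η)
  obtain ⟨C, hC⟩ := hk.bounded
  have h1 := (hC _ (L.comp_memLp' hf)).1
  refine MemLp.ae_eq ?_ h1
  filter_upwards [ae_integrable_smul hk.measurable hk.isDefinedOn hf] with x hx
  exact (map_intOp L hx).symm

/-- The column estimate. It only uses the maximal inequality for functions `u` with values in
the corners `P_d B(ℓ²) P_d` for `d` in the range of the sequence `d n`, along which the traces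
`Tr (∑ |T_j f_j|²)^r` have to be approximated. -/
theorem columnNorm_intOp_le {Z : Type*} {p : ℝ≥0∞} (hp : 2 ≤ p) (hp' : p ≠ ∞)
    {k s m : Z → Ω → Ω → ℂ} (hk : ∀ z, IsBoundedKernel p μ (k z))
    (hd : SquareDecomposition (p / (p - 2)) μ k s m)
    {M C : ℝ≥0} (hM : ∀ z x, eLpNorm (s z x) 2 μ ≤ M) {d : ℕ → ℕ}
    (hC : ∀ n, ∀ u : Ω → Op, MemSchattenLp (p / (p - 2)) μ u →
      (∀ x, coordProj (d n) * u x * coordProj (d n) = u x) →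
      opSupNorm (p / (p - 2)) μ (fun z => intOp (E := Op) μ (adjSqKernel (m z)) u) ≤
        C * schattenLpNorm (p / (p - 2)) μ u)
    {N : ℕ} (z : Fin N → Z) {f : Fin N → Ω → Op} (hf : ∀ j, MemSchattenLp p μ (f j))
    (hlim : ∀ x, opTrace ((∑ j, star (intOp (E := Op) μ (k (z j)) (f j) x) *
        intOp (E := Op) μ (k (z j)) (f j) x) ^ (p.toReal / 2)) ≤
      Filter.liminf (fun n => opTrace ((coordProj (d n) *
        (∑ j, star (intOp (E := Op) μ (k (z j)) (f j) x) * intOp (E := Op) μ (k (z j)) (f j) x) *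
        coordProj (d n)) ^ (p.toReal / 2))) Filter.atTop) :
    columnNorm p μ (fun j => intOp (E := Op) μ (k (z j)) (f j)) ≤
      M * (C : ℝ≥0∞) ^ (1 / 2 : ℝ) * columnNorm p μ f := by
  have hp0 : p ≠ 0 := (lt_of_lt_of_le two_pos hp).ne'
  have hqr := holderConjugate_of_two_le hp hp'
  set q := p / (p - 2)
  have hr : p / 2 ≠ ∞ := (ENNReal.div_lt_top hp' two_ne_zero).ne
  have hrr : (p / 2).toReal = p.toReal / 2 := by rw [ENNReal.toReal_div]; simp
  have hr1 := one_le_toReal_div_two hp hp'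
  choose g S hg hfg hS hσ hg0 using fun j => (hf j).exists_stronglyMeasurable hp0 hp'
  have e1 : ∀ j, intOp (E := Op) μ (k (z j)) (f j) = intOp μ (k (z j)) (g j) :=
    fun j => intOp_congr (hfg j) _
  have hg' : ∀ j, MemSchattenLp p μ (g j) := fun j =>
    ⟨(hg j).aestronglyMeasurable, by rw [← schattenLpNorm_congr (hfg j)]; exact (hf j).2⟩
  simp only [e1] at hlim ⊢
  rw [columnNorm_congr hfg]
  set h : Fin N → Ω → Op := fun j => intOp (E := Op) μ (k (z j)) (g j) with hh
  have hhm : ∀ j, StronglyMeasurable (h j) := fun j =>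
    stronglyMeasurable_intOp (hg j) (hg0 j) (hk _).measurable
  obtain ⟨E, hEm, hEμ, hEb, hEx⟩ := exists_exhaustion hp0 hp' hhm fun j i l =>
    memLp_inner_intOp (hk (z j)) ((hg' j).memLp hp0) (stdBasis i) (stdBasis l)
  set W := ∫⁻ x, opTrace ((∑ j, star (g j x) * g j x) ^ (p.toReal / 2)) ∂μ with hWdef
  have hW : W ≠ ∞ := by
    rw [hWdef, ← columnNorm_rpow hp' hp0]
    exact ENNReal.rpow_ne_top_of_nonneg ENNReal.toReal_nonneg (columnNorm_lt_top hp hp' hg').ne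
  have key : ∀ n, ∫⁻ x in E n, opTrace ((coordProj (d n) * (∑ j, star (h j x) * h j x) *
      coordProj (d n)) ^ (p.toReal / 2)) ∂μ ≤
      ((M : ℝ≥0∞) ^ 2 * W ^ (1 / (p.toReal / 2)) * C) ^ (p.toReal / 2) := by
    intro n
    rw [← hrr]
    refine lintegral_opTrace_compression_le hr hqr hhm (hEm n) (hEμ n) (hEb n) ?_
    intro v hv hvE hu hPu
    have : IsFiniteMeasure (μ.restrict (E n)) := isFiniteMeasure_restrict.2 (hEμ n)
    have h1 := sum_lintegral_hsSq_le hr hqr hd ENNReal.coe_ne_top hM z hg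
      (fun j => (hg' j).ae_isCompactOperator hp0 hp') hv hg0 hvE hu (by rw [hrr]; exact hW)
      (ENNReal.mul_ne_top ENNReal.coe_ne_top hu.2.ne) (hC n _ hu hPu)
    rw [hrr] at h1 ⊢
    exact h1.trans (le_of_eq (by ring))
  have hfatou : ∫⁻ x, opTrace ((∑ j, star (h j x) * h j x) ^ (p.toReal / 2)) ∂μ ≤
      ((M : ℝ≥0∞) ^ 2 * W ^ (1 / (p.toReal / 2)) * C) ^ (p.toReal / 2) := by
    set F : ℕ → Ω → ℝ≥0∞ := fun n => (E n).indicator fun x => opTrace ((coordProj (d n) *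
      (∑ j, star (h j x) * h j x) * coordProj (d n)) ^ (p.toReal / 2)) with hF
    have hFm : ∀ n, Measurable (F n) := fun n => by
      refine (measurable_opTrace (stronglyMeasurable_rpow ?_ (fun x => conj_coordProj_nonneg
        (sum_star_mul_nonneg fun j => h j x) _) (by linarith))).indicator (hEm n)
      exact (stronglyMeasurable_const.mul (stronglyMeasurable_sum_star_mul hhm)).mul
        stronglyMeasurable_const
    calc _ ≤ ∫⁻ x, Filter.liminf (fun n => F n x) Filter.atTop ∂μ := by
          refine lintegral_mono fun x => ?_
          by_cases h0 : ∑ j, star (h j x) * h j x = 0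
          · rw [h0, opTrace_zero_rpow (by linarith)]
            exact zero_le
          · refine (hlim x).trans (le_of_eq ?_)
            refine Filter.liminf_congr ?_
            filter_upwards [hEx x h0] with n hn
            simp only [hF, Set.indicator_of_mem hn]
            rfl
      _ ≤ Filter.liminf (fun n => ∫⁻ x, F n x ∂μ) Filter.atTop := lintegral_liminf_le hFm
      _ ≤ Filter.liminf (fun _ : ℕ => ((M : ℝ≥0∞) ^ 2 * W ^ (1 / (p.toReal / 2)) * C) ^
            (p.toReal / 2)) Filter.atTop := by
          refine Filter.liminf_le_liminf (Filter.Eventually.of_forall fun n => ?_)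
          simp only [hF]
          rw [lintegral_indicator (hEm n)]
          exact key n
      _ = _ := Filter.liminf_const _
  have h2 : columnNorm p μ h ^ 2 ≤ (M * (C : ℝ≥0∞) ^ (1 / 2 : ℝ) * columnNorm p μ g) ^ 2 := by
    rw [mul_pow, columnNorm_sq hp' hp0 h, columnNorm_sq hp' hp0 g]
    refine (ENNReal.rpow_le_rpow hfatou (by positivity)).trans (le_of_eq ?_)
    rw [← ENNReal.rpow_mul, mul_one_div_cancel (by linarith), ENNReal.rpow_one, mul_pow,
      ← ENNReal.rpow_natCast (_ ^ _) 2, ← ENNReal.rpow_mul]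
    norm_num
    ring
  exact (ENNReal.pow_le_pow_left_iff two_ne_zero).1 h2

end

/-! ### Random signs, columns and rows -/

theorem rademacherNorm_eq {V : Type*} [AddCommGroup V] (nrm : V → ℝ≥0∞) {N : ℕ} (v : Fin N → V) :
    rademacherNorm nrm v =
      ((∑ ε : Fin N → ℤˣ, nrm (signSum ε v) ^ 2) / 2 ^ N) ^ (1 / 2 : ℝ) := rfl

theorem rademacherNorm_sq {V : Type*} [AddCommGroup V] (nrm : V → ℝ≥0∞) {N : ℕ} (v : Fin N → V) :
    rademacherNorm nrm v ^ 2 = ∑ ε : Fin N → ℤˣ, (2 ^ N)⁻¹ * nrm (signSum ε v) ^ 2 := by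
  rw [rademacherNorm_eq, ← ENNReal.rpow_natCast, ← ENNReal.rpow_mul, ← Finset.mul_sum,
    ENNReal.div_eq_inv_mul]
  norm_num

theorem card_signs (N : ℕ) : (Finset.univ : Finset (Fin N → ℤˣ)).card = 2 ^ N := by
  simp [Finset.card_univ]

theorem sum_inv_two_pow (N : ℕ) : ∑ _ε : Fin N → ℤˣ, ((2 : ℝ≥0∞) ^ N)⁻¹ = 1 := by
  rw [Finset.sum_const, card_signs, nsmul_eq_mul]
  push_cast
  exact ENNReal.mul_inv_cancel (by simp) (by simp)

/-- Orthogonality of the signs: the average of `|∑ ε_j a_j|²` is `∑ |a_j|²`. -/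
theorem sum_star_signSum_mul {N : ℕ} (a : Fin N → Op) :
    ∑ ε : Fin N → ℤˣ, star (signSum ε a) * signSum ε a = 2 ^ N • ∑ j, star (a j) * a j := by
  have h1 : ∀ ε : Fin N → ℤˣ, star (signSum ε a) * signSum ε a =
      ∑ i, ∑ j, (((ε i : ℤˣ) : ℤ) * ((ε j : ℤˣ) : ℤ)) • (star (a i) * a j) := by
    intro ε
    simp only [signSum, star_sum, star_zsmul, Finset.sum_mul_sum, smul_mul_smul_comm]
  simp only [h1]
  rw [Finset.sum_comm, Finset.smul_sum]
  refine Finset.sum_congr rfl fun i _ => ?_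
  rw [Finset.sum_comm, Finset.sum_eq_single i]
  · have h2 : ∀ ε : Fin N → ℤˣ, ((ε i : ℤˣ) : ℤ) * ((ε i : ℤˣ) : ℤ) = 1 := fun ε => by
      rcases Int.units_eq_one_or (ε i) with h | h <;> simp [h]
    simp only [h2, one_smul]
    rw [Finset.sum_const, card_signs]
  · intro j _ hj
    rw [← Finset.sum_smul]
    have h3 : ∑ ε : Fin N → ℤˣ, ((ε i : ℤˣ) : ℤ) * ((ε j : ℤˣ) : ℤ) = 0 := by
      have h4 := sum_flipSign i fun ε : Fin N → ℤˣ => ((ε i : ℤˣ) : ℤ) * ((ε j : ℤˣ) : ℤ)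
      simp only [flipSign, Function.update_self, Function.update_of_ne hj, Units.val_neg,
        neg_mul, Finset.sum_neg_distrib] at h4
      linarith
    rw [h3, zero_smul]
  · simp

theorem signSum_fun_apply {Ω E : Type*} [AddCommGroup E] {N : ℕ} (ε : Fin N → ℤˣ)
    (f : Fin N → Ω → E) (x : Ω) : signSum ε f x = signSum ε fun j => f j x := by
  simp [signSum]

theorem star_signSum {N : ℕ} (ε : Fin N → ℤˣ) (a : Fin N → Op) :
    star (signSum ε a) = signSum ε fun j => star (a j) := by
  rw [signSum, signSum, star_sum]
  exact Finset.sum_congr rfl fun j _ => star_zsmul _ _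

section

variable {Ω : Type*} [MeasurableSpace Ω] {μ : Measure Ω}

theorem aestronglyMeasurable_signSum {N : ℕ} (ε : Fin N → ℤˣ) {f : Fin N → Ω → Op}
    (hf : ∀ j, AEStronglyMeasurable (f j) μ) : AEStronglyMeasurable (signSum ε f) μ :=
  Finset.aestronglyMeasurable_sum _ fun j _ => (hf j).const_smul _

/-- The column norm is at most the average norm of the random sums, as `∑ |f_j|²` is the average of
`|∑ ε_j f_j|²` and `L^{p/2}(Ω, S^{p/2})` satisfies the triangle inequality. -/
theorem columnNorm_le_rademacherNorm {p : ℝ≥0∞} (hp : 2 ≤ p) (hp' : p ≠ ∞) {N : ℕ}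
    {f : Fin N → Ω → Op} (hf : ∀ j, AEStronglyMeasurable (f j) μ) :
    columnNorm p μ f ≤ rademacherNorm (schattenLpNorm p μ) f := by
  have hp0 : p ≠ 0 := (lt_of_lt_of_le two_pos hp).ne'
  have hr := one_le_toReal_div_two hp hp'
  have hr0 : 0 < p.toReal / 2 := by linarith
  refine (ENNReal.pow_le_pow_left_iff two_ne_zero).1 ?_
  have h2 : (0 : ℝ) ≤ (2 ^ N)⁻¹ := by positivity
  have h2' : ENNReal.ofReal ((2 ^ N)⁻¹ : ℝ) = (2 ^ N)⁻¹ := by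
    rw [ENNReal.ofReal_inv_of_pos (by positivity)]
    simp
  have h1 : ∀ x, ∑ j, star (f j x) * f j x =
      ∑ ε : Fin N → ℤˣ, ((2 ^ N)⁻¹ : ℝ) • (star (signSum ε f x) * signSum ε f x) := by
    intro x
    simp only [signSum_fun_apply]
    rw [← Finset.smul_sum, sum_star_signSum_mul, ← Nat.cast_smul_eq_nsmul ℝ, smul_smul]
    push_cast
    rw [inv_mul_cancel₀ (by positivity), one_smul]
  rw [columnNorm_sq hp' hp0, rademacherNorm_sq]
  simp only [h1]
  refine (lintegral_opTrace_rpow_sum_le _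
    (A := fun ε x => ((2 ^ N)⁻¹ : ℝ) • (star (signSum ε f x) * signSum ε f x))
    (fun ε => ((aestronglyMeasurable_signSum ε hf).star.mul
      (aestronglyMeasurable_signSum ε hf)).const_smul ((2 ^ N)⁻¹ : ℝ))
    (fun ε x => smul_nonneg h2 (star_mul_self_nonneg _)) hr).trans (le_of_eq ?_)
  refine Finset.sum_congr rfl fun ε _ => ?_
  rw [schattenLpNorm_sq hp' hp0]
  have h3 : ∀ x, opTrace ((((2 ^ N)⁻¹ : ℝ) • (star (signSum ε f x) * signSum ε f x)) ^
      (p.toReal / 2)) = ((2 ^ N)⁻¹ : ℝ≥0∞) ^ (p.toReal / 2) *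
        opTrace ((star (signSum ε f x) * signSum ε f x) ^ (p.toReal / 2)) := fun x => by
    rw [opTrace_smul_rpow (star_mul_self_nonneg _) h2 hr0.le, h2']
  simp only [h3]
  rw [lintegral_const_mul' _ _ (ENNReal.rpow_ne_top_of_nonneg hr0.le (by simp)),
    ENNReal.mul_rpow_of_nonneg _ _ (by positivity), ← ENNReal.rpow_mul,
    mul_one_div_cancel hr0.ne', ENNReal.rpow_one]

theorem rademacherNorm_star {p : ℝ≥0∞} (hp : 2 ≤ p) {N : ℕ} (f : Fin N → Ω → Op) :
    rademacherNorm (schattenLpNorm p μ) (fun j x => star (f j x)) =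
      rademacherNorm (schattenLpNorm p μ) f := by
  have h : ∀ ε : Fin N → ℤˣ, schattenLpNorm p μ (signSum ε fun j x => star (f j x)) =
      schattenLpNorm p μ (signSum ε f) := by
    intro ε
    rw [← schattenLpNorm_star hp (signSum ε f)]
    congr 1
    funext x
    rw [signSum_fun_apply, signSum_fun_apply, star_signSum]
  rw [rademacherNorm_eq, rademacherNorm_eq]
  simp only [h]

theorem rowNorm_le_rademacherNorm {p : ℝ≥0∞} (hp : 2 ≤ p) (hp' : p ≠ ∞) {N : ℕ}
    {f : Fin N → Ω → Op} (hf : ∀ j, AEStronglyMeasurable (f j) μ) :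
    rowNorm p μ f ≤ rademacherNorm (schattenLpNorm p μ) f := by
  rw [rowNorm_eq_columnNorm_star, ← rademacherNorm_star hp]
  exact columnNorm_le_rademacherNorm hp hp' fun j => (hf j).star

/-- The noncommutative Khintchine inequality in `L^p(Ω, S^p)`. -/
theorem exists_rademacherNorm_le {p : ℝ≥0∞} (hp : 2 ≤ p) (hp' : p ≠ ∞) : ∃ K : ℝ≥0,
    ∀ (N : ℕ) (f : Fin N → Ω → Op), (∀ j, AEStronglyMeasurable (f j) μ) →
      rademacherNorm (schattenLpNorm p μ) f ≤ K * (columnNorm p μ f + rowNorm p μ f) := by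
  have hp0 : p ≠ 0 := (lt_of_lt_of_le two_pos hp).ne'
  have hr := one_le_toReal_div_two hp hp'
  have hpr : 2 ≤ p.toReal := by linarith
  obtain ⟨K, hK⟩ := exists_khintchine hpr
  refine ⟨K ^ (1 / p.toReal), fun N f hf => ?_⟩
  have h1 : rademacherNorm (schattenLpNorm p μ) f ^ p.toReal ≤
      ∑ ε : Fin N → ℤˣ, (2 ^ N)⁻¹ * schattenLpNorm p μ (signSum ε f) ^ p.toReal := by
    have h2 := ENNReal.rpow_arith_mean_le_arith_mean_rpow Finset.univ
      (fun _ : Fin N → ℤˣ => ((2 : ℝ≥0∞) ^ N)⁻¹) (fun ε => schattenLpNorm p μ (signSum ε f) ^ 2)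
      (sum_inv_two_pow N) hr
    rw [← rademacherNorm_sq] at h2
    have e : ∀ t : ℝ≥0∞, (t ^ 2) ^ (p.toReal / 2) = t ^ p.toReal := fun t => by
      rw [← ENNReal.rpow_natCast, ← ENNReal.rpow_mul]
      congr 1
      push_cast; ring
    simpa only [e] using h2
  have hm : ∀ ε : Fin N → ℤˣ, AEMeasurable (fun x => opTrace
      ((star (signSum ε f x) * signSum ε f x) ^ (p.toReal / 2))) μ := fun ε =>
    aemeasurable_opTrace (aestronglyMeasurable_rpow ((aestronglyMeasurable_signSum ε hf).star.mul
      (aestronglyMeasurable_signSum ε hf)) (fun x => star_mul_self_nonneg _) (by linarith))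
  have h3 : ∑ ε : Fin N → ℤˣ, (2 ^ N)⁻¹ * schattenLpNorm p μ (signSum ε f) ^ p.toReal ≤
      K * (columnNorm p μ f ^ p.toReal + rowNorm p μ f ^ p.toReal) := by
    rw [rowNorm_eq_columnNorm_star, columnNorm_rpow hp' hp0, columnNorm_rpow hp' hp0,
      ← Finset.mul_sum]
    simp only [schattenLpNorm_rpow hp' hp0, star_star]
    rw [← lintegral_finsetSum' _ fun ε _ => hm ε, ← lintegral_add_left', ← lintegral_const_mul' _ _
      ENNReal.coe_ne_top, ← lintegral_const_mul' _ _ (by simp)]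
    · refine lintegral_mono fun x => ?_
      simp only [signSum_fun_apply]
      refine (mul_le_mul_right (hK fun j => f j x) _).trans (le_of_eq ?_)
      rw [mul_comm (K : ℝ≥0∞), mul_assoc, ← mul_assoc,
        ENNReal.inv_mul_cancel (by simp) (by simp), one_mul]
    · exact aemeasurable_opTrace (aestronglyMeasurable_rpow (Finset.aestronglyMeasurable_fun_sum _
        fun j _ => (hf j).star.mul (hf j)) (fun x => sum_star_mul_nonneg _) (by linarith))
  have hp1 : 0 < p.toReal := by linarith
  have h4 := ENNReal.rpow_le_rpow (h1.trans h3) (by positivity : 0 ≤ 1 / p.toReal)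
  rw [← ENNReal.rpow_mul, mul_one_div_cancel hp1.ne', ENNReal.rpow_one,
    ENNReal.mul_rpow_of_nonneg _ _ (by positivity)] at h4
  refine h4.trans ?_
  rw [ENNReal.coe_rpow_of_nonneg _ (by positivity)]
  gcongr
  exact ENNReal.rpow_add_rpow_le_add _ _ (by linarith)

/-- Column and row bounds imply a bound of random sums. -/
theorem exists_rademacherNorm_le_of_column_row {p : ℝ≥0∞} (hp : 2 ≤ p) (hp' : p ≠ ∞) :
    ∃ K : ℝ≥0, ∀ (N : ℕ) (h f : Fin N → Ω → Op) (D : ℝ≥0), (∀ j, AEStronglyMeasurable (h j) μ) →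
      (∀ j, AEStronglyMeasurable (f j) μ) → columnNorm p μ h ≤ D * columnNorm p μ f →
      rowNorm p μ h ≤ D * rowNorm p μ f →
      rademacherNorm (schattenLpNorm p μ) h ≤
        (K * D : ℝ≥0) * rademacherNorm (schattenLpNorm p μ) f := by
  obtain ⟨K, hK⟩ := exists_rademacherNorm_le (μ := μ) hp hp'
  refine ⟨2 * K, fun N h f D hh hf hcol hrow => ?_⟩
  calc _ ≤ (K : ℝ≥0∞) * (columnNorm p μ h + rowNorm p μ h) := hK N h hh
    _ ≤ K * (D * rademacherNorm (schattenLpNorm p μ) f +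
        D * rademacherNorm (schattenLpNorm p μ) f) := by
        gcongr
        · exact hcol.trans (by gcongr; exact columnNorm_le_rademacherNorm hp hp' hf)
        · exact hrow.trans (by gcongr; exact rowNorm_le_rademacherNorm hp hp' hf)
    _ = _ := by push_cast; ring

/-! ### Conjugate kernels -/

theorem star_intOp {E : Type*} [NormedAddCommGroup E] [NormedSpace ℂ E] [CompleteSpace E]
    [StarAddMonoid E] [NormedStarGroup E] [StarModule ℂ E] (k : Ω → Ω → ℂ) (f : Ω → E) (x : Ω) :
    star (intOp μ k f x) = intOp μ (fun x y => star (k x y)) (fun y => star (f y)) x := by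
  simp only [intOp, ← star_smul]
  exact ((starL' ℝ : E ≃L[ℝ] E).integral_comp_comm fun y => k x y • f y).symm

theorem IsBoundedKernel.star_kernel {p : ℝ≥0∞} {k : Ω → Ω → ℂ} (hk : IsBoundedKernel p μ k) :
    IsBoundedKernel p μ fun x y => star (k x y) := by
  have hn : ∀ g : Ω → ℂ, eLpNorm (fun x => star (g x)) p μ = eLpNorm g p μ := fun g =>
    eLpNorm_congr_norm_ae (Filter.Eventually.of_forall fun x => norm_star _)
  have e : ∀ g : Ω → ℂ, intOp μ (fun x y => star (k x y)) g =
      fun x => star (intOp μ k (fun y => star (g y)) x) := fun g => by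
    funext x
    rw [star_intOp]
    simp only [star_star]
  refine ⟨continuous_star.measurable.comp hk.measurable, fun g hg => ?_, ?_⟩
  · filter_upwards [hk.isDefinedOn _ hg.star] with x hx
    refine (integrable_norm_iff ?_).1 ?_
    · exact ((continuous_star.measurable.comp
        (hk.measurable.comp measurable_prodMk_left)).aestronglyMeasurable).mul hg.1
    · refine hx.norm.congr (Filter.Eventually.of_forall fun y => ?_)
      simp
  · obtain ⟨C, hC⟩ := hk.bounded
    refine ⟨C, fun g hg => ?_⟩
    obtain ⟨h1, h2⟩ := hC _ hg.star
    rw [e, hn]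
    refine ⟨h1.star, h2.trans_eq ?_⟩
    congr 1
    exact hn g

theorem adjSqKernel_star {Ω : Type*} (m : Ω → Ω → ℂ) :
    adjSqKernel (fun x y => star (m x y)) = adjSqKernel m := by
  funext x y
  simp [adjSqKernel]

theorem SquareDecomposition.star_kernel {Z : Type*} {q : ℝ≥0∞} {k s m : Z → Ω → Ω → ℂ}
    (hd : SquareDecomposition q μ k s m) :
    SquareDecomposition q μ (fun z x y => star (k z x y)) (fun z x y => star (s z x y))
      (fun z x y => star (m z x y)) where
  measurable_s z := continuous_star.measurable.comp (hd.measurable_s z)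
  measurable_m z := continuous_star.measurable.comp (hd.measurable_m z)
  eq_mul z x y := by rw [hd.eq_mul, star_mul']
  square := by
    refine lt_of_le_of_lt (le_of_eq ?_) hd.square
    congr! 4 with z x
    exact eLpNorm_congr_norm_ae (Filter.Eventually.of_forall fun y => norm_star _)
  isDefinedOn z := by
    rw [adjSqKernel_star]
    exact hd.isDefinedOn z

/-! ### Bounds on `L^p(Ω, S^p)` -/

theorem MemSchattenLp.aestronglyMeasurable_intOp {p : ℝ≥0∞} (hp0 : p ≠ 0) (hp' : p ≠ ∞)
    {k : Ω → Ω → ℂ} (hk : Measurable (Function.uncurry k)) {f : Ω → Op}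
    (hf : MemSchattenLp p μ f) : AEStronglyMeasurable (intOp (E := Op) μ k f) μ := by
  obtain ⟨g, S, hg, hfg, hS, hσ, hg0⟩ := hf.exists_stronglyMeasurable hp0 hp'
  rw [intOp_congr hfg]
  exact (stronglyMeasurable_intOp hg hg0 hk).aestronglyMeasurable

theorem SquareDecomposition.exists_bound {Z : Type*} {q : ℝ≥0∞} {k s m : Z → Ω → Ω → ℂ}
    (hd : SquareDecomposition q μ k s m) : ∃ M : ℝ≥0, ∀ z x, eLpNorm (s z x) 2 μ ≤ M := by
  refine ⟨(⨆ z, ⨆ x, eLpNorm (s z x) 2 μ).toNNReal, fun z x => ?_⟩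
  rw [ENNReal.coe_toNNReal hd.square.ne]
  exact le_iSup₂_of_le z x le_rfl

theorem HasSchattenSquareMax.star_kernel {Z : Type*} {q : ℝ≥0∞} {k : Z → Ω → Ω → ℂ}
    (h : HasSchattenSquareMax q μ k) : HasSchattenSquareMax q μ fun z x y => star (k z x y) := by
  obtain ⟨s, m, hd, C, hC⟩ := h
  refine ⟨_, _, hd.star_kernel, C, fun u hu => ?_⟩
  simp only [adjSqKernel_star]
  exact hC u hu

theorem HasSchattenSquareMax.isColBounded {Z : Type*} {p : ℝ≥0∞} (hp : 2 ≤ p) (hp' : p ≠ ∞)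
    {k : Z → Ω → Ω → ℂ} (hk : ∀ z, IsBoundedKernel p μ (k z))
    (h : HasSchattenSquareMax (p / (p - 2)) μ k) :
    IsColBounded p μ fun z => intOp (E := Op) μ (k z) := by
  have hp0 : p ≠ 0 := (lt_of_lt_of_le two_pos hp).ne'
  obtain ⟨s, m, hd, C, hC⟩ := h
  obtain ⟨M, hM⟩ := hd.exists_bound
  refine ⟨M * C ^ (1 / 2 : ℝ), fun N z f hf => ?_⟩
  push_cast
  rw [ENNReal.coe_rpow_of_nonneg _ (by norm_num)]
  refine columnNorm_intOp_le hp hp' hk hd hM (d := fun n => n) (fun n u hu _ => hC u hu) z hf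
    fun x => opTrace_rpow_le_liminf (sum_star_mul_nonneg _) ?_ (one_le_toReal_div_two hp hp')
  exact (compactOperator (RingHom.id ℂ) L2 L2).sum_mem fun j _ => isCompactOperator_mul_left
    (isCompactOperator_intOp ((hf j).ae_isCompactOperator hp0 hp') _ _) _

theorem HasSchattenSquareMax.isRowBounded {Z : Type*} {p : ℝ≥0∞} (hp : 2 ≤ p) (hp' : p ≠ ∞)
    {k : Z → Ω → Ω → ℂ} (hk : ∀ z, IsBoundedKernel p μ (k z))
    (h : HasSchattenSquareMax (p / (p - 2)) μ k) :
    IsRowBounded p μ fun z => intOp (E := Op) μ (k z) := by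
  obtain ⟨C, hC⟩ := h.star_kernel.isColBounded hp hp' fun z => (hk z).star_kernel
  refine ⟨C, fun N z f hf => ?_⟩
  rw [rowNorm_eq_columnNorm_star, rowNorm_eq_columnNorm_star]
  simp only [star_intOp]
  exact hC N z _ fun j => (hf j).star_fun hp

theorem HasSchattenSquareMax.isRBounded {Z : Type*} {p : ℝ≥0∞} (hp : 2 ≤ p) (hp' : p ≠ ∞)
    {k : Z → Ω → Ω → ℂ} (hk : ∀ z, IsBoundedKernel p μ (k z))
    (h : HasSchattenSquareMax (p / (p - 2)) μ k) :
    IsRBounded (MemSchattenLp p μ) (schattenLpNorm p μ) fun z => intOp (E := Op) μ (k z) := by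
  have hp0 : p ≠ 0 := (lt_of_lt_of_le two_pos hp).ne'
  obtain ⟨C, hC⟩ := h.isColBounded hp hp' hk
  obtain ⟨R, hR⟩ := h.isRowBounded hp hp' hk
  obtain ⟨K, hK⟩ := exists_rademacherNorm_le_of_column_row (μ := μ) hp hp'
  refine ⟨K * (max C R), fun N z f hf => hK N _ f _
    (fun j => (hf j).aestronglyMeasurable_intOp hp0 hp' (hk _).measurable) (fun j => (hf j).1) ?_ ?_⟩
  · refine (hC N z f hf).trans ?_
    gcongr
    exact le_max_left _ _
  · refine (hR N z f hf).trans ?_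
    gcongr
    exact le_max_right _ _

theorem HasSchattenSquareMax.tensorBounded {Z : Type*} {p : ℝ≥0∞} (hp : 2 ≤ p) (hp' : p ≠ ∞)
    {k : Z → Ω → Ω → ℂ} (hk : ∀ z, IsBoundedKernel p μ (k z))
    (h : HasSchattenSquareMax (p / (p - 2)) μ k) (z : Z) : TensorBounded p μ (k z) := by
  have hp0 : p ≠ 0 := (lt_of_lt_of_le two_pos hp).ne'
  obtain ⟨C, hC⟩ := h.isColBounded hp hp' hk
  refine ⟨C, fun f hf => ?_⟩
  have h1 := hC 1 (fun _ => z) (fun _ => f) fun _ => hf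
  rw [columnNorm_one hp' hp0, columnNorm_one hp' hp0] at h1
  exact ⟨ae_integrable_smul (hk z).measurable (hk z).isDefinedOn (hf.memLp hp0),
    ⟨hf.aestronglyMeasurable_intOp hp0 hp' (hk z).measurable,
      h1.trans_lt (ENNReal.mul_lt_top ENNReal.coe_lt_top hf.2)⟩, h1⟩

end

/-! ### Scalar functions as functions with values in a corner of rank one -/

theorem coordProj_one_apply (x : L2) :
    coordProj 1 x = ⟪stdBasis 0, x⟫_ℂ • stdBasis 0 := by
  simp [coordProj_apply]

theorem coordProj_nonneg (d : ℕ) : 0 ≤ coordProj d := by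
  have h := star_mul_self_nonneg (coordProj d)
  rwa [star_coordProj, coordProj_mul_self] at h

theorem opTrace_coordProj_one_rpow {r : ℝ} (hr : 0 < r) : opTrace (coordProj 1 ^ r) = 1 := by
  have h : ∀ i, coordProj 1 (stdBasis i) = (((if i = 0 then 1 else 0 : ℝ)) : ℂ) • stdBasis i := by
    intro i
    rw [coordProj_stdBasis]
    rcases Nat.eq_zero_or_pos i with h | h
    · simp [h]
    · rw [if_neg (by omega), if_neg (by omega)]
      simp
  rw [opTrace_rpow_eq_tsum stdBasis (coordProj_nonneg 1) h hr.le, tsum_eq_single 0]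
  · simp
  · intro i hi
    simp [hi, hr]

theorem norm_coordProj_one : ‖coordProj 1‖ = 1 := by
  refine le_antisymm (norm_coordProj_le 1) ?_
  have h := (coordProj 1).le_opNorm (stdBasis 0)
  rw [coordProj_stdBasis, if_pos one_pos, norm_stdBasis, mul_one] at h
  exact h

theorem star_smul_coordProj_mul (c : ℂ) :
    star (c • coordProj 1) * (c • coordProj 1) = (‖c‖ ^ 2 : ℝ) • coordProj 1 := by
  rw [star_smul, star_coordProj, smul_mul_smul_comm, coordProj_mul_self]
  have h : star c * c = ((‖c‖ ^ 2 : ℝ) : ℂ) := by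
    push_cast
    exact Complex.conj_mul' c
  rw [h]
  exact Complex.coe_smul _ _

theorem schattenNorm_smul_coordProj {p : ℝ≥0∞} (hp0 : p ≠ 0) (c : ℂ) :
    schattenNorm p (c • coordProj 1) = ‖c‖ₑ := by
  by_cases hp : p = ∞
  · rw [schattenNorm, if_pos hp, enorm_smul, ← ofReal_norm (coordProj 1), norm_coordProj_one]
    simp
  · have h0 : 0 < p.toReal := ENNReal.toReal_pos hp0 hp
    refine ENNReal.rpow_left_injective h0.ne' ?_
    beta_reduce
    rw [schattenNorm_rpow hp hp0, star_smul_coordProj_mul,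
      opTrace_smul_rpow (coordProj_nonneg 1) (by positivity) (by positivity),
      opTrace_coordProj_one_rpow (by positivity), mul_one, ← enorm_sq_eq_ofReal,
      ← ENNReal.rpow_natCast, ← ENNReal.rpow_mul]
    congr 1
    push_cast; ring

theorem coordProj_mul_mul_coordProj (A : Op) :
    coordProj 1 * A * coordProj 1 = ⟪stdBasis 0, A (stdBasis 0)⟫_ℂ • coordProj 1 := by
  refine ContinuousLinearMap.ext fun x => ?_
  simp only [mul_apply_eq_comp, smul_apply, coordProj_one_apply, map_smul,
    smul_smul]
  rw [mul_comm]

section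

variable {Ω : Type*} [MeasurableSpace Ω] {μ : Measure Ω}

theorem schattenLpNorm_smul_coordProj {p : ℝ≥0∞} (hp0 : p ≠ 0) (φ : Ω → ℂ) :
    schattenLpNorm p μ (fun x => φ x • coordProj 1) = eLpNorm φ p μ := by
  rw [schattenLpNorm]
  simp only [schattenNorm_smul_coordProj hp0]
  exact eLpNorm_enorm φ

theorem memSchattenLp_smul_coordProj {p : ℝ≥0∞} (hp0 : p ≠ 0) {φ : Ω → ℂ} (hφ : MemLp φ p μ) :
    MemSchattenLp p μ (fun x => φ x • coordProj 1) :=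
  ⟨hφ.1.smul_const _, by rw [schattenLpNorm_smul_coordProj hp0]; exact hφ.2⟩

theorem eLpNorm_top_enorm_smul_coordProj (φ : Ω → ℂ) :
    eLpNorm (fun x => ‖φ x • coordProj 1‖ₑ) ∞ μ = eLpNorm φ ∞ μ := by
  have h := schattenLpNorm_smul_coordProj (μ := μ) ENNReal.top_ne_zero φ
  simpa only [schattenLpNorm, schattenNorm, if_true] using h

/-- A factorization of scalar functions is one of multiples of the projection. -/
theorem opSupNorm_smul_coordProj_le {Z : Type*} {q : ℝ≥0∞} (hq : q ≠ 0) (X : Z → Ω → ℂ) :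
    opSupNorm q μ (fun z x => X z x • coordProj 1) ≤ scalarSupNorm q μ X := by
  have hq2 : 2 * q ≠ 0 := by simp [hq]
  refine le_iInf fun a => le_iInf fun b => le_iInf fun y => le_iInf fun h => ?_
  have hfac : OpFactorization q μ (fun z x => X z x • coordProj 1) (fun x => a x • coordProj 1)
      (fun x => b x • coordProj 1) (fun z x => y z x • coordProj 1) := by
    refine ⟨memSchattenLp_smul_coordProj hq2 h.left_mem, memSchattenLp_smul_coordProj hq2 h.right_mem,
      fun z => ⟨fun ξ η => ?_, ?_⟩, ?_, fun z => ?_⟩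
    · simp only [smul_apply, inner_smul_right]
      exact (h.mid_mem z).1.mul_const _
    · rw [eLpNorm_top_enorm_smul_coordProj]
      exact (h.mid_mem z).2
    · simp only [eLpNorm_top_enorm_smul_coordProj]
      exact h.mid_bounded
    · filter_upwards [h.eq_mul z] with x hx
      rw [hx, smul_mul_smul_comm, smul_mul_smul_comm, coordProj_mul_self, coordProj_mul_self]
  have h1 : opSupNorm q μ (fun z x => X z x • coordProj 1) ≤ _ :=
    iInf₂_le_of_le _ _ (iInf₂_le_of_le _ hfac le_rfl)
  refine h1.trans (le_of_eq ?_)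
  simp only [schattenLpNorm_smul_coordProj hq2, eLpNorm_top_enorm_smul_coordProj]

theorem rademacherNorm_smul_coordProj {p : ℝ≥0∞} (hp0 : p ≠ 0) {N : ℕ} (φ : Fin N → Ω → ℂ) :
    rademacherNorm (schattenLpNorm p μ) (fun j x => φ j x • coordProj 1) =
      rademacherNorm (fun f : Ω → ℂ => eLpNorm f p μ) φ := by
  have h : ∀ ε : Fin N → ℤˣ, schattenLpNorm p μ (signSum ε fun j x => φ j x • coordProj 1) =
      eLpNorm (signSum ε φ) p μ := by
    intro ε
    rw [← schattenLpNorm_smul_coordProj hp0]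
    congr 1
    funext x
    rw [signSum_fun_apply, signSum_fun_apply, signSum, signSum, Finset.sum_smul]
    exact Finset.sum_congr rfl fun j _ => (smul_assoc _ _ _).symm
  rw [rademacherNorm_eq, rademacherNorm_eq]
  simp only [h]

theorem HasSquareMax.star_kernel {Z : Type*} {q : ℝ≥0∞} {k : Z → Ω → Ω → ℂ}
    (h : HasSquareMax q μ k) : HasSquareMax q μ fun z x y => star (k z x y) := by
  obtain ⟨s, m, hd, C, hC⟩ := h
  refine ⟨_, _, hd.star_kernel, C, fun u hu => ?_⟩
  simp only [adjSqKernel_star]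
  exact hC u hu

/-- The column estimate for scalar functions: all functions `u` involved take values in the corner
`P_1 B(ℓ²) P_1`, where the scalar maximal inequality suffices. -/
theorem HasSquareMax.exists_columnNorm_le {Z : Type*} {p : ℝ≥0∞} (hp : 2 ≤ p) (hp' : p ≠ ∞)
    {k : Z → Ω → Ω → ℂ} (hk : ∀ z, IsBoundedKernel p μ (k z))
    (h : HasSquareMax (p / (p - 2)) μ k) :
    ∃ C : ℝ≥0, ∀ (N : ℕ) (z : Fin N → Z) (φ : Fin N → Ω → ℂ), (∀ j, MemLp (φ j) p μ) →
      columnNorm p μ (fun j x => intOp μ (k (z j)) (φ j) x • coordProj 1) ≤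
        C * columnNorm p μ (fun j x => φ j x • coordProj 1) := by
  have hp0 : p ≠ 0 := (lt_of_lt_of_le two_pos hp).ne'
  have hq0 := (holderConjugate_of_two_le hp hp').ne_zero
  obtain ⟨s, m, hd, C, hC⟩ := h
  obtain ⟨M, hM⟩ := hd.exists_bound
  refine ⟨M * C ^ (1 / 2 : ℝ), fun N z φ hφ => ?_⟩
  push_cast
  rw [ENNReal.coe_rpow_of_nonneg _ (by norm_num)]
  have e : (fun j x => intOp μ (k (z j)) (φ j) x • coordProj 1) =
      fun j => intOp (E := Op) μ (k (z j)) (fun y => φ j y • coordProj 1) := by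
    funext j x
    rw [intOp_smul_const]
  rw [e]
  refine columnNorm_intOp_le hp hp' hk hd hM (d := fun _ => 1) (fun _ u hu hPu => ?_) z
    (fun j => memSchattenLp_smul_coordProj hp0 (hφ j)) fun x => ?_
  · set ψ : Ω → ℂ := fun x => ⟪stdBasis 0, u x (stdBasis 0)⟫_ℂ with hψ
    have hu' : u = fun x => ψ x • coordProj 1 := by
      funext x
      rw [hψ, ← coordProj_mul_mul_coordProj, hPu]
    have hψm : AEStronglyMeasurable ψ μ :=
      ((innerSL ℂ (stdBasis 0)).comp
        (ContinuousLinearMap.apply ℂ L2 (stdBasis 0))).continuous.comp_aestronglyMeasurable hu.1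
    have hn : schattenLpNorm (p / (p - 2)) μ u = eLpNorm ψ (p / (p - 2)) μ := by
      rw [hu', schattenLpNorm_smul_coordProj hq0]
    have h1 := hC ψ ⟨hψm, by rw [← hn]; exact hu.2⟩
    rw [hn]
    refine le_trans ?_ h1
    refine le_trans (le_of_eq ?_) (opSupNorm_smul_coordProj_le hq0 _)
    congr 1
    funext z x
    rw [hu', intOp_smul_const]
  · rw [Filter.liminf_const]
    refine le_of_eq ?_
    congr 2
    simp only [intOp_smul_const, star_smul_coordProj_mul]
    rw [Finset.mul_sum, Finset.sum_mul]
    refine Finset.sum_congr rfl fun j _ => ?_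
    rw [mul_smul_comm, smul_mul_assoc, coordProj_mul_self, coordProj_mul_self]

theorem HasSquareMax.isRBounded {Z : Type*} {p : ℝ≥0∞} (hp : 2 ≤ p) (hp' : p ≠ ∞)
    {k : Z → Ω → Ω → ℂ} (hk : ∀ z, IsBoundedKernel p μ (k z))
    (h : HasSquareMax (p / (p - 2)) μ k) :
    IsRBounded (fun f : Ω → ℂ => MemLp f p μ) (fun f : Ω → ℂ => eLpNorm f p μ)
      fun z => intOp (E := ℂ) μ (k z) := by
  have hp0 : p ≠ 0 := (lt_of_lt_of_le two_pos hp).ne'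
  obtain ⟨C, hC⟩ := h.exists_columnNorm_le hp hp' hk
  obtain ⟨R, hR⟩ := h.star_kernel.exists_columnNorm_le hp hp' fun z => (hk z).star_kernel
  obtain ⟨K, hK⟩ := exists_rademacherNorm_le_of_column_row (μ := μ) hp hp'
  refine ⟨K * (max C R), fun N z φ hφ => ?_⟩
  rw [← rademacherNorm_smul_coordProj hp0, ← rademacherNorm_smul_coordProj hp0]
  have hTφ : ∀ j, AEStronglyMeasurable (intOp μ (k (z j)) (φ j)) μ := fun j => by
    obtain ⟨_, hB⟩ := (hk (z j)).bounded
    exact (hB _ (hφ j)).1.1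
  refine hK N _ _ _ (fun j => (hTφ j).smul_const _) (fun j => (hφ j).1.smul_const _) ?_ ?_
  · refine (hC N z φ hφ).trans ?_
    gcongr
    exact le_max_left _ _
  · rw [rowNorm_eq_columnNorm_star, rowNorm_eq_columnNorm_star]
    have h1 := hR N z (fun j y => star (φ j y)) fun j => (hφ j).star
    simp only [star_smul, star_coordProj, star_intOp]
    refine h1.trans ?_
    gcongr
    exact le_max_right _ _

end

end SquareMax

theorem theorem9p4 {Ω Z : Type*} [MeasurableSpace Ω] (μ : Measure Ω)
    (p : ℝ≥0∞) (hp : 2 ≤ p) (hp' : p ≠ ∞)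
    (k : Z → Ω → Ω → ℂ) (hk : ∀ z, SquareMax.IsBoundedKernel p μ (k z)) :
    (SquareMax.HasSchattenSquareMax (p / (p - 2)) μ k →
      (∀ z, SquareMax.TensorBounded p μ (k z)) ∧
      SquareMax.IsColBounded p μ (fun z => SquareMax.intOp (E := SquareMax.Op) μ (k z)) ∧
      SquareMax.IsRowBounded p μ (fun z => SquareMax.intOp (E := SquareMax.Op) μ (k z)) ∧
      SquareMax.IsRBounded (SquareMax.MemSchattenLp p μ) (SquareMax.schattenLpNorm p μ)
        (fun z => SquareMax.intOp (E := SquareMax.Op) μ (k z))) ∧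
    (SquareMax.HasSquareMax (p / (p - 2)) μ k →
      SquareMax.IsRBounded (fun f : Ω → ℂ => MemLp f p μ) (fun f : Ω → ℂ => eLpNorm f p μ)
        (fun z => SquareMax.intOp (E := ℂ) μ (k z))) :=
  ⟨fun h => ⟨h.tensorBounded hp hp' hk, h.isColBounded hp hp' hk, h.isRowBounded hp hp' hk,
    h.isRBounded hp hp' hk⟩, fun h => h.isRBounded hp hp' hk⟩
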